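/- Let $\alpha\in[0,1)$, $C_\alpha:=\frac{\alpha(2+\alpha)}{4}$, and let $A_\alpha(0):=-\frac{d^2}{dx^2}+\frac{C_\alpha}{x^2}$ with domain $\mathcal D(A_\alpha(0)):=C_c^\infty(\mathbb R^+)$, a densely defined non-negative symmetric operator in the complex Hilbert space $L^2(\mathbb R^+)$, $\mathbb R^+=(0,\infty)$. Let $A_{\alpha,F}(0)$ be its Friedrichs extension. With the modified Bessel functions $I_\nu,K_\nu$ put $$\Phi_{\alpha,0}(x):=\sqrt x\,K_{\frac{1+\alpha}2}(x),\qquad F_{\alpha,0}(x):=\sqrt x\,I_{\frac{1+\alpha}2}(x),$$ $$G_{\alpha,0}(r,\rho):=\begin{cases}\Phi_{\alpha,0}(r)F_{\alpha,0}(\rho)&0<\rho<r,\\ F_{\alpha,0}(r)\Phi_{\alpha,0}(\rho)&0<r<\rho,\end{cases}\qquad \Psi_{\alpha,0}(x):=\int_0^{\infty}G_{\alpha,0}(x,\rho)\,\Phi_{\alpha,0}(\rho)\,d\rho .$$ (i) The adjoint of $A_\alpha(0)$ acts as $-\frac{d^2}{dx^2}+\frac{C_\alpha}{x^2}$ (with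 the derivative in the weak sense), and $$\mathcal D(A_\alpha(0)^*)=\Big\{g\in L^2(\mathbb R^+)\,:\,\Big(-\frac{d^2}{dx^2}+\frac{\alpha(2+\alpha)}{4x^2}\Big)g\in L^2(\mathbb R^+)\Big\}=\mathcal D(\overline{A_\alpha(0)})\dotplus\mathrm{span}\{\Psi_{\alpha,0}\}\dotplus\mathrm{span}\{\Phi_{\alpha,0}\}$$ (direct sum), where $\Phi_{\alpha,0}$ and $\Psi_{\alpha,0}$ are smooth on $\mathbb R^+$ and square-integrable. Moreover $\ker(A_\alpha(0)^*+\mathbb 1)=\mathrm{span}\{\Phi_{\alpha,0}\}$. (ii) The self-adjoint extensions of $A_\alpha(0)$ in $L^2(\mathbb R^+)$ form a family $\{A_\alpha^{[\gamma]}(0)\,:\,\gamma\in\mathbb R\cup\{\infty\}\}$. The extension with $\gamma=\infty$ is the Friedrichs extension $A_{\alpha,F}(0)$. Its domain is $$\mathcal D(A_{\alpha,F}(0))=\mathcal D(\overline{A_\alpha(0)})+\mathrm{span}\{x^{1+\frac\alpha2}P\}$$ for every $P\in C_c^\infty([0,\infty))$ with $P(0)=1$. Moreover $A_{\alpha,F}(0)+\mathbb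 1$ is injective and $(A_{\alpha,F}(0)+\mathbb 1)^{-1}$ is the everywhere defined and bounded integral operator on $L^2(\mathbb R^+)$ with kernel $G_{\alpha,0}$. For $\gamma\in\mathbb R$, $$\mathcal D(A_\alpha^{[\gamma]}(0))=\Big\{g\in\mathcal D(A_\alpha(0)^*)\,:\,g(x)=g_0x^{-\frac\alpha2}+\gamma g_0x^{1+\frac\alpha2}+o(x^{\frac32})\ \text{as }x\downarrow0\ \text{for some }g_0\in\mathbb C\Big\},$$ the asymptotics being that of the continuous representative of $g$. -/

import Mathlib

open MeasureTheory Set Filter Topology Asymptotics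
open scoped ContDiff InnerProductSpace Distributions LinearPMap

noncomputable section

/-! ### Nonnegative operators in a Hilbert space and their Friedrichs extension -/

section Abstract

variable {H : Type*} [NormedAddCommGroup H] [InnerProductSpace ℂ H]

/-- The quadratic form `u ↦ Re ⟪u, A u⟫` of an operator `A`, on the domain of `A`. -/
def operatorForm (A : H →ₗ.[ℂ] H) (u : A.domain) : ℝ := (⟪(u : H), A u⟫_ℂ).re

/-- `A` is a nonnegative operator. -/
def IsNonnegOperator (A : H →ₗ.[ℂ] H) : Prop := ∀ u : A.domain, 0 ≤ operatorForm A u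

theorem operatorForm_add_le {A : H →ₗ.[ℂ] H} (hA : IsNonnegOperator A) (u v : A.domain) :
    operatorForm A (u + v) ≤ 2 * operatorForm A u + 2 * operatorForm A v := by
  have h := hA (u - v)
  have e : operatorForm A (u + v) + operatorForm A (u - v)
      = 2 * operatorForm A u + 2 * operatorForm A v := by
    simp only [operatorForm, LinearPMap.map_add, LinearPMap.map_sub, Submodule.coe_add,
      Submodule.coe_sub, inner_add_left, inner_add_right, inner_sub_left, inner_sub_right,
      Complex.add_re, Complex.sub_re]
    ring
  linarith

theorem operatorForm_smul (A : H →ₗ.[ℂ] H) (c : ℂ) (u : A.domain) :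
    operatorForm A (c • u) = ‖c‖ ^ 2 * operatorForm A u := by
  simp only [operatorForm, LinearPMap.map_smul, Submodule.coe_smul, inner_smul_left,
    inner_smul_right]
  rw [← mul_assoc, Complex.mul_conj', ← Complex.ofReal_pow, Complex.re_ofReal_mul]

/-- The domain of the closure of the quadratic form of a nonnegative operator `A`: the limits in
`H` of those sequences in `D(A)` that are Cauchy for the form norm
`(⟪u, A u⟫ + ‖u‖ ^ 2) ^ (1 / 2)`. -/
def closedFormDomain (A : H →ₗ.[ℂ] H) (hA : IsNonnegOperator A) : Submodule ℂ H where
  carrier := {u | ∃ s : ℕ → A.domain, Tendsto (fun n => (s n : H)) atTop (𝓝 u) ∧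
    Tendsto (fun p : ℕ × ℕ => operatorForm A (s p.1 - s p.2)) atTop (𝓝 0)}
  zero_mem' := ⟨fun _ => 0, by simp, by simp [operatorForm]⟩
  add_mem' := by
    rintro u v ⟨s, hs, hs'⟩ ⟨t, ht, ht'⟩
    refine ⟨fun n => s n + t n, by simpa using hs.add ht, ?_⟩
    have hlim : Tendsto (fun p : ℕ × ℕ => 2 * operatorForm A (s p.1 - s p.2)
        + 2 * operatorForm A (t p.1 - t p.2)) atTop (𝓝 0) := by
      simpa using (hs'.const_mul 2).add (ht'.const_mul 2)
    refine squeeze_zero (fun p => hA _) (fun p => ?_) hlim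
    have : s p.1 + t p.1 - (s p.2 + t p.2) = (s p.1 - s p.2) + (t p.1 - t p.2) := by abel
    rw [this]
    exact operatorForm_add_le hA _ _
  smul_mem' := by
    rintro c u ⟨s, hs, hs'⟩
    refine ⟨fun n => c • s n, by simpa using hs.const_smul c, ?_⟩
    simp only [← smul_sub, operatorForm_smul]
    simpa using hs'.const_mul (‖c‖ ^ 2)

/-- The Friedrichs extension of a densely defined symmetric nonnegative operator `A`: the
restriction of `A†` to the elements of `D(A†)` that belong to the closed form domain. -/
def friedrichsExtension [CompleteSpace H] (A : H →ₗ.[ℂ] H) (hA : IsNonnegOperator A) :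
    H →ₗ.[ℂ] H :=
  A†.domRestrict (closedFormDomain A hA)

/-- The operator `A + 1`, with the same domain as `A`. -/
def shiftByOne (A : H →ₗ.[ℂ] H) : H →ₗ.[ℂ] H := (LinearMap.id : H →ₗ[ℂ] H) +ᵥ A

/-- The kernel of an operator `A`, as a subspace of the ambient space. -/
def operatorKer (A : H →ₗ.[ℂ] H) : Submodule ℂ H :=
  (LinearMap.ker A.toFun).map A.domain.subtype

end Abstract

/-! ### The operator on the half-line -/

/-- Lebesgue measure on the half-line `(0, ∞)`. -/
abbrev halfLineMeasure : Measure ℝ := volume.restrict (Ioi (0 : ℝ))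

/-- The Hilbert space `L²((0, ∞))` of complex-valued functions. -/
abbrev HalfLineL2 : Type := Lp ℂ 2 halfLineMeasure

/-- The open half-line `(0, ∞)`. -/
def halfLine : TopologicalSpace.Opens ℝ := ⟨Ioi 0, isOpen_Ioi⟩

/-- The coupling constant of the inverse square potential. -/
def couplingConst (α : ℝ) : ℝ := α * (2 + α) / 4

/-- The classical action of `-d²/dx² + C_α / x²`. -/
def besselAction (α : ℝ) (φ : ℝ → ℂ) (x : ℝ) : ℂ :=
  -deriv (deriv φ) x + ((couplingConst α / x ^ 2 : ℝ) : ℂ) * φ x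

theorem testFunction_memLp (φ : 𝓓(halfLine, ℂ)) : MemLp φ 2 halfLineMeasure :=
  (φ.continuous.memLp_of_hasCompactSupport φ.hasCompactSupport).restrict _

theorem testFunction_deriv_contDiff (φ : 𝓓(halfLine, ℂ)) : ContDiff ℝ ∞ (deriv φ) :=
  ((contDiff_infty_iff_deriv (f := (φ : ℝ → ℂ))).1 φ.contDiff).2

theorem testFunction_differentiable (φ : 𝓓(halfLine, ℂ)) : Differentiable ℝ φ :=
  ((contDiff_infty_iff_deriv (f := (φ : ℝ → ℂ))).1 φ.contDiff).1

theorem testFunction_deriv_differentiable (φ : 𝓓(halfLine, ℂ)) : Differentiable ℝ (deriv φ) :=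
  (contDiff_infty_iff_deriv.1 (testFunction_deriv_contDiff φ)).1

theorem testFunction_deriv2_continuous (φ : 𝓓(halfLine, ℂ)) : Continuous (deriv (deriv φ)) :=
  (contDiff_infty_iff_deriv.1 (testFunction_deriv_contDiff φ)).2.continuous

theorem testFunction_potential_continuous (α : ℝ) (φ : 𝓓(halfLine, ℂ)) :
    Continuous (fun x => ((couplingConst α / x ^ 2 : ℝ) : ℂ) * φ x) := by
  refine continuous_of_tsupport (fun x hx => ?_)
  have hx' : x ∈ tsupport φ := tsupport_mul_subset_right hx
  have hx0 : (0 : ℝ) < x := φ.tsupport_subset hx'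
  have h1 : ContinuousAt (fun x : ℝ => couplingConst α / x ^ 2) x :=
    continuousAt_const.div (by fun_prop) (by positivity)
  exact (Complex.continuous_ofReal.continuousAt.comp h1).mul φ.continuous.continuousAt

theorem besselAction_continuous (α : ℝ) (φ : 𝓓(halfLine, ℂ)) :
    Continuous (besselAction α φ) :=
  (testFunction_deriv2_continuous φ).neg.add (testFunction_potential_continuous α φ)

theorem besselAction_hasCompactSupport (α : ℝ) (φ : 𝓓(halfLine, ℂ)) :
    HasCompactSupport (besselAction α φ) :=
  φ.hasCompactSupport.deriv.deriv.neg.add φ.hasCompactSupport.mul_left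

theorem besselAction_memLp (α : ℝ) (φ : 𝓓(halfLine, ℂ)) :
    MemLp (besselAction α φ) 2 halfLineMeasure :=
  ((besselAction_continuous α φ).memLp_of_hasCompactSupport
    (besselAction_hasCompactSupport α φ)).restrict _

theorem besselAction_add (α : ℝ) (φ ψ : 𝓓(halfLine, ℂ)) :
    besselAction α ⇑(φ + ψ) = besselAction α φ + besselAction α ψ := by
  have h1 : deriv (⇑(φ + ψ)) = deriv φ + deriv ψ := by
    funext x
    exact deriv_add (testFunction_differentiable φ x) (testFunction_differentiable ψ x)
  funext x
  have h2 : deriv (deriv φ + deriv ψ) x = deriv (deriv φ) x + deriv (deriv ψ) x :=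
    deriv_add (testFunction_deriv_differentiable φ x) (testFunction_deriv_differentiable ψ x)
  have h3 : (φ + ψ) x = φ x + ψ x := rfl
  simp only [besselAction, h1, h2, h3, Pi.add_apply]
  ring

theorem besselAction_smul (α : ℝ) (c : ℂ) (φ : 𝓓(halfLine, ℂ)) :
    besselAction α ⇑(c • φ) = c • besselAction α φ := by
  have h1 : deriv (⇑(c • φ)) = c • deriv φ := by
    funext x
    exact deriv_const_smul c (testFunction_differentiable φ x)
  funext x
  have h2 : deriv (c • deriv φ) x = c • deriv (deriv φ) x :=
    deriv_const_smul c (testFunction_deriv_differentiable φ x)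
  have h3 : (c • φ) x = c • φ x := rfl
  simp only [besselAction, h1, h2, h3, Pi.smul_apply, smul_eq_mul]
  ring

/-- The inclusion of the test functions into `L²((0, ∞))`. -/
def testToL2 : 𝓓(halfLine, ℂ) →ₗ[ℂ] HalfLineL2 where
  toFun φ := (testFunction_memLp φ).toLp φ
  map_add' _ _ := rfl
  map_smul' _ _ := rfl

/-- The classical action of `-d²/dx² + C_α / x²` on test functions, with values in
`L²((0, ∞))`. -/
def besselActionL2 (α : ℝ) : 𝓓(halfLine, ℂ) →ₗ[ℂ] HalfLineL2 where
  toFun φ := (besselAction_memLp α φ).toLp (besselAction α φ)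
  map_add' φ ψ := by
    rw [← MemLp.toLp_add]
    exact MemLp.toLp_congr _ _ (by rw [besselAction_add])
  map_smul' c φ := by
    rw [RingHom.id_apply, ← MemLp.toLp_const_smul]
    exact MemLp.toLp_congr _ _ (by rw [besselAction_smul])

theorem testToL2_injective : Function.Injective testToL2 := by
  intro φ ψ h
  have h1 : (φ : ℝ → ℂ) =ᵐ[halfLineMeasure] ψ :=
    (MemLp.toLp_eq_toLp_iff (testFunction_memLp φ) (testFunction_memLp ψ)).1 h
  have h2 : EqOn φ ψ (Ioi 0) :=
    Measure.eqOn_open_of_ae_eq h1 isOpen_Ioi φ.continuous.continuousOn ψ.continuous.continuousOn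
  ext x
  by_cases hx : x ∈ Ioi (0 : ℝ)
  · exact h2 hx
  · rw [image_eq_zero_of_notMem_tsupport fun hm => hx (φ.tsupport_subset hm),
      image_eq_zero_of_notMem_tsupport fun hm => hx (ψ.tsupport_subset hm)]

/-- The minimally defined operator `A_α(0) = -d²/dx² + C_α / x²` in `L²((0, ∞))`, with domain
`C_c^∞((0, ∞))`. -/
def zeroModeOperator (α : ℝ) : HalfLineL2 →ₗ.[ℂ] HalfLineL2 where
  domain := LinearMap.range testToL2
  toFun := (besselActionL2 α).comp
    (LinearEquiv.ofInjective testToL2 testToL2_injective).symm.toLinearMap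

theorem zeroModeOperator_apply (α : ℝ) (φ : 𝓓(halfLine, ℂ)) :
    zeroModeOperator α ⟨testToL2 φ, LinearMap.mem_range_self _ φ⟩ = besselActionL2 α φ := by
  change besselActionL2 α ((LinearEquiv.ofInjective testToL2 testToL2_injective).symm _) = _
  exact congrArg (besselActionL2 α)
    ((LinearEquiv.ofInjective testToL2 testToL2_injective).symm_apply_apply φ)

theorem zeroModeOperator_nonneg {α : ℝ} (hα : 0 ≤ α) : IsNonnegOperator (zeroModeOperator α) := by
  rintro ⟨_, φ, rfl⟩
  rw [operatorForm, zeroModeOperator_apply, L2.inner_def]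
  have e1 : ∫ x, ⟪testToL2 φ x, besselActionL2 α φ x⟫_ℂ ∂halfLineMeasure
      = ∫ x, ⟪φ x, besselAction α φ x⟫_ℂ := by
    have : ∫ x, ⟪testToL2 φ x, besselActionL2 α φ x⟫_ℂ ∂halfLineMeasure
        = ∫ x, ⟪φ x, besselAction α φ x⟫_ℂ ∂halfLineMeasure := by
      refine integral_congr_ae ?_
      filter_upwards [(testFunction_memLp φ).coeFn_toLp, (besselAction_memLp α φ).coeFn_toLp]
        with x h1 h2
      change ⟪(testFunction_memLp φ).toLp φ x,
        (besselAction_memLp α φ).toLp (besselAction α φ) x⟫_ℂ = _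
      rw [h1, h2]
    rw [this]
    refine setIntegral_eq_integral_of_forall_compl_eq_zero fun x hx => ?_
    rw [image_eq_zero_of_notMem_tsupport fun hm => hx (φ.tsupport_subset hm), inner_zero_left]
  have hd : ContDiff ℝ ∞ (deriv φ) := testFunction_deriv_contDiff φ
  have cs := φ.hasCompactSupport
  have hconj : Continuous fun x => star (φ x) := continuous_star.comp φ.continuous
  have csconj : HasCompactSupport fun x => star (φ x) := cs.comp_left (star_zero _)
  have i1 : Integrable (fun x => star (φ x) * deriv (deriv φ) x) :=
    (hconj.mul (testFunction_deriv2_continuous φ)).integrable_of_hasCompactSupport csconj.mul_right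
  have i2 : Integrable (fun x => star (deriv φ x) * deriv φ x) :=
    ((continuous_star.comp hd.continuous).mul hd.continuous).integrable_of_hasCompactSupport
      cs.deriv.mul_left
  have i3 : Integrable (fun x => star (φ x) * deriv φ x) :=
    (hconj.mul hd.continuous).integrable_of_hasCompactSupport csconj.mul_right
  have i4 : Integrable (fun x => star (φ x) * (((couplingConst α / x ^ 2 : ℝ) : ℂ) * φ x)) :=
    (hconj.mul (testFunction_potential_continuous α φ)).integrable_of_hasCompactSupport
      csconj.mul_right
  have ibp : ∫ x, star (φ x) * deriv (deriv φ) x = -∫ x, star (deriv φ x) * deriv φ x :=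
    integral_mul_deriv_eq_deriv_mul_of_integrable
      (fun x _ => (testFunction_differentiable φ x).hasDerivAt.star)
      (fun x _ => (testFunction_deriv_differentiable φ x).hasDerivAt) i1 i2 i3
  have e2 : ∫ x, ⟪φ x, besselAction α φ x⟫_ℂ
      = (∫ x, star (deriv φ x) * deriv φ x)
        + ∫ x, star (φ x) * (((couplingConst α / x ^ 2 : ℝ) : ℂ) * φ x) := by
    rw [← neg_neg (∫ x, star (deriv φ x) * deriv φ x), ← ibp, ← integral_neg]
    refine Eq.trans ?_ (integral_add i1.neg i4)
    refine integral_congr_ae (Eventually.of_forall fun x => ?_)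
    simp only [RCLike.inner_apply, besselAction, starRingEnd_apply]
    ring
  have hC : 0 ≤ couplingConst α := by unfold couplingConst; positivity
  have e3 : ∀ z : ℂ, star z * z = ((‖z‖ ^ 2 : ℝ) : ℂ) := fun z => by
    rw [← starRingEnd_apply, Complex.conj_mul', Complex.ofReal_pow]
  have e4 : ∫ x, star (deriv φ x) * deriv φ x = ((∫ x, ‖deriv φ x‖ ^ 2 : ℝ) : ℂ) := by
    rw [← integral_complex_ofReal]
    exact integral_congr_ae (Eventually.of_forall fun x => e3 _)
  have e5 : ∫ x, star (φ x) * (((couplingConst α / x ^ 2 : ℝ) : ℂ) * φ x)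
      = ((∫ x, couplingConst α / x ^ 2 * ‖φ x‖ ^ 2 : ℝ) : ℂ) := by
    rw [← integral_complex_ofReal]
    refine integral_congr_ae (Eventually.of_forall fun x => ?_)
    simp only
    rw [mul_left_comm, e3, ← Complex.ofReal_mul]
  rw [e1, e2, e4, e5, ← Complex.ofReal_add, Complex.ofReal_re]
  refine add_nonneg (integral_nonneg fun x => by positivity) (integral_nonneg fun x => ?_)
  simp only [Pi.zero_apply]
  positivity

/-- The Friedrichs extension of `A_α(0)`. -/
def zeroModeFriedrichs {α : ℝ} (hα : 0 ≤ α) : HalfLineL2 →ₗ.[ℂ] HalfLineL2 :=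
  friedrichsExtension (zeroModeOperator α) (zeroModeOperator_nonneg hα)

/-- `h` is the second weak derivative of `g` on `(0, ∞)`, and is a locally integrable function. -/
def HasWeakSecondDeriv (g h : ℝ → ℂ) : Prop :=
  LocallyIntegrableOn h (Ioi 0) ∧ ∀ φ : 𝓓(halfLine, ℂ),
    ∫ x in Ioi 0, g x * deriv (deriv φ) x = ∫ x in Ioi 0, h x * φ x

/-! ### Modified Bessel functions, the Green kernel and asymptotics at the origin -/

/-- The modified Bessel function `I_ν(x)` of the first kind, for real order and `x > 0`. -/
def besselI (ν x : ℝ) : ℝ :=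
  ∑' m : ℕ, (x / 2) ^ (2 * (m : ℝ) + ν) / ((m.factorial : ℝ) * Real.Gamma ((m : ℝ) + ν + 1))

/-- The modified Bessel function `K_ν(x)` of the second kind (Macdonald function), for real
non-integer order `ν` and `x > 0`. -/
def besselK (ν x : ℝ) : ℝ :=
  Real.pi / 2 * ((besselI (-ν) x - besselI ν x) / Real.sin (ν * Real.pi))

/-- `Φ_{α,0}(x) = √x K_{(1+α)/2}(x)`. -/
def zeroModePhi (α x : ℝ) : ℝ := √x * besselK ((1 + α) / 2) x

/-- `F_{α,0}(x) = √x I_{(1+α)/2}(x)`. -/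
def zeroModeF (α x : ℝ) : ℝ := √x * besselI ((1 + α) / 2) x

/-- The Green kernel `G_{α,0}(r, ρ)`. -/
def zeroModeGreen (α r ρ : ℝ) : ℝ :=
  if ρ < r then zeroModePhi α r * zeroModeF α ρ else zeroModeF α r * zeroModePhi α ρ

/-- `Ψ_{α,0}(x) = ∫₀^∞ G_{α,0}(x, ρ) Φ_{α,0}(ρ) dρ`. -/
def zeroModePsi (α x : ℝ) : ℝ := ∫ ρ in Ioi 0, zeroModeGreen α x ρ * zeroModePhi α ρ

/-- The bounded operator `R` on `L²((0, ∞))` is the integral operator with kernel `G`: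
for almost every `r > 0`, `(R g)(r) = ∫₀^∞ G(r, ρ) g(ρ) dρ`, the integral being absolutely
convergent. -/
def HasIntegralKernel (R : HalfLineL2 →L[ℂ] HalfLineL2) (G : ℝ → ℝ → ℝ) : Prop :=
  ∀ g : HalfLineL2, ∀ᵐ r ∂halfLineMeasure,
    Integrable (fun ρ => (G r ρ : ℂ) * g ρ) halfLineMeasure ∧
      R g r = ∫ ρ in Ioi 0, (G r ρ : ℂ) * g ρ

/-- `g(x) = g₀ x^{-α/2} + g₁ x^{1+α/2} + o(x^{3/2})` as `x ↓ 0`, for the continuous representative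
of the class `g`. -/
def HasOriginExpansion (α : ℝ) (g : HalfLineL2) (g₀ g₁ : ℂ) : Prop :=
  ∃ u : ℝ → ℂ, ContinuousOn u (Ioi 0) ∧ g =ᵐ[halfLineMeasure] u ∧
    (fun x : ℝ => u x - (g₀ * ((x ^ (-(α / 2)) : ℝ) : ℂ) + g₁ * ((x ^ (1 + α / 2) : ℝ) : ℂ)))
      =o[𝓝[>] 0] fun x : ℝ => x ^ (3 / 2 : ℝ)

end

/-! ### The entire part of the modified Bessel functions -/

/-! Put ν = (1+α)/2, so that 1/2 ≤ ν < 1. The equation −u'' + (1 + C_α/x²)u = 0 has the solutions F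
= √x I_ν, regular at the origin, and Φ = √x K_ν, square-integrable, with Wronskian 1. The kernel G
built from them defines an operator R with the properties collected in `IsGreenOperator`: R is
bounded and symmetric, R(A+1) is the identity on test functions, and the orthogonal complement of
the range of A+1 is the line through Φ. The closure, the adjoint and the self-adjoint extensions are
then found by Hilbert space algebra.

Boundedness is Schur's test with constant 1. As C_α ≥ 0, F ≤ F'' and Φ ≤ Φ'', so the integral of F
over (0, r) is at most F'(r), that of Φ over (r, ∞) is at most −Φ'(r), and the row integrals of G
are at most ΦF' − FΦ' = 1 (`lintegral_zeroModeGreen_le`). The signs Φ > 0 and Φ' ≤ 0 used here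
follow from Φ/F → 0 at infinity, that is from I_{-ν}/I_ν → 1. This limit is obtained without
asymptotic expansions, by comparing the power series of I_a for different orders a term by term
(`tendsto_besselDouble_neg_div`).

A test function annihilated by both Φ and F is A+1 applied to a test function, by variation of
constants. Hence the conjugate of any w orthogonal to the range of A+1 is a combination of Φ and F,
and F is excluded because it is not square-integrable (`exists_smul_zeroModePhiL2`).

Abstractly, D(A*) consists of the elements g = Rf + aΦ with f and a unique and A*g = f − g, and the
closure of A has as domain the elements Rf with f ⊥ Φ. In the coordinates (f, a) the boundary form
of A* is a' conj⟨Φ,f⟩ − conj(a) ⟨Φ,f'⟩, so the self-adjoint extensions are given either by a = 0 or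
by ⟨Φ,f⟩ = βa with β real (`isSelfAdjoint_extension_iff`). At the origin Rf = ⟨Φ,f⟩F + o(x^{3/2})
(`volterra_isLittleO`), which turns the condition with β into a fixed ratio γ of the coefficients of
x^{1+α/2} and x^{-α/2}, with γ affine in β.

The Friedrichs extension is the case a = 0. No nonzero multiple of Φ belongs to the form domain,
because A*Φ = −Φ would give a negative form value. Conversely R maps into the form domain:
subtracting from f a multiple of a function concentrated at the origin makes it orthogonal to Φ at a
vanishing cost in the form (`apply_mem_closedFormDomain`). Finally s = 1+α/2 satisfies s(s−1) = C_α,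
so the singular term cancels when −d²/dx² + C_α/x² + 1 is applied to x^s P, and x^s P lies in the
range of R. -/

/-- The Taylor coefficients `1 / (m! Γ(m + μ + 1))`. -/
noncomputable def besselCoeff (μ : ℝ) (m : ℕ) : ℝ :=
  1 / ((m.factorial : ℝ) * Real.Gamma ((m : ℝ) + μ + 1))

/-- The entire function `∑ z ^ m / (m! Γ(m + μ + 1))`. -/
noncomputable def besselEntire (μ z : ℝ) : ℝ := ∑' m : ℕ, besselCoeff μ m * z ^ m

theorem besselCoeff_pos {μ : ℝ} (hμ : -1 < μ) (m : ℕ) : 0 < besselCoeff μ m := by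
  have h0 : (0 : ℝ) ≤ m := m.cast_nonneg
  have : 0 < Real.Gamma ((m : ℝ) + μ + 1) := Real.Gamma_pos_of_pos (by linarith)
  unfold besselCoeff
  positivity

theorem besselCoeff_succ {μ : ℝ} (hμ : -1 < μ) (m : ℕ) :
    besselCoeff μ m = (m + 1) * (m + μ + 1) * besselCoeff μ (m + 1) := by
  have h0 : (0 : ℝ) ≤ m := m.cast_nonneg
  have h1 : (m : ℝ) + μ + 1 ≠ 0 := by linarith
  have hG : Real.Gamma ((m : ℝ) + μ + 1) ≠ 0 := (Real.Gamma_pos_of_pos (by linarith)).ne'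
  have e : Real.Gamma (((m + 1 : ℕ) : ℝ) + μ + 1)
      = ((m : ℝ) + μ + 1) * Real.Gamma ((m : ℝ) + μ + 1) := by
    rw [← Real.Gamma_add_one h1]; congr 1; push_cast; ring
  have hm : (m.factorial : ℝ) ≠ 0 := by positivity
  have hm1 : (m : ℝ) + 1 ≠ 0 := by positivity
  rw [besselCoeff, besselCoeff, e, Nat.factorial_succ]
  push_cast
  field_simp

theorem besselCoeff_add_one (μ : ℝ) (m : ℕ) :
    besselCoeff (μ + 1) m = (m + 1) * besselCoeff μ (m + 1) := by
  have hm1 : (m : ℝ) + 1 ≠ 0 := by positivity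
  have e : ((m + 1 : ℕ) : ℝ) + μ + 1 = (m : ℝ) + (μ + 1) + 1 := by push_cast; ring
  rw [besselCoeff, besselCoeff, e, Nat.factorial_succ]
  push_cast
  field_simp

theorem besselCoeff_eq {μ : ℝ} (hμ : -1 < μ) (m : ℕ) :
    besselCoeff μ m = (m + μ + 1) * besselCoeff (μ + 1) m := by
  rw [besselCoeff_succ hμ, besselCoeff_add_one]
  ring

theorem summable_besselCoeff {μ : ℝ} (hμ : -1 < μ) (z : ℝ) :
    Summable fun m => besselCoeff μ m * z ^ m := by
  refine summable_of_ratio_norm_eventually_le (r := 1 / 2) (by norm_num) ?_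
  obtain ⟨N, hN⟩ := exists_nat_gt (2 * |z| / (μ + 1))
  filter_upwards [eventually_ge_atTop N] with m hm
  have hm' : (N : ℝ) ≤ m := by exact_mod_cast hm
  have h0 : (0 : ℝ) ≤ m := m.cast_nonneg
  have hμ1 : 0 < μ + 1 := by linarith
  have hz : 2 * |z| ≤ m * (μ + 1) := by
    rw [div_lt_iff₀ hμ1] at hN
    nlinarith
  have hc := besselCoeff_pos hμ (m + 1)
  rw [Real.norm_eq_abs, Real.norm_eq_abs, abs_mul, abs_mul, abs_of_pos hc,
    abs_of_pos (besselCoeff_pos hμ m), besselCoeff_succ hμ m, pow_succ, abs_mul]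
  have : |z| ≤ 1 / 2 * ((m + 1) * (m + μ + 1)) := by nlinarith
  have h2 : 0 ≤ besselCoeff μ (m + 1) * |z ^ m| := by positivity
  nlinarith [mul_le_mul_of_nonneg_left this h2]

theorem besselEntire_pos {μ z : ℝ} (hμ : -1 < μ) (hz : 0 ≤ z) : 0 < besselEntire μ z := by
  refine (summable_besselCoeff hμ z).tsum_pos
    (fun m => mul_nonneg (besselCoeff_pos hμ m).le (pow_nonneg hz m)) 0 ?_
  simpa using besselCoeff_pos hμ 0

theorem besselCoeff_zero (μ : ℝ) : besselCoeff μ 0 = 1 / Real.Gamma (μ + 1) := by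
  simp [besselCoeff]

theorem besselEntire_zero (μ : ℝ) : besselEntire μ 0 = 1 / Real.Gamma (μ + 1) := by
  rw [besselEntire, tsum_eq_single 0 (fun m hm => by simp [hm])]
  simp [besselCoeff_zero]

/-- Termwise differentiation: the factor m cancels against m! and shifts the order up by one. On the
ball of radius |z|+1 the derived series is dominated by its value at |z|+1, all coefficients being
positive. -/
theorem hasDerivAt_besselEntire {μ : ℝ} (hμ : -1 < μ) (z : ℝ) :
    HasDerivAt (besselEntire μ) (besselEntire (μ + 1) z) z := by
  have key : ∀ w : ℝ, Summable fun m : ℕ => besselCoeff μ m * ((m : ℝ) * w ^ (m - 1)) := by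
    intro w
    rw [← summable_nat_add_iff 1]
    refine (summable_besselCoeff (μ := μ + 1) (by linarith) w).congr fun m => ?_
    rw [besselCoeff_add_one, Nat.add_sub_cancel]
    push_cast
    ring
  have h := hasDerivAt_tsum_of_isPreconnected (𝕜 := ℝ) (key (|z| + 1))
    (g := fun (m : ℕ) (w : ℝ) => besselCoeff μ m * w ^ m)
    (g' := fun (m : ℕ) (w : ℝ) => besselCoeff μ m * ((m : ℝ) * w ^ (m - 1)))
    (t := Metric.ball 0 (|z| + 1)) (y₀ := z) (y := z) Metric.isOpen_ball
    (convex_ball _ _).isPreconnected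
    (fun m w _ => (hasDerivAt_pow m w).const_mul _)
    (fun m w hw => by
      have hw' : |w| ≤ |z| + 1 := by
        simpa using (mem_ball_zero_iff.1 hw).le
      rw [Real.norm_eq_abs, abs_mul, abs_mul, abs_pow, Nat.abs_cast,
        abs_of_pos (besselCoeff_pos hμ m)]
      have := besselCoeff_pos hμ m
      gcongr)
    (by simp) (summable_besselCoeff hμ z) (by simp)
  have e : ∑' m : ℕ, besselCoeff μ m * ((m : ℝ) * z ^ (m - 1)) = besselEntire (μ + 1) z := by
    rw [(key z).tsum_eq_zero_add, besselEntire]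
    simp only [Nat.cast_zero, zero_mul, mul_zero, zero_add]
    refine tsum_congr fun m => ?_
    rw [besselCoeff_add_one, Nat.add_sub_cancel]
    push_cast
    ring
  rw [e] at h
  exact h

/-- Splitting the factor m+μ+1 that relates the coefficients of orders μ and μ+1 into m and μ+1
gives the two terms. In terms of Bessel functions this is I_μ − I_{μ+2} = (2(μ+1)/x) I_{μ+1}. -/
theorem besselEntire_recurrence {μ : ℝ} (hμ : -1 < μ) (z : ℝ) :
    z * besselEntire (μ + 2) z + (μ + 1) * besselEntire (μ + 1) z = besselEntire μ z := by
  have s0 := summable_besselCoeff hμ z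
  have s1 := summable_besselCoeff (μ := μ + 1) (by linarith) z
  have s2 := summable_besselCoeff (μ := μ + 2) (by linarith) z
  have e2 : z * besselEntire (μ + 2) z = ∑' m : ℕ, (m : ℝ) * besselCoeff (μ + 1) m * z ^ m := by
    have hs : Summable fun m : ℕ => (m : ℝ) * besselCoeff (μ + 1) m * z ^ m := by
      rw [← summable_nat_add_iff 1]
      refine (s2.mul_left z).congr fun m => ?_
      rw [show μ + 2 = μ + 1 + 1 by ring, besselCoeff_add_one]
      push_cast
      ring
    rw [hs.tsum_eq_zero_add, besselEntire, ← tsum_mul_left]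
    simp only [Nat.cast_zero, zero_mul, zero_add]
    refine tsum_congr fun m => ?_
    rw [show μ + 2 = μ + 1 + 1 by ring, besselCoeff_add_one]
    push_cast
    ring
  have hs : Summable fun m : ℕ => (m : ℝ) * besselCoeff (μ + 1) m * z ^ m := by
    refine (s0.sub (s1.mul_left (μ + 1))).congr fun m => ?_
    rw [besselCoeff_eq hμ]
    ring
  rw [e2, besselEntire, besselEntire, ← tsum_mul_left, ← hs.tsum_add (s1.mul_left _)]
  refine tsum_congr fun m => ?_
  rw [besselCoeff_eq hμ]
  ring

theorem contDiff_besselEntire {μ : ℝ} (hμ : -1 < μ) : ContDiff ℝ ∞ (besselEntire μ) := by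
  -- The derivative has order μ+1, so the induction has to range over all orders at once.
  have key : ∀ (n : ℕ) (μ : ℝ), -1 < μ → ContDiff ℝ n (besselEntire μ) := by
    intro n
    induction n with
    | zero =>
      intro μ hμ
      exact contDiff_zero.2
        (continuous_iff_continuousAt.2 fun z => (hasDerivAt_besselEntire hμ z).continuousAt)
    | succ n ih =>
      intro μ hμ
      have hd : deriv (besselEntire μ) = besselEntire (μ + 1) :=
        funext fun z => (hasDerivAt_besselEntire hμ z).deriv
      push_cast
      rw [contDiff_succ_iff_deriv, hd]
      exact ⟨fun z => (hasDerivAt_besselEntire hμ z).differentiableAt, by simp,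
        ih _ (by linarith)⟩
  exact contDiff_infty.2 fun n => key n μ hμ

/-! ### Comparison of the growth of modified Bessel functions of different order -/

/-- The modified Bessel function `I_a` at `2 t`. -/
noncomputable def besselDouble (a t : ℝ) : ℝ := t ^ a * besselEntire a (t ^ 2)

theorem besselDouble_pos {a t : ℝ} (ha : -1 < a) (ht : 0 < t) : 0 < besselDouble a t :=
  mul_pos (Real.rpow_pos_of_pos ht _) (besselEntire_pos ha (by positivity))

theorem hasSum_besselDouble {a : ℝ} (ha : -1 < a) (t : ℝ) :
    HasSum (fun m => t ^ a * (besselCoeff a m * (t ^ 2) ^ m)) (besselDouble a t) :=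
  (summable_besselCoeff ha (t ^ 2)).hasSum.mul_left _

theorem besselDouble_recurrence {a t : ℝ} (ha : -1 < a) (ht : 0 < t) :
    besselDouble a t = besselDouble (a + 2) t + (a + 1) / t * besselDouble (a + 1) t := by
  rw [besselDouble, ← besselEntire_recurrence ha (t ^ 2), besselDouble, besselDouble,
    Real.rpow_add ht, Real.rpow_add ht, Real.rpow_one]
  have : t ^ (2 : ℝ) = t ^ 2 := by norm_cast
  rw [this]
  field_simp

/-- Log-convexity of Γ, applied to y+1 as the convex combination of y+δ and y+δ+1 with weights δ and
1−δ. -/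
theorem inv_Gamma_add_le {y δ : ℝ} (hy : 0 < y) (h0 : 0 < δ) (h1 : δ ≤ 1) :
    1 / Real.Gamma (y + δ) ≤ (y + δ) ^ (1 - δ) / (y * Real.Gamma y) := by
  have hG : 0 < Real.Gamma y := Real.Gamma_pos_of_pos hy
  have hGδ : 0 < Real.Gamma (y + δ) := Real.Gamma_pos_of_pos (by linarith)
  have hyδ : 0 < y + δ := by linarith
  rw [← Real.Gamma_add_one hy.ne', div_le_div_iff₀ hGδ (Real.Gamma_pos_of_pos (by linarith)),
    one_mul]
  rcases h1.eq_or_lt with rfl | h1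
  · simp
  have h := Real.Gamma_mul_add_mul_le_rpow_Gamma_mul_rpow_Gamma (s := y + δ) (t := y + δ + 1)
    (a := δ) (b := 1 - δ) hyδ (by linarith) h0 (by linarith) (by ring)
  rw [show δ * (y + δ) + (1 - δ) * (y + δ + 1) = y + 1 by ring, Real.Gamma_add_one hyδ.ne',
    Real.mul_rpow hyδ.le hGδ.le, mul_left_comm, ← Real.rpow_add hGδ] at h
  simpa using h

/-- The comparison is made term by term in the power series. The Gamma bound leaves the product
(t/y)^δ ((y+δ)/y)^{1−δ} with y = m+a+1, and the weighted arithmetic-geometric mean inequality splits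
it into contributions of orders a+1 and a. -/
theorem besselDouble_interpolation {a δ t : ℝ} (ha : -1 < a) (h0 : 0 < δ) (h1 : δ ≤ 1)
    (ht : 0 < t) : besselDouble (a + δ) t ≤
      (δ + δ * (1 - δ) / t) * besselDouble (a + 1) t + (1 - δ) * besselDouble a t := by
  refine hasSum_le (fun m => ?_) (hasSum_besselDouble (a := a + δ) (by linarith) t)
    (((hasSum_besselDouble (a := a + 1) (by linarith) t).mul_left _).add
      ((hasSum_besselDouble ha t).mul_left _))
  have hm : (0 : ℝ) ≤ m := m.cast_nonneg
  set y : ℝ := m + a + 1 with hy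
  have hy0 : 0 < y := by linarith
  have hG : 0 < Real.Gamma y := Real.Gamma_pos_of_pos hy0
  have hf : (0 : ℝ) < m.factorial := by positivity
  have c1 : besselCoeff (a + δ) m = 1 / (m.factorial * Real.Gamma (y + δ)) := by
    rw [besselCoeff, hy]; ring_nf
  have c2 : besselCoeff (a + 1) m = 1 / (m.factorial * (y * Real.Gamma y)) := by
    rw [← Real.Gamma_add_one hy0.ne', besselCoeff, hy]; ring_nf
  have c3 : besselCoeff a m = 1 / (m.factorial * Real.Gamma y) := by rw [besselCoeff, hy]
  have am := Real.geom_mean_le_arith_mean2_weighted (w₁ := δ) (w₂ := 1 - δ) (p₁ := t / y)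
    (p₂ := (y + δ) / y) h0.le (by linarith) (by positivity) (by positivity) (by ring)
  have e1 : t ^ δ * ((y + δ) ^ (1 - δ) / y) = (t / y) ^ δ * ((y + δ) / y) ^ (1 - δ) := by
    rw [Real.div_rpow ht.le hy0.le, Real.div_rpow (by linarith) hy0.le]
    have : y ^ δ * y ^ (1 - δ) = y := by rw [← Real.rpow_add hy0]; simp
    rw [div_mul_div_comm, this]
    ring
  have hb := inv_Gamma_add_le hy0 h0 h1
  have hP : 0 < t ^ a * (t ^ 2) ^ m / m.factorial := by positivity
  have htδ : 0 < t ^ δ := Real.rpow_pos_of_pos ht _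
  rw [c1, c2, c3, Real.rpow_add ht, Real.rpow_add ht, Real.rpow_one]
  calc t ^ a * t ^ δ * (1 / (m.factorial * Real.Gamma (y + δ)) * (t ^ 2) ^ m)
      = (t ^ a * (t ^ 2) ^ m / m.factorial) * (t ^ δ * (1 / Real.Gamma (y + δ))) := by
        field_simp
    _ ≤ (t ^ a * (t ^ 2) ^ m / m.factorial)
        * (t ^ δ * ((y + δ) ^ (1 - δ) / (y * Real.Gamma y))) := by gcongr
    _ = (t ^ a * (t ^ 2) ^ m / m.factorial)
        * ((t ^ δ * ((y + δ) ^ (1 - δ) / y)) / Real.Gamma y) := by field_simp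
    _ ≤ (t ^ a * (t ^ 2) ^ m / m.factorial)
        * ((δ * (t / y) + (1 - δ) * ((y + δ) / y)) / Real.Gamma y) := by rw [e1]; gcongr
    _ = _ := by field_simp; ring

/-- Also termwise. Writing all coefficients as multiples of the one of order a+3, the main
inequality is ty ≤ (t²+y²)/2 with y = m+a+1. The index shifts leave an excess t², absorbed through y
≥ a+1, which produces the last term. -/
theorem besselDouble_add_one_le {a t : ℝ} (ha : -1 < a) (ht : 0 < t) :
    besselDouble (a + 1) t ≤ 1 / 2 * besselDouble a t + 1 / 2 * besselDouble (a + 2) t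
      + (1 / 2 + 1 / (a + 1)) / t * besselDouble (a + 3) t := by
  refine hasSum_le (fun m => ?_) (hasSum_besselDouble (a := a + 1) (by linarith) t)
    ((((hasSum_besselDouble ha t).mul_left _).add
      ((hasSum_besselDouble (a := a + 2) (by linarith) t).mul_left _)).add
      ((hasSum_besselDouble (a := a + 3) (by linarith) t).mul_left _))
  have hm : (0 : ℝ) ≤ m := m.cast_nonneg
  have ha1 : 0 < a + 1 := by linarith
  set y : ℝ := m + a + 1 with hy
  have hy0 : 0 < y := by linarith
  have hG : 0 < Real.Gamma y := Real.Gamma_pos_of_pos hy0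
  have c3 : besselCoeff a m = y * ((y + 1) * ((y + 2) * besselCoeff (a + 3) m)) := by
    rw [besselCoeff_eq ha, besselCoeff_eq (μ := a + 1) (by linarith),
      besselCoeff_eq (μ := a + 1 + 1) (by linarith), hy]
    ring_nf
  have c2 : besselCoeff (a + 1) m = ((y + 1) * ((y + 2) * besselCoeff (a + 3) m)) := by
    rw [besselCoeff_eq (μ := a + 1) (by linarith),
      besselCoeff_eq (μ := a + 1 + 1) (by linarith), hy]
    ring_nf
  have c1 : besselCoeff (a + 2) m = (y + 2) * besselCoeff (a + 3) m := by
    rw [besselCoeff_eq (μ := a + 2) (by linarith), hy]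
    ring_nf
  have hc := besselCoeff_pos (μ := a + 3) (by linarith) m
  rw [c1, c2, c3, Real.rpow_add ht, Real.rpow_add ht, Real.rpow_add ht, Real.rpow_one]
  have t2 : t ^ (2 : ℝ) = t ^ 2 := by norm_cast
  have t3 : t ^ (3 : ℝ) = t ^ 3 := by norm_cast
  rw [t2, t3]
  have hA : 0 < t ^ a * besselCoeff (a + 3) m * (t ^ 2) ^ m := by positivity
  have h1 : 1 ≤ y / (a + 1) := by rw [le_div_iff₀ ha1]; linarith
  have key : t * ((y + 1) * (y + 2)) ≤ 1 / 2 * (y * ((y + 1) * (y + 2))) + 1 / 2 * t ^ 2 * (y + 2)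
      + (1 / 2 + 1 / (a + 1)) * t ^ 2 := by
    have s : t * y * ((y + 1) * (y + 2)) ≤ 1 / 2 * (y ^ 2 + t ^ 2) * ((y + 1) * (y + 2)) := by
      have := sq_nonneg (y - t)
      have h3 : 0 < (y + 1) * (y + 2) := by positivity
      nlinarith [mul_nonneg this h3.le]
    have h4 : t ^ 2 ≤ t ^ 2 * (y / (a + 1)) := le_mul_of_one_le_right (by positivity) h1
    have : y * (t * ((y + 1) * (y + 2))) ≤ y * (1 / 2 * (y * ((y + 1) * (y + 2)))
        + 1 / 2 * t ^ 2 * (y + 2) + (1 / 2 + 1 / (a + 1)) * t ^ 2) := by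
      have e : y * ((1 / 2 + 1 / (a + 1)) * t ^ 2) = 1 / 2 * y * t ^ 2 + t ^ 2 * (y / (a + 1)) := by
        ring
      nlinarith
    exact le_of_mul_le_mul_left this hy0
  calc _ = (t ^ a * besselCoeff (a + 3) m * (t ^ 2) ^ m) * (t * ((y + 1) * (y + 2))) := by ring
    _ ≤ (t ^ a * besselCoeff (a + 3) m * (t ^ 2) ^ m) * (1 / 2 * (y * ((y + 1) * (y + 2)))
        + 1 / 2 * t ^ 2 * (y + 2) + (1 / 2 + 1 / (a + 1)) * t ^ 2) :=
      mul_le_mul_of_nonneg_left key hA.le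
    _ = _ := by field_simp

/-- `I_b` is asymptotically at most `I_a` at infinity. -/
def BesselDominates (a b : ℝ) : Prop :=
  ∀ ε > 0, ∀ᶠ t in atTop, besselDouble b t ≤ (1 + ε) * besselDouble a t

theorem BesselDominates.trans {a b c : ℝ} (h : BesselDominates a b) (h' : BesselDominates b c) :
    BesselDominates a c := by
  intro ε hε
  obtain ⟨η, hη, hη'⟩ : ∃ η > 0, (1 + η) * (1 + η) = 1 + ε := by
    refine ⟨√(1 + ε) - 1, ?_, ?_⟩
    · have : 1 < √(1 + ε) := Real.lt_sqrt_of_sq_lt (by linarith)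
      linarith
    · rw [add_sub_cancel, Real.mul_self_sqrt (by linarith)]
  filter_upwards [h η hη, h' η hη] with t h1 h2
  calc _ ≤ (1 + η) * besselDouble b t := h2
    _ ≤ (1 + η) * ((1 + η) * besselDouble a t) := by gcongr
    _ = _ := by rw [← hη', mul_assoc]

theorem eventually_div_le (K : ℝ) {ε : ℝ} (hε : 0 < ε) : ∀ᶠ t : ℝ in atTop, K / t ≤ ε :=
  ((tendsto_const_nhds.div_atTop tendsto_id).eventually_lt_const hε).mono fun _ h => h.le

/-- By the recurrence I_{a+2} ≤ I_a and I_{a+3} ≤ I_{a+1}, so `besselDouble_add_one_le` becomes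
I_{a+1} ≤ I_a + O(1/t) I_{a+1}, and the last term is absorbed on the left. -/
theorem besselDominates_add_one {a : ℝ} (ha : -1 < a) : BesselDominates a (a + 1) := by
  intro ε hε
  -- Chosen so that (1+ε)(1−η) = 1.
  set η := ε / (1 + ε) with hη
  have hη0 : 0 < η := by positivity
  have e : (1 + ε) * (1 - η) = 1 := by rw [hη]; field_simp; ring
  filter_upwards [eventually_div_le (1 / 2 + 1 / (a + 1)) hη0, eventually_gt_atTop 0] with t h1 ht
  have p1 := besselDouble_pos (a := a + 1) (t := t) (by linarith) ht
  have p2 := besselDouble_pos (a := a + 2) (t := t) (by linarith) ht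
  have r1 := besselDouble_recurrence ha ht
  have r2 := besselDouble_recurrence (a := a + 1) (by linarith) ht
  rw [show a + 1 + 2 = a + 3 by ring, show a + 1 + 1 = a + 2 by ring] at r2
  have q1 : 0 < (a + 1) / t := div_pos (by linarith) ht
  have q2 : 0 < (a + 2) / t := div_pos (by linarith) ht
  have b1 : besselDouble (a + 2) t ≤ besselDouble a t := by nlinarith
  have b2 : besselDouble (a + 3) t ≤ besselDouble (a + 1) t := by nlinarith
  have k0 : 0 ≤ (1 / 2 + 1 / (a + 1)) / t := by
    have : 0 < a + 1 := by linarith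
    positivity
  have b3 := besselDouble_add_one_le ha ht
  have b4 : (1 / 2 + 1 / (a + 1)) / t * besselDouble (a + 3) t ≤ η * besselDouble (a + 1) t :=
    mul_le_mul h1 b2 (besselDouble_pos (by linarith) ht).le hη0.le
  have b5 : (1 - η) * besselDouble (a + 1) t ≤ besselDouble a t := by linarith
  calc besselDouble (a + 1) t = (1 + ε) * ((1 - η) * besselDouble (a + 1) t) := by
        rw [← mul_assoc, e, one_mul]
    _ ≤ _ := by gcongr

theorem besselDominates_add {a δ : ℝ} (ha : -1 < a) (h0 : 0 ≤ δ) (h1 : δ ≤ 1) :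
    BesselDominates a (a + δ) := by
  rcases h0.eq_or_lt with rfl | h0
  · intro ε hε
    filter_upwards [eventually_gt_atTop 0] with t ht
    have := besselDouble_pos ha ht
    rw [add_zero]
    nlinarith
  intro ε hε
  obtain ⟨η, hη, hη'⟩ : ∃ η > 0, (1 + η) * (1 + η) ≤ 1 + ε := by
    -- For 0 < η ≤ 1 one has (1+η)² ≤ 1+3η.
    refine ⟨min 1 (ε / 3), by positivity, ?_⟩
    nlinarith [min_le_left 1 (ε / 3), min_le_right 1 (ε / 3), show 0 < min 1 (ε / 3) by positivity]
  filter_upwards [besselDominates_add_one ha η hη, eventually_div_le (δ * (1 - δ)) hη,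
    eventually_gt_atTop 0] with t b1 b2 ht
  have p0 := besselDouble_pos ha ht
  have p1 := besselDouble_pos (a := a + 1) (t := t) (by linarith) ht
  have h := besselDouble_interpolation ha h0 h1 ht
  have s : (δ + δ * (1 - δ) / t) * besselDouble (a + 1) t
      ≤ (δ + η) * ((1 + η) * besselDouble a t) := by gcongr
  have : (δ + η) * (1 + η) + (1 - δ) ≤ 1 + ε := by nlinarith
  nlinarith

/-- The only comparison that lowers the order: in the recurrence the term (a+1)/t · I_{a+1} is
negligible against I_a, because I_{a+1} is at most 2 I_a eventually. -/
theorem besselDominates_sub_two {a : ℝ} (ha : -1 < a) : BesselDominates (a + 2) a := by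
  intro ε hε
  set η := ε / (1 + ε) with hη
  have hη0 : 0 < η := by positivity
  have e : (1 + ε) * (1 - η) = 1 := by rw [hη]; field_simp; ring
  filter_upwards [besselDominates_add_one ha 1 one_pos,
    eventually_div_le (a + 1) (half_pos hη0), eventually_gt_atTop 0] with t b1 b2 ht
  have p0 := besselDouble_pos ha ht
  have p1 := besselDouble_pos (a := a + 1) (t := t) (by linarith) ht
  have r := besselDouble_recurrence ha ht
  have s : (a + 1) / t * besselDouble (a + 1) t ≤ η / 2 * ((1 + 1) * besselDouble a t) := by
    gcongr
  have b5 : (1 - η) * besselDouble a t ≤ besselDouble (a + 2) t := by linarith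
  calc besselDouble a t = (1 + ε) * ((1 - η) * besselDouble a t) := by
        rw [← mul_assoc, e, one_mul]
    _ ≤ _ := by gcongr

/-- `I_{-ν}(x) / I_ν(x) → 1` as `x → ∞`. -/
theorem tendsto_besselDouble_neg_div {ν : ℝ} (h0 : 1 / 2 ≤ ν) (h1 : ν < 1) :
    Tendsto (fun t => besselDouble (-ν) t / besselDouble ν t) atTop (𝓝 1) := by
  -- The order is raised from −ν to 1−ν and then by 2ν−1, which lies in [0, 1] because 1/2 ≤ ν < 1.
  have d1 : BesselDominates (-ν) ν := by
    have h := (besselDominates_add_one (a := -ν) (by linarith)).trans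
      (besselDominates_add (a := -ν + 1) (δ := 2 * ν - 1) (by linarith) (by linarith)
        (by linarith))
    rwa [show -ν + 1 + (2 * ν - 1) = ν by ring] at h
  -- The order is raised from ν to 2−ν, a step of 2−2ν ≤ 1, and then lowered by two.
  have d2 : BesselDominates ν (-ν) := by
    have h := besselDominates_add (a := ν) (δ := 2 - 2 * ν) (by linarith) (by linarith)
        (by linarith)
    rw [show ν + (2 - 2 * ν) = -ν + 2 by ring] at h
    exact h.trans (besselDominates_sub_two (by linarith))
  rw [tendsto_order]
  constructor
  · intro c hc
    rcases le_or_gt c 0 with hc0 | hc0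
    · filter_upwards [eventually_gt_atTop 0] with t ht
      exact hc0.trans_lt
        (div_pos (besselDouble_pos (by linarith) ht) (besselDouble_pos (by linarith) ht))
    obtain ⟨ε, hε, hcε⟩ : ∃ ε > 0, c * (1 + ε) < 1 :=
      ⟨(1 - c) / 2, by linarith, by nlinarith⟩
    filter_upwards [d1 ε hε, eventually_gt_atTop 0] with t ht h0
    have p := besselDouble_pos (a := ν) (t := t) (by linarith) h0
    have q := besselDouble_pos (a := -ν) (t := t) (by linarith) h0
    rw [lt_div_iff₀ p]
    nlinarith
  · intro c hc
    obtain ⟨ε, hε, hcε⟩ : ∃ ε > 0, 1 + ε < c := ⟨(c - 1) / 2, by linarith, by linarith⟩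
    filter_upwards [d2 ε hε, eventually_gt_atTop 0] with t ht h0
    have p := besselDouble_pos (a := ν) (t := t) (by linarith) h0
    rw [div_lt_iff₀ p]
    nlinarith

theorem besselI_eq {x : ℝ} (hx : 0 < x) (ν : ℝ) : besselI ν x = besselDouble ν (x / 2) := by
  rw [besselI, besselDouble, besselEntire, ← tsum_mul_left]
  refine tsum_congr fun m => ?_
  have h2 : (0 : ℝ) < x / 2 := by positivity
  have e : (x / 2) ^ (2 * (m : ℝ)) = ((x / 2) ^ 2) ^ m := by
    rw [Real.rpow_mul h2.le]; norm_cast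
  rw [Real.rpow_add h2, e, besselCoeff]
  ring

/-! ### The solutions `√x I_μ(x)` of the zero-mode equation -/

/-- The even entire function `x ↦ x ^ (-μ) I_μ(x)`. -/
noncomputable def besselReg (μ x : ℝ) : ℝ := (2 : ℝ) ^ (-μ) * besselEntire μ (x ^ 2 / 4)

/-- The function `√x I_μ(x)`. -/
noncomputable def besselSqrt (μ x : ℝ) : ℝ := x ^ (μ + 1 / 2) * besselReg μ x

/-- The derivative of `√x I_μ(x)`. -/
noncomputable def besselSqrtDeriv (μ x : ℝ) : ℝ :=
  (μ + 1 / 2) * x ^ (μ - 1 / 2) * besselReg μ x + x ^ (μ + 3 / 2) * besselReg (μ + 1) x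

theorem besselReg_pos {μ : ℝ} (hμ : -1 < μ) (x : ℝ) : 0 < besselReg μ x :=
  mul_pos (by positivity) (besselEntire_pos hμ (by positivity))

theorem hasDerivAt_besselReg {μ : ℝ} (hμ : -1 < μ) (x : ℝ) :
    HasDerivAt (besselReg μ) (x * besselReg (μ + 1) x) x := by
  have h1 : HasDerivAt (fun x : ℝ => x ^ 2 / 4) (x / 2) x := by
    convert! (hasDerivAt_pow 2 x).div_const 4 using 1
    push_cast; ring
  have h := ((hasDerivAt_besselEntire hμ (x ^ 2 / 4)).comp x h1).const_mul ((2 : ℝ) ^ (-μ))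
  convert! h using 1
  rw [besselReg, neg_add, Real.rpow_add two_pos, Real.rpow_neg_one]
  ring

theorem contDiff_besselReg {μ : ℝ} (hμ : -1 < μ) : ContDiff ℝ ∞ (besselReg μ) :=
  contDiff_const.mul ((contDiff_besselEntire hμ).comp ((contDiff_id.pow 2).div_const 4))

theorem continuous_besselReg {μ : ℝ} (hμ : -1 < μ) : Continuous (besselReg μ) :=
  (contDiff_besselReg hμ).continuous

theorem besselReg_recurrence {μ : ℝ} (hμ : -1 < μ) (x : ℝ) :
    besselReg μ x = x ^ 2 * besselReg (μ + 2) x + 2 * (μ + 1) * besselReg (μ + 1) x := by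
  rw [besselReg, ← besselEntire_recurrence hμ, besselReg, besselReg, neg_add, neg_add,
    Real.rpow_add two_pos, Real.rpow_add two_pos, Real.rpow_neg_one]
  have : (2 : ℝ) ^ (-2 : ℝ) = 1 / 4 := by
    rw [Real.rpow_neg two_pos.le]; norm_num
  rw [this]
  ring

theorem besselReg_zero (μ : ℝ) : besselReg μ 0 = 2 ^ (-μ) / Real.Gamma (μ + 1) := by
  rw [besselReg]
  norm_num [besselEntire_zero]
  rfl

theorem besselReg_sub_isBigO {μ : ℝ} (hμ : -1 < μ) :
    (fun x => besselReg μ x - besselReg μ 0) =O[𝓝 0] fun x : ℝ => x ^ 2 := by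
  have h1 : Tendsto (fun x : ℝ => x ^ 2 / 4) (𝓝 0) (𝓝 0) := by
    have : Continuous fun x : ℝ => x ^ 2 / 4 := by fun_prop
    simpa using this.tendsto 0
  have h := ((hasDerivAt_besselEntire hμ 0).isBigO_sub.comp_tendsto h1).const_mul_left
    ((2 : ℝ) ^ (-μ))
  refine (h.congr_left fun x => ?_).trans ?_
  · simp only [besselReg, Function.comp_apply]
    norm_num
    ring
  · simp only [Function.comp_def, sub_zero]
    refine IsBigO.of_bound 1 (Eventually.of_forall fun x => ?_)
    rw [norm_div, one_mul]
    exact div_le_self (norm_nonneg _) (by norm_num)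

theorem sqrt_mul_besselI {x : ℝ} (hx : 0 < x) (μ : ℝ) :
    √x * besselI μ x = besselSqrt μ x := by
  rw [besselI_eq hx, besselDouble, besselSqrt, besselReg, Real.div_rpow hx.le two_pos.le,
    Real.rpow_add hx, Real.sqrt_eq_rpow, Real.rpow_neg two_pos.le, div_pow]
  norm_num
  ring

theorem hasDerivAt_besselSqrt {μ x : ℝ} (hμ : -1 < μ) (hx : 0 < x) :
    HasDerivAt (besselSqrt μ) (besselSqrtDeriv μ x) x := by
  have h := (Real.hasDerivAt_rpow_const (p := μ + 1 / 2) (Or.inl hx.ne')).mul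
    (hasDerivAt_besselReg hμ x)
  convert! h using 1
  rw [besselSqrtDeriv, show μ + 3 / 2 = μ + 1 / 2 + 1 by ring, Real.rpow_add_one hx.ne',
    show μ + 1 / 2 - 1 = μ - 1 / 2 by ring]
  ring

/-- The equation depends on μ only through μ², so the orders ν and −ν give two solutions of the same
equation. -/
theorem hasDerivAt_besselSqrtDeriv {μ x : ℝ} (hμ : -1 < μ) (hx : 0 < x) :
    HasDerivAt (besselSqrtDeriv μ) ((1 + (μ ^ 2 - 1 / 4) / x ^ 2) * besselSqrt μ x) x := by
  have h := (((Real.hasDerivAt_rpow_const (p := μ - 1 / 2) (Or.inl hx.ne')).const_mul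
    (μ + 1 / 2)).mul (hasDerivAt_besselReg hμ x)).add
    ((Real.hasDerivAt_rpow_const (p := μ + 3 / 2) (Or.inl hx.ne')).mul
    (hasDerivAt_besselReg (μ := μ + 1) (by linarith) x))
  convert! h using 1
  have e : ∀ k : ℝ, x ^ (μ + k) = x ^ μ * x ^ k := fun k => Real.rpow_add hx _ _
  have e1 : x ^ (μ - 1 / 2) = x ^ (μ + 1 / 2) / x := by
    rw [← Real.rpow_sub_one hx.ne']; congr 1; ring
  have e2 : x ^ (μ - 1 / 2 - 1) = x ^ (μ + 1 / 2) / x ^ 2 := by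
    rw [Real.rpow_sub_one hx.ne', e1]; field_simp
  have e3 : x ^ (μ + 3 / 2) = x ^ (μ + 1 / 2) * x := by
    rw [← Real.rpow_add_one hx.ne']; congr 1; ring
  have e4 : x ^ (μ + 3 / 2 - 1) = x ^ (μ + 1 / 2) := by congr 1; ring
  rw [besselSqrt, e1, e2, e3, e4, add_mul, one_mul]
  nth_rewrite 1 [besselReg_recurrence hμ x]
  rw [show μ + 1 + 1 = μ + 2 by ring]
  field_simp
  ring

theorem contDiffOn_besselSqrt {μ : ℝ} (hμ : -1 < μ) : ContDiffOn ℝ ∞ (besselSqrt μ) (Ioi 0) :=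
  (contDiffOn_id.rpow_const_of_ne fun _ hx => (mem_Ioi.1 hx).ne').mul
    (contDiff_besselReg hμ).contDiffOn

theorem exists_besselReg_le {μ : ℝ} (hμ : -1 < μ) :
    ∃ C > 0, ∀ x ∈ Ioc (0 : ℝ) 1, besselReg μ x ≤ C := by
  obtain ⟨C, hC⟩ := (isCompact_Icc (a := (0 : ℝ)) (b := 1)).exists_bound_of_continuousOn
    (continuous_besselReg hμ).continuousOn
  refine ⟨max C 1, by positivity, fun x hx => ?_⟩
  exact (le_abs_self _).trans ((hC x ⟨hx.1.le, hx.2⟩).trans (le_max_left _ _))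

theorem exists_besselSqrt_le {μ : ℝ} (hμ : -1 < μ) :
    ∃ C > 0, ∀ x ∈ Ioc (0 : ℝ) 1, |besselSqrt μ x| ≤ C * x ^ (μ + 1 / 2) := by
  obtain ⟨C, hC0, hC⟩ := exists_besselReg_le hμ
  refine ⟨C, hC0, fun x hx => ?_⟩
  have h1 := besselReg_pos hμ x
  have h2 : 0 < x ^ (μ + 1 / 2) := Real.rpow_pos_of_pos hx.1 _
  rw [besselSqrt, abs_of_pos (mul_pos h2 h1), mul_comm]
  exact mul_le_mul_of_nonneg_right (hC x hx) h2.le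

theorem exists_besselSqrtDeriv_le {μ : ℝ} (hμ : -1 < μ) :
    ∃ C > 0, ∀ x ∈ Ioc (0 : ℝ) 1, |besselSqrtDeriv μ x| ≤ C * x ^ (μ - 1 / 2) := by
  obtain ⟨C, hC0, hC⟩ := exists_besselReg_le hμ
  obtain ⟨D, hD0, hD⟩ := exists_besselReg_le (μ := μ + 1) (by linarith)
  refine ⟨|μ + 1 / 2| * C + D, by positivity, fun x hx => ?_⟩
  have h1 := besselReg_pos hμ x
  have h1' := besselReg_pos (μ := μ + 1) (by linarith) x
  have h2 : 0 < x ^ (μ - 1 / 2) := Real.rpow_pos_of_pos hx.1 _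
  have h3 : 0 < x ^ (μ + 3 / 2) := Real.rpow_pos_of_pos hx.1 _
  have h4 : x ^ (μ + 3 / 2) ≤ x ^ (μ - 1 / 2) :=
    Real.rpow_le_rpow_of_exponent_ge hx.1 hx.2 (by linarith)
  calc |besselSqrtDeriv μ x|
      ≤ |(μ + 1 / 2) * x ^ (μ - 1 / 2) * besselReg μ x|
        + |x ^ (μ + 3 / 2) * besselReg (μ + 1) x| := abs_add_le _ _
    _ = |μ + 1 / 2| * x ^ (μ - 1 / 2) * besselReg μ x
        + x ^ (μ + 3 / 2) * besselReg (μ + 1) x := by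
        rw [abs_mul, abs_mul, abs_of_pos h1, abs_of_pos h2, abs_mul, abs_of_pos h3, abs_of_pos h1']
    _ ≤ |μ + 1 / 2| * x ^ (μ - 1 / 2) * C + x ^ (μ - 1 / 2) * D := by
        gcongr
        · exact hC x hx
        · exact hD x hx
    _ = _ := by ring

/-- The factor multiplying x^{μ+1/2} is a function of x², so the first correction is of relative
size x², not x. -/
theorem besselSqrt_sub_isLittleO {μ k : ℝ} (hμ : -1 < μ) (hk : k < μ + 5 / 2) :
    (fun x => besselSqrt μ x - besselReg μ 0 * x ^ (μ + 1 / 2)) =o[𝓝[>] 0] fun x : ℝ => x ^ k := by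
  have h1 : (fun x => besselSqrt μ x - besselReg μ 0 * x ^ (μ + 1 / 2))
      =O[𝓝[>] 0] fun x : ℝ => x ^ (μ + 1 / 2) * x ^ 2 := by
    refine ((isBigO_refl (fun x : ℝ => x ^ (μ + 1 / 2)) _).mul
      ((besselReg_sub_isBigO hμ).mono nhdsWithin_le_nhds)).congr_left fun x => ?_
    rw [besselSqrt]
    ring
  refine h1.trans_isLittleO ?_
  rw [isLittleO_iff_tendsto']
  · have h2 : Tendsto (fun x : ℝ => x ^ (μ + 5 / 2 - k)) (𝓝[>] 0) (𝓝 0) := by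
      have := (Real.continuousAt_rpow_const 0 (μ + 5 / 2 - k) (Or.inr (by linarith))).tendsto
      rw [Real.zero_rpow (by linarith)] at this
      exact this.mono_left nhdsWithin_le_nhds
    refine h2.congr' ?_
    filter_upwards [self_mem_nhdsWithin] with x hx
    have hx : 0 < x := hx
    rw [Real.rpow_sub hx, show μ + 5 / 2 = μ + 1 / 2 + 2 by ring, Real.rpow_add hx]
    norm_cast
  · filter_upwards [self_mem_nhdsWithin] with x hx h
    exact absurd h (Real.rpow_pos_of_pos hx _).ne'

/-- Both functions solve the same equation without first-order term, so the Wronskian is constant.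
Once the powers of x are multiplied out it equals the auxiliary function `p`, which is continuous at
0, and the constant is its value there. -/
theorem besselSqrt_wronskian {ν x : ℝ} (h0 : -1 < ν) (h1 : ν < 1) (hx : 0 < x) :
    besselSqrt (-ν) x * besselSqrtDeriv ν x - besselSqrtDeriv (-ν) x * besselSqrt ν x
      = 2 * ν * (besselReg (-ν) 0 * besselReg ν 0) := by
  set p : ℝ → ℝ := fun x => 2 * ν * (besselReg (-ν) x * besselReg ν x)
    + x ^ 2 * (besselReg (-ν) x * besselReg (ν + 1) x - besselReg (-ν + 1) x * besselReg ν x)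
  set w : ℝ → ℝ := fun x =>
    besselSqrt (-ν) x * besselSqrtDeriv ν x - besselSqrtDeriv (-ν) x * besselSqrt ν x
  have hwp : ∀ x > 0, w x = p x := by
    intro x hx
    have e1 : x ^ (-ν + 1 / 2) * x ^ (ν - 1 / 2) = 1 := by
      rw [← Real.rpow_add hx]; ring_nf; simp
    have e2 : x ^ (-ν - 1 / 2) * x ^ (ν + 1 / 2) = 1 := by
      rw [← Real.rpow_add hx]; ring_nf; simp
    have e3 : x ^ (-ν + 1 / 2) * x ^ (ν + 3 / 2) = x ^ 2 := by
      rw [← Real.rpow_add hx, ← Real.rpow_natCast]; congr 1; push_cast; ring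
    have e4 : x ^ (-ν + 3 / 2) * x ^ (ν + 1 / 2) = x ^ 2 := by
      rw [← Real.rpow_add hx, ← Real.rpow_natCast]; congr 1; push_cast; ring
    simp only [w, p, besselSqrt, besselSqrtDeriv]
    linear_combination (ν + 1 / 2) * besselReg (-ν) x * besselReg ν x * e1
      - (-ν + 1 / 2) * besselReg (-ν) x * besselReg ν x * e2
      + besselReg (-ν) x * besselReg (ν + 1) x * e3
      - besselReg (-ν + 1) x * besselReg ν x * e4
  have hw : ∀ x > 0, HasDerivAt w 0 x := by
    intro x hx
    have h := ((hasDerivAt_besselSqrt (μ := -ν) (by linarith) hx).mul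
      (hasDerivAt_besselSqrtDeriv h0 hx)).sub
      ((hasDerivAt_besselSqrtDeriv (μ := -ν) (by linarith) hx).mul (hasDerivAt_besselSqrt h0 hx))
    convert! h using 1
    ring
  obtain ⟨c, hc⟩ := isOpen_Ioi.exists_is_const_of_deriv_eq_zero (convex_Ioi (0 : ℝ)).isPreconnected
    (fun x hx => (hw x hx).differentiableAt.differentiableWithinAt) (fun x hx => (hw x hx).deriv)
  have cont : Continuous p := by
    have c1 := continuous_besselReg (μ := -ν) (by linarith)
    have c2 := continuous_besselReg (μ := ν) (by linarith)
    have c3 := continuous_besselReg (μ := ν + 1) (by linarith)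
    have c4 := continuous_besselReg (μ := -ν + 1) (by linarith)
    fun_prop
  have l1 : Tendsto p (𝓝[>] 0) (𝓝 (p 0)) := (cont.tendsto 0).mono_left nhdsWithin_le_nhds
  have l2 : Tendsto p (𝓝[>] 0) (𝓝 c) := by
    refine tendsto_const_nhds.congr' ?_
    filter_upwards [self_mem_nhdsWithin] with y hy
    rw [← hwp y hy, hc y hy]
  have hpc : p 0 = c := tendsto_nhds_unique l1 l2
  have : w x = p 0 := by rw [hc x hx, hpc]
  simpa [w, p] using this

/-! ### The functions `Φ_{α,0}` and `F_{α,0}` -/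

/-- The derivative of `F_{α,0}`. -/
noncomputable def zeroModeFDeriv (α x : ℝ) : ℝ := besselSqrtDeriv ((1 + α) / 2) x

/-- The normalisation `π / (2 sin νπ)` of `K_ν`, `ν = (1 + α) / 2`. -/
noncomputable def macdonaldConst (α : ℝ) : ℝ := Real.pi / (2 * Real.sin ((1 + α) / 2 * Real.pi))

/-- The derivative of `Φ_{α,0}`. -/
noncomputable def zeroModePhiDeriv (α x : ℝ) : ℝ :=
  macdonaldConst α * (besselSqrtDeriv (-((1 + α) / 2)) x - besselSqrtDeriv ((1 + α) / 2) x)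

/-- The coefficient of `x ^ (1 + α / 2)` in the expansion of `F_{α,0}` at the origin. -/
noncomputable def coeffF (α : ℝ) : ℝ := besselReg ((1 + α) / 2) 0

/-- The coefficient of `x ^ (-α / 2)` in the expansion of `Φ_{α,0}` at the origin. -/
noncomputable def coeffPhi (α : ℝ) : ℝ := macdonaldConst α * besselReg (-((1 + α) / 2)) 0

section Solutions

set_option linter.unusedSectionVars false

variable {α : ℝ} (hα0 : 0 ≤ α) (hα1 : α < 1)
include hα0 hα1

theorem sin_order_pos : 0 < Real.sin ((1 + α) / 2 * Real.pi) := by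
  have := Real.pi_pos
  exact Real.sin_pos_of_pos_of_lt_pi (by positivity) (by nlinarith)

theorem macdonaldConst_pos : 0 < macdonaldConst α := by
  have := sin_order_pos hα0 hα1
  have := Real.pi_pos
  unfold macdonaldConst
  positivity

theorem coeffPhi_pos : 0 < coeffPhi α :=
  mul_pos (macdonaldConst_pos hα0 hα1) (besselReg_pos (by linarith) _)

theorem coeffF_pos : 0 < coeffF α := besselReg_pos (by linarith) _

omit hα0 hα1 in
theorem zeroModeF_eq {x : ℝ} (hx : 0 < x) : zeroModeF α x = besselSqrt ((1 + α) / 2) x :=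
  sqrt_mul_besselI hx _

omit hα0 hα1 in
theorem zeroModePhi_eq {x : ℝ} (hx : 0 < x) : zeroModePhi α x =
    macdonaldConst α * (besselSqrt (-((1 + α) / 2)) x - besselSqrt ((1 + α) / 2) x) := by
  rw [← sqrt_mul_besselI hx, ← sqrt_mul_besselI hx, zeroModePhi, besselK, macdonaldConst]
  ring

theorem hasDerivAt_zeroModeF {x : ℝ} (hx : 0 < x) :
    HasDerivAt (zeroModeF α) (zeroModeFDeriv α x) x := by
  refine (hasDerivAt_besselSqrt (μ := (1 + α) / 2) (by linarith) hx).congr_of_eventuallyEq ?_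
  filter_upwards [Ioi_mem_nhds hx] with y hy
  exact zeroModeF_eq hy

theorem hasDerivAt_zeroModePhi {x : ℝ} (hx : 0 < x) :
    HasDerivAt (zeroModePhi α) (zeroModePhiDeriv α x) x := by
  refine (((hasDerivAt_besselSqrt (μ := -((1 + α) / 2)) (by linarith) hx).sub
    (hasDerivAt_besselSqrt (μ := (1 + α) / 2) (by linarith) hx)).const_mul
      (macdonaldConst α)).congr_of_eventuallyEq ?_
  filter_upwards [Ioi_mem_nhds hx] with y hy
  exact zeroModePhi_eq hy

theorem hasDerivAt_zeroModeFDeriv {x : ℝ} (hx : 0 < x) :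
    HasDerivAt (zeroModeFDeriv α) ((1 + couplingConst α / x ^ 2) * zeroModeF α x) x := by
  convert! hasDerivAt_besselSqrtDeriv (μ := (1 + α) / 2) (by linarith) hx using 1
  rw [zeroModeF_eq hx, couplingConst]
  ring

theorem hasDerivAt_zeroModePhiDeriv {x : ℝ} (hx : 0 < x) :
    HasDerivAt (zeroModePhiDeriv α) ((1 + couplingConst α / x ^ 2) * zeroModePhi α x) x := by
  convert! ((hasDerivAt_besselSqrtDeriv (μ := -((1 + α) / 2)) (by linarith) hx).sub
    (hasDerivAt_besselSqrtDeriv (μ := (1 + α) / 2) (by linarith) hx)).const_mul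
      (macdonaldConst α) using 1
  rw [zeroModePhi_eq hx, couplingConst]
  ring

/-- The reflection formula for Γ evaluates the constant in `besselSqrt_wronskian` as 2 sin(νπ)/π,
which the normalisation of K_ν cancels. The F-component of Φ does not contribute. -/
theorem zeroMode_wronskian {x : ℝ} (hx : 0 < x) :
    zeroModePhi α x * zeroModeFDeriv α x - zeroModePhiDeriv α x * zeroModeF α x = 1 := by
  have h := besselSqrt_wronskian (ν := (1 + α) / 2) (by linarith) (by linarith) hx
  have hs := sin_order_pos hα0 hα1
  have hG : 0 < Real.Gamma ((1 + α) / 2) := Real.Gamma_pos_of_pos (by linarith)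
  have hG' : 0 < Real.Gamma (1 - (1 + α) / 2) := Real.Gamma_pos_of_pos (by linarith)
  have hr := Real.Gamma_mul_Gamma_one_sub ((1 + α) / 2)
  have e : 2 * ((1 + α) / 2) * (besselReg (-((1 + α) / 2)) 0 * besselReg ((1 + α) / 2) 0)
      = 2 * Real.sin ((1 + α) / 2 * Real.pi) / Real.pi := by
    rw [besselReg_zero, besselReg_zero, neg_neg,
      show -((1 + α) / 2) + 1 = 1 - (1 + α) / 2 by ring,
      Real.Gamma_add_one (s := (1 + α) / 2) (by linarith),
      Real.rpow_neg two_pos.le, mul_comm ((1 + α) / 2) Real.pi]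
    have h2 : (0 : ℝ) < 2 ^ ((1 + α) / 2) := by positivity
    have hpi := Real.pi_pos
    have hs' : 0 < Real.sin (Real.pi * ((1 + α) / 2)) := by rwa [mul_comm]
    have hν : (1 + α) / 2 ≠ 0 := by linarith
    generalize (1 + α) / 2 = ν at *
    generalize Real.sin (Real.pi * ν) = σ at *
    rw [eq_div_iff hs'.ne'] at hr
    rw [eq_div_iff hpi.ne', ← hr]
    field_simp
  rw [zeroModePhi_eq hx, zeroModeF_eq hx, zeroModeFDeriv, zeroModePhiDeriv]
  have hpi := Real.pi_pos
  have : macdonaldConst α * (2 * Real.sin ((1 + α) / 2 * Real.pi) / Real.pi) = 1 := by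
    rw [macdonaldConst, div_mul_div_comm, div_eq_one_iff_eq (by positivity)]
    ring
  linear_combination this + macdonaldConst α * (h.trans e)

/-! ### Signs and monotonicity of F, Φ and their derivatives. -/

theorem zeroModeF_pos {x : ℝ} (hx : 0 < x) : 0 < zeroModeF α x := by
  rw [zeroModeF_eq hx]
  exact mul_pos (Real.rpow_pos_of_pos hx _) (besselReg_pos (by linarith) x)

theorem zeroModeFDeriv_pos {x : ℝ} (hx : 0 < x) : 0 < zeroModeFDeriv α x := by
  have h1 := besselReg_pos (μ := (1 + α) / 2) (by linarith) x
  have h2 := besselReg_pos (μ := (1 + α) / 2 + 1) (by linarith) x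
  unfold zeroModeFDeriv besselSqrtDeriv
  positivity

theorem couplingConst_nonneg : 0 ≤ couplingConst α := by
  unfold couplingConst; positivity

theorem zeroModeFDeriv_mono {x y : ℝ} (hx : 0 < x) (hxy : x ≤ y) :
    zeroModeFDeriv α x ≤ zeroModeFDeriv α y := by
  have h : MonotoneOn (zeroModeFDeriv α) (Ioi 0) := by
    refine monotoneOn_of_hasDerivWithinAt_nonneg (convex_Ioi 0)
      (fun x hx => (hasDerivAt_zeroModeFDeriv hα0 hα1 hx).continuousAt.continuousWithinAt)
      (fun x hx => (hasDerivAt_zeroModeFDeriv hα0 hα1 ?_).hasDerivWithinAt) fun x hx => ?_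
    · simpa using hx
    · rw [interior_Ioi] at hx
      have := couplingConst_nonneg hα0 hα1
      have := zeroModeF_pos hα0 hα1 hx
      positivity
  exact h hx (hx.trans_le hxy) hxy

/-- F' is positive and nondecreasing, so on [1, ∞) F stays above its tangent line at 1. -/
theorem tendsto_zeroModeF_atTop : Tendsto (zeroModeF α) atTop atTop := by
  have h1 := zeroModeFDeriv_pos hα0 hα1 one_pos
  have h : ∀ x ≥ 1, zeroModeF α 1 + zeroModeFDeriv α 1 * (x - 1) ≤ zeroModeF α x := by
    intro x hx
    have hm : MonotoneOn (fun x => zeroModeF α x - zeroModeFDeriv α 1 * (x - 1)) (Ici 1) := by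
      have hd : ∀ x : ℝ, 0 < x → HasDerivAt (fun x => zeroModeF α x - zeroModeFDeriv α 1 * (x - 1))
          (zeroModeFDeriv α x - zeroModeFDeriv α 1 * 1) x := fun x hx =>
        (hasDerivAt_zeroModeF hα0 hα1 hx).sub (((hasDerivAt_id x).sub_const 1).const_mul _)
      refine monotoneOn_of_hasDerivWithinAt_nonneg (convex_Ici 1)
        (fun x hx => (hd x (one_pos.trans_le hx)).continuousAt.continuousWithinAt)
        (fun x hx => (hd x ?_).hasDerivWithinAt) fun x hx => ?_
      · rw [interior_Ici] at hx; exact one_pos.trans hx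
      · rw [interior_Ici] at hx
        have := zeroModeFDeriv_mono hα0 hα1 one_pos (le_of_lt hx)
        linarith
    have := hm (mem_Ici.2 le_rfl) hx hx
    simp only [sub_self, mul_zero, sub_zero] at this
    linarith
  refine tendsto_atTop_mono' atTop (eventually_ge_atTop 1 |>.mono h) ?_
  exact tendsto_atTop_add_const_left _ _
    ((tendsto_atTop_add_const_right _ (-1) tendsto_id).const_mul_atTop h1)

/-- The quotient is a constant multiple of I_{-ν}/I_ν − 1. This is the only place where behaviour at
infinity of Bessel functions enters. -/
theorem tendsto_zeroModePhi_div : Tendsto (fun x => zeroModePhi α x / zeroModeF α x) atTop (𝓝 0) := by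
  have h1 : Tendsto (fun x : ℝ => x / 2) atTop atTop := tendsto_id.atTop_div_const two_pos
  have h := (((tendsto_besselDouble_neg_div (ν := (1 + α) / 2) (by linarith) (by linarith)).comp
    h1).sub_const 1).const_mul (macdonaldConst α)
  rw [sub_self, mul_zero] at h
  refine h.congr' ?_
  filter_upwards [eventually_gt_atTop 0] with x hx
  have p : 0 < besselDouble ((1 + α) / 2) (x / 2) := besselDouble_pos (by linarith) (by positivity)
  have hs : 0 < √x := Real.sqrt_pos.2 hx
  rw [zeroModePhi_eq hx, zeroModeF_eq hx, ← sqrt_mul_besselI hx, ← sqrt_mul_besselI hx,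
    besselI_eq hx, besselI_eq hx, Function.comp_apply]
  field_simp

theorem hasDerivAt_zeroModePhi_div {x : ℝ} (hx : 0 < x) :
    HasDerivAt (fun x => zeroModePhi α x / zeroModeF α x) (-(1 / zeroModeF α x ^ 2)) x := by
  have hF := (zeroModeF_pos hα0 hα1 hx).ne'
  convert! (hasDerivAt_zeroModePhi hα0 hα1 hx).div (hasDerivAt_zeroModeF hα0 hα1 hx) hF using 1
  rw [← neg_div, ← zeroMode_wronskian hα0 hα1 hx]
  ring

/-- By the Wronskian identity (Φ/F)' = −1/F², so Φ/F decreases strictly, and its limit at infinity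
is 0. -/
theorem zeroModePhi_pos {x : ℝ} (hx : 0 < x) : 0 < zeroModePhi α x := by
  have hanti : StrictAntiOn (fun x => zeroModePhi α x / zeroModeF α x) (Ioi 0) := by
    refine strictAntiOn_of_deriv_neg (convex_Ioi 0)
      (fun x hx => (hasDerivAt_zeroModePhi_div hα0 hα1 hx).continuousAt.continuousWithinAt) ?_
    intro x hx
    rw [interior_Ioi] at hx
    rw [(hasDerivAt_zeroModePhi_div hα0 hα1 hx).deriv]
    have := zeroModeF_pos hα0 hα1 hx
    have : 0 < 1 / zeroModeF α x ^ 2 := by positivity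
    linarith
  have h1 : 0 ≤ zeroModePhi α (x + 1) / zeroModeF α (x + 1) := by
    refine le_of_tendsto (tendsto_zeroModePhi_div hα0 hα1) ?_
    filter_upwards [eventually_ge_atTop (x + 1)] with y hy
    exact hanti.antitoneOn (mem_Ioi.2 (by linarith)) (mem_Ioi.2 (by linarith)) hy
  have h2 := hanti (mem_Ioi.2 hx) (mem_Ioi.2 (by linarith)) (lt_add_one x)
  have h3 : 0 < zeroModePhi α x / zeroModeF α x := h1.trans_lt h2
  rw [div_pos_iff_of_pos_right (zeroModeF_pos hα0 hα1 hx)] at h3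
  exact h3

/-- By the Wronskian identity the claim amounts to Φ(x)F'(x) ≤ 1. Since Φ/F at x is the integral of
1/F² over (x, ∞) and F' is nondecreasing, it is at most 1/F'(x) times the integral of F'/F², which
is 1/(F'(x)F(x)). -/
theorem zeroModePhiDeriv_nonpos {x : ℝ} (hx : 0 < x) : zeroModePhiDeriv α x ≤ 0 := by
  have hF := zeroModeF_pos hα0 hα1 hx
  have hD := zeroModeFDeriv_pos hα0 hα1 hx
  -- The difference of the two sides of this comparison as a function of the left endpoint, with
  -- F'(x) frozen. It increases to 0 at infinity, so it is nonpositive at x.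
  set q : ℝ → ℝ := fun y => zeroModePhi α y / zeroModeF α y
    - 1 / zeroModeFDeriv α x * (1 / zeroModeF α y)
  have hq : ∀ y > 0, HasDerivAt q (-(1 / zeroModeF α y ^ 2)
      - 1 / zeroModeFDeriv α x * (-zeroModeFDeriv α y / zeroModeF α y ^ 2)) y := by
    intro y hy
    refine (hasDerivAt_zeroModePhi_div hα0 hα1 hy).sub (HasDerivAt.const_mul _ ?_)
    simpa [Pi.inv_def] using (hasDerivAt_zeroModeF hα0 hα1 hy).inv (zeroModeF_pos hα0 hα1 hy).ne'
  have hmono : MonotoneOn q (Ici x) := by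
    refine monotoneOn_of_hasDerivWithinAt_nonneg (convex_Ici x)
      (fun y hy => (hq y (hx.trans_le hy)).continuousAt.continuousWithinAt)
      (fun y hy => (hq y ?_).hasDerivWithinAt) fun y hy => ?_
    · rw [interior_Ici] at hy; exact hx.trans hy
    · rw [interior_Ici] at hy
      have hy0 : 0 < y := hx.trans hy
      have hFy := zeroModeF_pos hα0 hα1 hy0
      have := zeroModeFDeriv_mono hα0 hα1 hx (le_of_lt hy)
      have e : -(1 / zeroModeF α y ^ 2)
          - 1 / zeroModeFDeriv α x * (-zeroModeFDeriv α y / zeroModeF α y ^ 2)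
          = (zeroModeFDeriv α y - zeroModeFDeriv α x)
            / (zeroModeFDeriv α x * zeroModeF α y ^ 2) := by
        field_simp; ring
      rw [e]
      exact div_nonneg (by linarith) (by positivity)
  have hlim : Tendsto q atTop (𝓝 0) := by
    have h := (tendsto_zeroModePhi_div hα0 hα1).sub
      (((tendsto_zeroModeF_atTop hα0 hα1).inv_tendsto_atTop).const_mul (1 / zeroModeFDeriv α x))
    simpa [q] using h
  have h0 : q x ≤ 0 := by
    refine ge_of_tendsto hlim ?_
    filter_upwards [eventually_ge_atTop x] with y hy
    exact hmono (mem_Ici.2 le_rfl) hy hy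
  have h1 : zeroModePhi α x * zeroModeFDeriv α x ≤ 1 := by
    have e : q x = (zeroModePhi α x * zeroModeFDeriv α x - 1)
        / (zeroModeF α x * zeroModeFDeriv α x) := by
      simp only [q]; field_simp
    rw [e, div_nonpos_iff] at h0
    have : 0 < zeroModeF α x * zeroModeFDeriv α x := by positivity
    rcases h0 with h0 | h0 <;> linarith [h0.1, h0.2]
  have h2 := zeroMode_wronskian hα0 hα1 hx
  have h3 : zeroModePhiDeriv α x * zeroModeF α x ≤ 0 := by linarith
  exact nonpos_of_mul_nonpos_left h3 hF

theorem contDiffOn_zeroModeF : ContDiffOn ℝ ∞ (zeroModeF α) (Ioi 0) :=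
  (contDiffOn_besselSqrt (μ := (1 + α) / 2) (by linarith)).congr fun _ hx => zeroModeF_eq hx

theorem contDiffOn_zeroModePhi : ContDiffOn ℝ ∞ (zeroModePhi α) (Ioi 0) :=
  (contDiffOn_const.mul ((contDiffOn_besselSqrt (μ := -((1 + α) / 2)) (by linarith)).sub
    (contDiffOn_besselSqrt (μ := (1 + α) / 2) (by linarith)))).congr fun _ hx => zeroModePhi_eq hx

/-! ### Bounds and expansions of F and Φ at the origin. -/

theorem exists_zeroModeF_le :
    ∃ C > 0, ∀ x ∈ Ioc (0 : ℝ) 1, zeroModeF α x ≤ C * x ^ (1 + α / 2) := by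
  obtain ⟨C, hC, h⟩ := exists_besselSqrt_le (μ := (1 + α) / 2) (by linarith)
  refine ⟨C, hC, fun x hx => ?_⟩
  rw [zeroModeF_eq hx.1]
  convert! (le_abs_self _).trans (h x hx) using 3
  ring

theorem exists_zeroModeFDeriv_le :
    ∃ C > 0, ∀ x ∈ Ioc (0 : ℝ) 1, zeroModeFDeriv α x ≤ C * x ^ (α / 2) := by
  obtain ⟨C, hC, h⟩ := exists_besselSqrtDeriv_le (μ := (1 + α) / 2) (by linarith)
  refine ⟨C, hC, fun x hx => ?_⟩
  have h2 := (le_abs_self _).trans (h x hx)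
  rwa [show (1 + α) / 2 - 1 / 2 = α / 2 by ring] at h2

theorem exists_zeroModePhi_le :
    ∃ C > 0, ∀ x ∈ Ioc (0 : ℝ) 1, zeroModePhi α x ≤ C * x ^ (-(α / 2)) := by
  obtain ⟨C, hC, h⟩ := exists_besselSqrt_le (μ := -((1 + α) / 2)) (by linarith)
  have hm := macdonaldConst_pos hα0 hα1
  refine ⟨macdonaldConst α * C, by positivity, fun x hx => ?_⟩
  have h1 := zeroModeF_pos hα0 hα1 hx.1
  have h2 := (le_abs_self _).trans (h x hx)
  rw [zeroModeF_eq hx.1] at h1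
  rw [show -((1 + α) / 2) + 1 / 2 = -(α / 2) by ring] at h2
  rw [zeroModePhi_eq hx.1, mul_assoc]
  exact mul_le_mul_of_nonneg_left (by linarith) hm.le

theorem zeroModeF_sub_isLittleO :
    (fun x => zeroModeF α x - coeffF α * x ^ (1 + α / 2)) =o[𝓝[>] 0] fun x : ℝ => x ^ (3 / 2 : ℝ) := by
  refine (besselSqrt_sub_isLittleO (μ := (1 + α) / 2) (by linarith) (by linarith)).congr' ?_
    EventuallyEq.rfl
  filter_upwards [self_mem_nhdsWithin] with x hx
  rw [zeroModeF_eq hx, coeffF, show (1 + α) / 2 + 1 / 2 = 1 + α / 2 by ring]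

/-- The component of order −ν has its first correction at x^{5/2−ν}, which is o(x^{3/2}) because ν <
1. This is a place where α < 1 is essential. -/
theorem zeroModePhi_sub_isLittleO :
    (fun x => zeroModePhi α x - (coeffPhi α * x ^ (-(α / 2))
      + -(macdonaldConst α * coeffF α) * x ^ (1 + α / 2)))
      =o[𝓝[>] 0] fun x : ℝ => x ^ (3 / 2 : ℝ) := by
  refine (((besselSqrt_sub_isLittleO (μ := -((1 + α) / 2)) (by linarith) (by linarith)).sub
    (besselSqrt_sub_isLittleO (μ := (1 + α) / 2) (by linarith) (by linarith))).const_mul_left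
    (macdonaldConst α)).congr' ?_ EventuallyEq.rfl
  filter_upwards [self_mem_nhdsWithin] with x hx
  rw [zeroModePhi_eq hx, coeffF, coeffPhi, show (1 + α) / 2 + 1 / 2 = 1 + α / 2 by ring,
    show -((1 + α) / 2) + 1 / 2 = -(α / 2) by ring]
  ring

end Solutions

/-! ### Schur's test -/

section Schur

open ENNReal

variable {X : Type*} [MeasurableSpace X] {μ : Measure X}

/-- Cauchy-Schwarz for the factors k^{1/2} and k^{1/2} f. -/
theorem sq_lintegral_mul_le {k f : X → ℝ≥0∞} (hk : AEMeasurable k μ) (hf : AEMeasurable f μ) :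
    (∫⁻ y, k y * f y ∂μ) ^ 2 ≤ (∫⁻ y, k y ∂μ) * ∫⁻ y, k y * f y ^ 2 ∂μ := by
  have h := ENNReal.lintegral_mul_le_Lp_mul_Lq μ Real.HolderConjugate.two_two
    (hk.pow_const (1 / 2 : ℝ)) ((hk.pow_const (1 / 2 : ℝ)).mul hf)
  have e1 : ∀ y, k y ^ (1 / 2 : ℝ) * k y ^ (1 / 2 : ℝ) = k y := fun y => by
    rw [← ENNReal.rpow_add_of_nonneg _ _ (by norm_num) (by norm_num)]; norm_num
  have e2 : ∀ y, (k y ^ (1 / 2 : ℝ)) ^ (2 : ℝ) = k y := fun y => by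
    rw [← ENNReal.rpow_mul]; norm_num
  simp only [Pi.mul_apply, ← mul_assoc, e1, ENNReal.mul_rpow_of_nonneg _ _ zero_le_two, e2] at h
  calc (∫⁻ y, k y * f y ∂μ) ^ 2
      ≤ ((∫⁻ y, k y ∂μ) ^ (1 / 2 : ℝ) * (∫⁻ y, k y * f y ^ (2 : ℝ) ∂μ) ^ (1 / 2 : ℝ)) ^ 2 := by
        gcongr
    _ = _ := by
        rw [← ENNReal.rpow_two, ENNReal.mul_rpow_of_nonneg _ _ zero_le_two, ← ENNReal.rpow_mul,
          ← ENNReal.rpow_mul]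
        norm_num

/-- The row bound enters through Cauchy-Schwarz with respect to K(x, ·), the column bound after
exchanging the integrals. No square-integrability of f is needed, both sides being allowed to be
infinite. -/
theorem lintegral_sq_schur_le [SFinite μ] {K : X → X → ℝ≥0∞}
    (hK : AEMeasurable (Function.uncurry K) (μ.prod μ)) (hKx : ∀ᵐ x ∂μ, AEMeasurable (K x) μ)
    (h1 : ∀ᵐ x ∂μ, ∫⁻ y, K x y ∂μ ≤ 1) (h2 : ∀ᵐ y ∂μ, ∫⁻ x, K x y ∂μ ≤ 1)
    {f : X → ℝ≥0∞} (hf : AEMeasurable f μ) :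
    ∫⁻ x, (∫⁻ y, K x y * f y ∂μ) ^ 2 ∂μ ≤ ∫⁻ y, f y ^ 2 ∂μ := by
  have hf2 : AEMeasurable (fun y => f y ^ 2) μ := hf.pow_const 2
  calc ∫⁻ x, (∫⁻ y, K x y * f y ∂μ) ^ 2 ∂μ ≤ ∫⁻ x, ∫⁻ y, K x y * f y ^ 2 ∂μ ∂μ := by
        refine lintegral_mono_ae ?_
        filter_upwards [hKx, h1] with x hx hx1
        refine (sq_lintegral_mul_le hx hf).trans ?_
        exact (mul_le_mul_left hx1 _).trans (one_mul _).le
    _ = ∫⁻ y, ∫⁻ x, K x y * f y ^ 2 ∂μ ∂μ :=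
        lintegral_lintegral_swap ((show AEMeasurable (fun p : X × X => K p.1 p.2 * f p.2 ^ 2)
          (μ.prod μ) from AEMeasurable.mul (f := Function.uncurry K) hK hf2.comp_snd))
    _ ≤ ∫⁻ y, f y ^ 2 ∂μ := by
        refine lintegral_mono_ae ?_
        have hK' : ∀ᵐ y ∂μ, AEMeasurable (fun x => K x y) μ := by
          have := (hK.aestronglyMeasurable.comp_quasiMeasurePreserving
            Measure.measurePreserving_swap.quasiMeasurePreserving).prodMk_left
          filter_upwards [this] with y hy
          exact hy.aemeasurable
        filter_upwards [hK', h2] with y hy hy2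
        rw [lintegral_mul_const'' _ hy]
        exact (mul_le_mul_left hy2 _).trans (one_mul _).le

end Schur

/-! ### The Green operator -/

section Green

set_option linter.unusedSectionVars false

variable {α : ℝ} (hα0 : 0 ≤ α) (hα1 : α < 1)
include hα0 hα1

theorem continuousOn_zeroModeF : ContinuousOn (zeroModeF α) (Ioi 0) :=
  (contDiffOn_zeroModeF hα0 hα1).continuousOn

theorem continuousOn_zeroModePhi : ContinuousOn (zeroModePhi α) (Ioi 0) :=
  (contDiffOn_zeroModePhi hα0 hα1).continuousOn

theorem zeroModeF_mono {x y : ℝ} (hx : 0 < x) (hxy : x ≤ y) : zeroModeF α x ≤ zeroModeF α y := by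
  have h : MonotoneOn (zeroModeF α) (Ioi 0) := by
    refine monotoneOn_of_hasDerivWithinAt_nonneg (convex_Ioi 0) (continuousOn_zeroModeF hα0 hα1)
      (fun x hx => (hasDerivAt_zeroModeF hα0 hα1 ?_).hasDerivWithinAt) fun x hx => ?_
    · simpa using hx
    · rw [interior_Ioi] at hx
      exact (zeroModeFDeriv_pos hα0 hα1 hx).le
  exact h hx (hx.trans_le hxy) hxy

theorem zeroModePhi_anti {x y : ℝ} (hx : 0 < x) (hxy : x ≤ y) :
    zeroModePhi α y ≤ zeroModePhi α x := by
  have h : AntitoneOn (zeroModePhi α) (Ioi 0) := by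
    refine antitoneOn_of_deriv_nonpos (convex_Ioi 0) (continuousOn_zeroModePhi hα0 hα1)
      (fun x hx => (hasDerivAt_zeroModePhi hα0 hα1
        (by simpa using hx)).differentiableAt.differentiableWithinAt) fun x hx => ?_
    rw [interior_Ioi] at hx
    rw [(hasDerivAt_zeroModePhi hα0 hα1 hx).deriv]
    exact zeroModePhiDeriv_nonpos hα0 hα1 hx
  exact h hx (hx.trans_le hxy) hxy

omit hα0 hα1 in
theorem zeroModeGreen_eq (r ρ : ℝ) :
    zeroModeGreen α r ρ = zeroModePhi α (max r ρ) * zeroModeF α (min r ρ) := by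
  unfold zeroModeGreen
  split_ifs with h
  · rw [max_eq_left h.le, min_eq_right h.le]
  · rw [max_eq_right (not_lt.1 h), min_eq_left (not_lt.1 h), mul_comm]

omit hα0 hα1 in
theorem zeroModeGreen_symm (r ρ : ℝ) : zeroModeGreen α r ρ = zeroModeGreen α ρ r := by
  rw [zeroModeGreen_eq, zeroModeGreen_eq, max_comm, min_comm]

theorem zeroModeGreen_nonneg {r ρ : ℝ} (hr : 0 < r) (hρ : 0 < ρ) : 0 ≤ zeroModeGreen α r ρ := by
  rw [zeroModeGreen_eq]
  exact mul_nonneg (zeroModePhi_pos hα0 hα1 (lt_max_of_lt_left hr)).le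
    (zeroModeF_pos hα0 hα1 (lt_min hr hρ)).le

theorem continuousOn_zeroModeGreen :
    ContinuousOn (Function.uncurry (zeroModeGreen α)) (Ioi 0 ×ˢ Ioi 0) := by
  have h : Function.uncurry (zeroModeGreen α)
      = fun p : ℝ × ℝ => zeroModePhi α (max p.1 p.2) * zeroModeF α (min p.1 p.2) := by
    funext p
    exact zeroModeGreen_eq _ _
  rw [h]
  refine ((continuousOn_zeroModePhi hα0 hα1).comp (by fun_prop) ?_).mul
    ((continuousOn_zeroModeF hα0 hα1).comp (by fun_prop) ?_)
  · exact fun p hp => mem_Ioi.2 (lt_max_of_lt_left hp.1)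
  · exact fun p hp => mem_Ioi.2 (lt_min hp.1 hp.2)

theorem aestronglyMeasurable_zeroModeGreen :
    AEStronglyMeasurable (Function.uncurry (zeroModeGreen α))
      (halfLineMeasure.prod halfLineMeasure) := by
  rw [Measure.prod_restrict]
  exact (continuousOn_zeroModeGreen hα0 hα1).aestronglyMeasurable
    (measurableSet_Ioi.prod measurableSet_Ioi)

/-- As C_α ≥ 0, F ≤ (1 + C_α/x²)F = F''. -/
theorem lintegral_zeroModeF_le {a b : ℝ} (ha : 0 < a) (hab : a ≤ b) :
    ∫⁻ x in Ioc a b, ENNReal.ofReal (zeroModeF α x)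
      ≤ ENNReal.ofReal (zeroModeFDeriv α b - zeroModeFDeriv α a) := by
  have hsub : Icc a b ⊆ Ioi 0 := fun x hx => ha.trans_le hx.1
  have c1 : ContinuousOn (zeroModeF α) (Icc a b) := (continuousOn_zeroModeF hα0 hα1).mono hsub
  have c2 : ContinuousOn (fun x => (1 + couplingConst α / x ^ 2) * zeroModeF α x) (Icc a b) := by
    refine ContinuousOn.mul (continuousOn_const.add (continuousOn_const.div (by fun_prop) ?_)) c1
    intro x hx
    have : 0 < x := hsub hx
    positivity
  rw [← uIcc_of_le hab] at c1 c2
  have i1 := c1.intervalIntegrable (μ := volume)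
  have i2 := c2.intervalIntegrable (μ := volume)
  have h := intervalIntegral.integral_eq_sub_of_hasDerivAt (fun x hx =>
    hasDerivAt_zeroModeFDeriv hα0 hα1 (hsub (by rwa [uIcc_of_le hab] at hx))) i2
  have hm := intervalIntegral.integral_mono_on hab i1 i2 (fun x hx => by
    have h1 := zeroModeF_pos hα0 hα1 (hsub hx)
    have h2 := couplingConst_nonneg hα0 hα1
    have h3 : 0 ≤ couplingConst α / x ^ 2 := by positivity
    nlinarith)
  rw [h, intervalIntegral.integral_of_le hab] at hm
  rw [← ofReal_integral_eq_lintegral_ofReal i1.1]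
  · exact ENNReal.ofReal_le_ofReal hm
  · filter_upwards [ae_restrict_mem measurableSet_Ioc] with x hx
    exact (zeroModeF_pos hα0 hα1 (ha.trans hx.1)).le

theorem lintegral_zeroModePhi_le {a b : ℝ} (ha : 0 < a) (hab : a ≤ b) :
    ∫⁻ x in Ioc a b, ENNReal.ofReal (zeroModePhi α x)
      ≤ ENNReal.ofReal (zeroModePhiDeriv α b - zeroModePhiDeriv α a) := by
  have hsub : Icc a b ⊆ Ioi 0 := fun x hx => ha.trans_le hx.1
  have c1 : ContinuousOn (zeroModePhi α) (Icc a b) := (continuousOn_zeroModePhi hα0 hα1).mono hsub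
  have c2 : ContinuousOn (fun x => (1 + couplingConst α / x ^ 2) * zeroModePhi α x) (Icc a b) := by
    refine ContinuousOn.mul (continuousOn_const.add (continuousOn_const.div (by fun_prop) ?_)) c1
    intro x hx
    have : 0 < x := hsub hx
    positivity
  rw [← uIcc_of_le hab] at c1 c2
  have i1 := c1.intervalIntegrable (μ := volume)
  have i2 := c2.intervalIntegrable (μ := volume)
  have h := intervalIntegral.integral_eq_sub_of_hasDerivAt (fun x hx =>
    hasDerivAt_zeroModePhiDeriv hα0 hα1 (hsub (by rwa [uIcc_of_le hab] at hx))) i2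
  have hm := intervalIntegral.integral_mono_on hab i1 i2 (fun x hx => by
    have h1 := zeroModePhi_pos hα0 hα1 (hsub hx)
    have h2 := couplingConst_nonneg hα0 hα1
    have h3 : 0 ≤ couplingConst α / x ^ 2 := by positivity
    nlinarith)
  rw [h, intervalIntegral.integral_of_le hab] at hm
  rw [← ofReal_integral_eq_lintegral_ofReal i1.1]
  · exact ENNReal.ofReal_le_ofReal hm
  · filter_upwards [ae_restrict_mem measurableSet_Ioc] with x hx
    exact (zeroModePhi_pos hα0 hα1 (ha.trans hx.1)).le

/-- The interval is exhausted from the right of the origin, and the contribution −F' of the left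
endpoint has a favourable sign. -/
theorem lintegral_zeroModeF_Ioc_le {r : ℝ} (hr : 0 < r) :
    ∫⁻ x in Ioc 0 r, ENNReal.ofReal (zeroModeF α x) ≤ ENNReal.ofReal (zeroModeFDeriv α r) := by
  have e : Ioc 0 r = ⋃ n : ℕ, Ioc (r / (n + 1)) r := by
    ext x
    simp only [mem_iUnion, mem_Ioc]
    constructor
    · rintro ⟨h0, h1⟩
      obtain ⟨n, hn⟩ := exists_nat_gt (r / x)
      refine ⟨n, ?_, h1⟩
      rw [div_lt_iff₀ h0] at hn
      rw [div_lt_iff₀ (by positivity)]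
      nlinarith
    · rintro ⟨n, h0, h1⟩
      exact ⟨lt_trans (by positivity) h0, h1⟩
  rw [e, setLIntegral_iUnion_of_directed]
  · refine iSup_le fun n => (lintegral_zeroModeF_le hα0 hα1 (by positivity) ?_).trans ?_
    · exact div_le_self hr.le (by linarith [n.cast_nonneg (α := ℝ)])
    · have := zeroModeFDeriv_pos hα0 hα1 (x := r / (n + 1)) (by positivity)
      exact ENNReal.ofReal_le_ofReal (by linarith)
  · refine directed_of_isDirected_le fun m n hmn => Ioc_subset_Ioc_left ?_
    gcongr

theorem lintegral_zeroModePhi_Ioi_le {r : ℝ} (hr : 0 < r) :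
    ∫⁻ x in Ioi r, ENNReal.ofReal (zeroModePhi α x) ≤ ENNReal.ofReal (-zeroModePhiDeriv α r) := by
  have e : Ioi r = ⋃ n : ℕ, Ioc r (r + n) := by
    ext x
    simp only [mem_iUnion, mem_Ioc, mem_Ioi]
    constructor
    · intro h0
      obtain ⟨n, hn⟩ := exists_nat_gt (x - r)
      exact ⟨n, h0, by linarith⟩
    · rintro ⟨n, h0, h1⟩
      exact h0
  rw [e, setLIntegral_iUnion_of_directed]
  · refine iSup_le fun n => (lintegral_zeroModePhi_le hα0 hα1 hr
      (by linarith [n.cast_nonneg (α := ℝ)])).trans ?_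
    have := zeroModePhiDeriv_nonpos hα0 hα1 (x := r + n) (by positivity)
    exact ENNReal.ofReal_le_ofReal (by linarith)
  · refine directed_of_isDirected_le fun m n hmn => Ioc_subset_Ioc_right ?_
    gcongr

/-- The parts ρ ≤ r and ρ > r contribute at most ΦF' and −FΦ' at r, whose sum is the Wronskian. The
constant 1 is the bound expected for (A+1)⁻¹ with A ≥ 0. -/
theorem lintegral_zeroModeGreen_le {r : ℝ} (hr : 0 < r) :
    ∫⁻ ρ in Ioi 0, ENNReal.ofReal (zeroModeGreen α r ρ) ≤ 1 := by
  have hΦ := zeroModePhi_pos hα0 hα1 hr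
  have hF := zeroModeF_pos hα0 hα1 hr
  have h1 : ∫⁻ ρ in Ioc 0 r, ENNReal.ofReal (zeroModeGreen α r ρ)
      = ENNReal.ofReal (zeroModePhi α r) * ∫⁻ ρ in Ioc 0 r, ENNReal.ofReal (zeroModeF α ρ) := by
    rw [← lintegral_const_mul' _ _ ENNReal.ofReal_ne_top]
    refine setLIntegral_congr_fun measurableSet_Ioc fun ρ hρ => ?_
    rw [zeroModeGreen_eq, max_eq_left hρ.2, min_eq_right hρ.2, ENNReal.ofReal_mul hΦ.le]
  have h2 : ∫⁻ ρ in Ioi r, ENNReal.ofReal (zeroModeGreen α r ρ)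
      = ENNReal.ofReal (zeroModeF α r) * ∫⁻ ρ in Ioi r, ENNReal.ofReal (zeroModePhi α ρ) := by
    rw [← lintegral_const_mul' _ _ ENNReal.ofReal_ne_top]
    refine setLIntegral_congr_fun measurableSet_Ioi fun ρ hρ => ?_
    rw [zeroModeGreen_eq, max_eq_right (le_of_lt hρ), min_eq_left (le_of_lt hρ), mul_comm,
      ENNReal.ofReal_mul hF.le]
  rw [← Ioc_union_Ioi_eq_Ioi hr.le, lintegral_union measurableSet_Ioi
    (Set.disjoint_left.2 fun x hx hx' => not_lt.2 hx.2 hx'), h1, h2]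
  calc _ ≤ ENNReal.ofReal (zeroModePhi α r) * ENNReal.ofReal (zeroModeFDeriv α r)
        + ENNReal.ofReal (zeroModeF α r) * ENNReal.ofReal (-zeroModePhiDeriv α r) := by
        gcongr
        · exact lintegral_zeroModeF_Ioc_le hα0 hα1 hr
        · exact lintegral_zeroModePhi_Ioi_le hα0 hα1 hr
    _ = 1 := by
        have hp := zeroModePhiDeriv_nonpos hα0 hα1 hr
        have hf := zeroModeFDeriv_pos hα0 hα1 hr
        rw [← ENNReal.ofReal_mul hΦ.le, ← ENNReal.ofReal_mul hF.le,
          ← ENNReal.ofReal_add (by positivity) (mul_nonneg hF.le (by linarith)),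
          ← ENNReal.ofReal_one, ← zeroMode_wronskian hα0 hα1 hr]
        congr 1
        ring

/-- Together with integrability of G(r, ·) this uniform bound gives square-integrability, and hence
absolute convergence of the integral against any g in L². -/
theorem zeroModeGreen_le {r ρ : ℝ} (hr : 0 < r) (hρ : 0 < ρ) :
    zeroModeGreen α r ρ ≤ zeroModePhi α r * zeroModeF α r := by
  rw [zeroModeGreen_eq]
  exact mul_le_mul (zeroModePhi_anti hα0 hα1 hr (le_max_left _ _))
    (zeroModeF_mono hα0 hα1 (lt_min hr hρ) (min_le_left _ _))
    (zeroModeF_pos hα0 hα1 (lt_min hr hρ)).le (zeroModePhi_pos hα0 hα1 hr).le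

theorem aestronglyMeasurable_zeroModeGreen_right {r : ℝ} (hr : 0 < r) :
    AEStronglyMeasurable (zeroModeGreen α r) halfLineMeasure := by
  refine ContinuousOn.aestronglyMeasurable ?_ measurableSet_Ioi
  exact (continuousOn_zeroModeGreen hα0 hα1).comp (f := fun ρ : ℝ => (r, ρ)) (by fun_prop)
    fun ρ hρ => ⟨hr, hρ⟩

theorem integrable_zeroModeGreen {r : ℝ} (hr : 0 < r) :
    Integrable (zeroModeGreen α r) halfLineMeasure := by
  refine ⟨aestronglyMeasurable_zeroModeGreen_right hα0 hα1 hr, ?_⟩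
  rw [hasFiniteIntegral_iff_ofReal]
  · exact (lintegral_zeroModeGreen_le hα0 hα1 hr).trans_lt ENNReal.one_lt_top
  · filter_upwards [ae_restrict_mem measurableSet_Ioi] with ρ hρ
    exact zeroModeGreen_nonneg hα0 hα1 hr hρ

theorem memLp_zeroModeGreen {r : ℝ} (hr : 0 < r) :
    MemLp (fun ρ => (zeroModeGreen α r ρ : ℂ)) 2 halfLineMeasure := by
  have hm := aestronglyMeasurable_zeroModeGreen_right hα0 hα1 hr
  refine MemLp.ofReal ((memLp_two_iff_integrable_sq hm).2 ?_)
  refine ((integrable_zeroModeGreen hα0 hα1 hr).const_mul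
    (zeroModePhi α r * zeroModeF α r)).mono' (hm.pow 2) ?_
  filter_upwards [ae_restrict_mem measurableSet_Ioi] with ρ hρ
  have h0 := zeroModeGreen_nonneg hα0 hα1 hr hρ
  rw [Real.norm_of_nonneg (by positivity), sq]
  exact mul_le_mul_of_nonneg_right (zeroModeGreen_le hα0 hα1 hr hρ) h0

theorem integrable_zeroModeGreen_mul {g : ℝ → ℂ} (hg : MemLp g 2 halfLineMeasure) {r : ℝ}
    (hr : 0 < r) : Integrable (fun ρ => (zeroModeGreen α r ρ : ℂ) * g ρ) halfLineMeasure :=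
  (memLp_zeroModeGreen hα0 hα1 hr).integrable_mul hg

/-- The function `r ↦ ∫ G(r, ρ) g(ρ) dρ`. -/
noncomputable def greenIntegral (α : ℝ) (g : ℝ → ℂ) (r : ℝ) : ℂ :=
  ∫ ρ in Ioi 0, (zeroModeGreen α r ρ : ℂ) * g ρ

theorem aestronglyMeasurable_greenIntegral {g : ℝ → ℂ}
    (hg : AEStronglyMeasurable g halfLineMeasure) :
    AEStronglyMeasurable (greenIntegral α g) halfLineMeasure :=
  AEStronglyMeasurable.integral_prod_right'
    (f := fun p : ℝ × ℝ => (zeroModeGreen α p.1 p.2 : ℂ) * g p.2)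
    ((Complex.continuous_ofReal.comp_aestronglyMeasurable
      (aestronglyMeasurable_zeroModeGreen hα0 hα1)).mul hg.comp_snd)

theorem enorm_zeroModeGreen_mul {r ρ : ℝ} (hr : 0 < r) (hρ : 0 < ρ) (z : ℂ) :
    ‖(zeroModeGreen α r ρ : ℂ) * z‖ₑ = ENNReal.ofReal (zeroModeGreen α r ρ) * ‖z‖ₑ := by
  have e : ‖(zeroModeGreen α r ρ : ℂ)‖ₑ = ENNReal.ofReal (zeroModeGreen α r ρ) := by
    rw [← ofReal_norm, Complex.norm_real,
      Real.norm_of_nonneg (zeroModeGreen_nonneg hα0 hα1 hr hρ)]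
  rw [enorm_mul, e]

theorem lintegral_greenIntegral_sq_le {g : ℝ → ℂ} (hg : AEStronglyMeasurable g halfLineMeasure) :
    ∫⁻ r in Ioi 0, (∫⁻ ρ in Ioi 0, ENNReal.ofReal (zeroModeGreen α r ρ) * ‖g ρ‖ₑ) ^ 2
      ≤ ∫⁻ ρ in Ioi 0, ‖g ρ‖ₑ ^ 2 := by
  have b : ∀ᵐ r ∂halfLineMeasure, ∫⁻ ρ in Ioi 0, ENNReal.ofReal (zeroModeGreen α r ρ) ≤ 1 := by
    filter_upwards [ae_restrict_mem measurableSet_Ioi] with r hr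
    exact lintegral_zeroModeGreen_le hα0 hα1 hr
  refine lintegral_sq_schur_le (K := fun r ρ => ENNReal.ofReal (zeroModeGreen α r ρ))
    (aestronglyMeasurable_zeroModeGreen hα0 hα1).aemeasurable.ennreal_ofReal ?_ b ?_ hg.enorm
  · filter_upwards [ae_restrict_mem measurableSet_Ioi] with r hr
    exact (aestronglyMeasurable_zeroModeGreen_right hα0 hα1 hr).aemeasurable.ennreal_ofReal
  · simpa only [zeroModeGreen_symm] using b

theorem enorm_greenIntegral_le (g : ℝ → ℂ) {r : ℝ} (hr : 0 < r) :
    ‖greenIntegral α g r‖ₑ ≤ ∫⁻ ρ in Ioi 0, ENNReal.ofReal (zeroModeGreen α r ρ) * ‖g ρ‖ₑ := by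
  refine (enorm_integral_le_lintegral_enorm _).trans (le_of_eq ?_)
  exact setLIntegral_congr_fun measurableSet_Ioi fun ρ hρ =>
    enorm_zeroModeGreen_mul hα0 hα1 hr hρ _

theorem eLpNorm_greenIntegral_le {g : ℝ → ℂ} (hg : AEStronglyMeasurable g halfLineMeasure) :
    eLpNorm (greenIntegral α g) 2 halfLineMeasure ≤ eLpNorm g 2 halfLineMeasure := by
  rw [eLpNorm_eq_lintegral_rpow_enorm_toReal two_ne_zero ENNReal.ofNat_ne_top,
    eLpNorm_eq_lintegral_rpow_enorm_toReal two_ne_zero ENNReal.ofNat_ne_top]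
  simp only [ENNReal.toReal_ofNat, ENNReal.rpow_two]
  refine ENNReal.rpow_le_rpow ?_ (by norm_num)
  refine le_trans (lintegral_mono_ae ?_) (lintegral_greenIntegral_sq_le hα0 hα1 hg)
  filter_upwards [ae_restrict_mem measurableSet_Ioi] with r hr
  gcongr
  exact enorm_greenIntegral_le hα0 hα1 g hr

theorem memLp_greenIntegral {g : ℝ → ℂ} (hg : MemLp g 2 halfLineMeasure) :
    MemLp (greenIntegral α g) 2 halfLineMeasure :=
  ⟨aestronglyMeasurable_greenIntegral hα0 hα1 hg.1,
    (eLpNorm_greenIntegral_le hα0 hα1 hg.1).trans_lt hg.2⟩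

omit hα0 hα1 in
theorem greenIntegral_congr {f g : ℝ → ℂ} (h : f =ᵐ[halfLineMeasure] g) (r : ℝ) :
    greenIntegral α f r = greenIntegral α g r := by
  refine integral_congr_ae ?_
  filter_upwards [h] with ρ hρ
  rw [hρ]

/-- The integral operator with kernel `G_{α,0}`. -/
noncomputable def greenOperator : HalfLineL2 →L[ℂ] HalfLineL2 :=
  LinearMap.mkContinuous
    { toFun := fun g => (memLp_greenIntegral hα0 hα1 (Lp.memLp g)).toLp _
      map_add' := fun f g => by
        rw [← MemLp.toLp_add]
        refine MemLp.toLp_congr _ _ ?_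
        filter_upwards [ae_restrict_mem measurableSet_Ioi] with r hr
        rw [Pi.add_apply, greenIntegral_congr (Lp.coeFn_add f g), greenIntegral, greenIntegral,
          greenIntegral, ← integral_add (integrable_zeroModeGreen_mul hα0 hα1 (Lp.memLp f) hr)
            (integrable_zeroModeGreen_mul hα0 hα1 (Lp.memLp g) hr)]
        simp only [Pi.add_apply, mul_add]
      map_smul' := fun c g => by
        rw [RingHom.id_apply, ← MemLp.toLp_const_smul]
        refine MemLp.toLp_congr _ _ (Eventually.of_forall fun r => ?_)
        rw [Pi.smul_apply, greenIntegral_congr (Lp.coeFn_smul c g), greenIntegral, greenIntegral,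
          smul_eq_mul, ← integral_const_mul]
        simp only [Pi.smul_apply, smul_eq_mul, mul_left_comm] }
    1 fun g => by
      rw [one_mul, LinearMap.coe_mk, AddHom.coe_mk, Lp.norm_toLp, Lp.norm_def]
      exact ENNReal.toReal_mono (Lp.memLp g).2.ne
        (eLpNorm_greenIntegral_le hα0 hα1 (Lp.memLp g).1)

theorem coeFn_greenOperator (g : HalfLineL2) :
    greenOperator hα0 hα1 g =ᵐ[halfLineMeasure] greenIntegral α g :=
  (memLp_greenIntegral hα0 hα1 (Lp.memLp g)).coeFn_toLp

theorem hasIntegralKernel_greenOperator :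
    HasIntegralKernel (greenOperator hα0 hα1) (zeroModeGreen α) := by
  intro g
  filter_upwards [coeFn_greenOperator hα0 hα1 g, ae_restrict_mem measurableSet_Ioi] with r h hr
  exact ⟨integrable_zeroModeGreen_mul hα0 hα1 (Lp.memLp g) hr, h⟩

/-- Justifies Fubini in the proof of symmetry. With a(r) the integral of G(r, ·)|f|, the estimate
a|g| ≤ a² + |g|² reduces the matter to Schur's bound for a. -/
theorem integrable_green_sesq (f g : HalfLineL2) :
    Integrable (Function.uncurry fun r ρ => (zeroModeGreen α r ρ : ℂ) * (starRingEnd ℂ (f ρ) * g r))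
      (halfLineMeasure.prod halfLineMeasure) := by
  have hf := (Lp.memLp f).1
  have hg := (Lp.memLp g).1
  have hK := aestronglyMeasurable_zeroModeGreen hα0 hα1
  refine ⟨(Complex.continuous_ofReal.comp_aestronglyMeasurable hK).mul
    ((Complex.continuous_conj.comp_aestronglyMeasurable hf.comp_snd).mul hg.comp_fst), ?_⟩
  rw [hasFiniteIntegral_iff_enorm]
  have hmeas : AEMeasurable (fun p : ℝ × ℝ => ENNReal.ofReal (zeroModeGreen α p.1 p.2) * ‖f p.2‖ₑ)
      (halfLineMeasure.prod halfLineMeasure) :=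
    hK.aemeasurable.ennreal_ofReal.mul hf.enorm.comp_snd
  have hf2 : ∫⁻ ρ in Ioi 0, ‖f ρ‖ₑ ^ 2 < ⊤ := by
    simpa using (eLpNorm_lt_top_iff_lintegral_rpow_enorm_lt_top two_ne_zero
      ENNReal.ofNat_ne_top).1 (Lp.memLp f).2
  have hg2 : ∫⁻ ρ in Ioi 0, ‖g ρ‖ₑ ^ 2 < ⊤ := by
    simpa using (eLpNorm_lt_top_iff_lintegral_rpow_enorm_lt_top two_ne_zero
      ENNReal.ofNat_ne_top).1 (Lp.memLp g).2
  calc ∫⁻ p, ‖(Function.uncurry fun r ρ => (zeroModeGreen α r ρ : ℂ)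
        * (starRingEnd ℂ (f ρ) * g r)) p‖ₑ ∂(halfLineMeasure.prod halfLineMeasure)
      = ∫⁻ p : ℝ × ℝ, ENNReal.ofReal (zeroModeGreen α p.1 p.2) * ‖f p.2‖ₑ * ‖g p.1‖ₑ
        ∂(halfLineMeasure.prod halfLineMeasure) := by
        rw [Measure.prod_restrict]
        refine setLIntegral_congr_fun (measurableSet_Ioi.prod measurableSet_Ioi) fun p hp => ?_
        rw [Function.uncurry, enorm_zeroModeGreen_mul hα0 hα1 hp.1 hp.2, enorm_mul, mul_assoc]
        congr 2
        rw [← ofReal_norm, ← ofReal_norm, RCLike.norm_conj]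
    _ = ∫⁻ r in Ioi 0, ∫⁻ ρ in Ioi 0,
        ENNReal.ofReal (zeroModeGreen α r ρ) * ‖f ρ‖ₑ * ‖g r‖ₑ :=
        lintegral_prod _ (hmeas.mul hg.enorm.comp_fst)
    _ = ∫⁻ r in Ioi 0, (∫⁻ ρ in Ioi 0,
        ENNReal.ofReal (zeroModeGreen α r ρ) * ‖f ρ‖ₑ) * ‖g r‖ₑ := by
        refine lintegral_congr_ae ?_
        filter_upwards with r
        rw [lintegral_mul_const' _ _ enorm_ne_top]
    _ ≤ ∫⁻ r in Ioi 0, ((∫⁻ ρ in Ioi 0,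
        ENNReal.ofReal (zeroModeGreen α r ρ) * ‖f ρ‖ₑ) ^ 2 + ‖g r‖ₑ ^ 2) := by
        refine lintegral_mono fun r => ?_
        generalize (∫⁻ ρ in Ioi 0, ENNReal.ofReal (zeroModeGreen α r ρ) * ‖f ρ‖ₑ) = a
        generalize ‖g r‖ₑ = b
        rcases le_total a b with h | h
        · calc a * b ≤ b * b := by gcongr
            _ ≤ _ := by rw [← sq]; exact le_add_self
        · calc a * b ≤ a * a := by gcongr
            _ ≤ _ := by rw [← sq]; exact le_self_add
    _ = (∫⁻ r in Ioi 0, (∫⁻ ρ in Ioi 0,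
        ENNReal.ofReal (zeroModeGreen α r ρ) * ‖f ρ‖ₑ) ^ 2) + ∫⁻ r in Ioi 0, ‖g r‖ₑ ^ 2 :=
        lintegral_add_left' (hmeas.lintegral_prod_right'.pow_const 2) _
    _ < ⊤ := ENNReal.add_lt_top.2
        ⟨(lintegral_greenIntegral_sq_le hα0 hα1 hf).trans_lt hf2, hg2⟩

theorem inner_greenOperator_left (f g : HalfLineL2) :
    ⟪greenOperator hα0 hα1 f, g⟫_ℂ = ⟪f, greenOperator hα0 hα1 g⟫_ℂ := by
  rw [L2.inner_def, L2.inner_def]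
  have e1 : ∫ r in Ioi 0, ⟪greenOperator hα0 hα1 f r, g r⟫_ℂ = ∫ r in Ioi 0, ∫ ρ in Ioi 0,
      (zeroModeGreen α r ρ : ℂ) * (starRingEnd ℂ (f ρ) * g r) := by
    refine integral_congr_ae ?_
    filter_upwards [coeFn_greenOperator hα0 hα1 f] with r hr
    rw [hr, RCLike.inner_apply, greenIntegral, ← integral_conj, ← integral_const_mul]
    refine integral_congr_ae (Eventually.of_forall fun ρ => ?_)
    simp only [map_mul, Complex.conj_ofReal]
    ring
  have e2 : ∫ ρ in Ioi 0, ⟪f ρ, greenOperator hα0 hα1 g ρ⟫_ℂ = ∫ ρ in Ioi 0, ∫ r in Ioi 0,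
      (zeroModeGreen α r ρ : ℂ) * (starRingEnd ℂ (f ρ) * g r) := by
    refine integral_congr_ae ?_
    filter_upwards [coeFn_greenOperator hα0 hα1 g] with ρ hρ
    rw [hρ, RCLike.inner_apply, greenIntegral, ← integral_mul_const]
    refine integral_congr_ae (Eventually.of_forall fun r => ?_)
    simp only [zeroModeGreen_symm ρ r]
    ring
  rw [e1, e2]
  exact integral_integral_swap (integrable_green_sesq hα0 hα1 f g)

end Green

/-! ### Integrability of `Φ` and `F` -/

section Integrability

set_option linter.unusedSectionVars false

variable {α : ℝ} (hα0 : 0 ≤ α) (hα1 : α < 1)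

theorem Ioc_subset_Ioi_zero {r : ℝ} : Ioc 0 r ⊆ Ioi (0 : ℝ) := fun _ hx => hx.1

include hα0 hα1

theorem aestronglyMeasurable_zeroModePhi :
    AEStronglyMeasurable (zeroModePhi α) halfLineMeasure :=
  (continuousOn_zeroModePhi hα0 hα1).aestronglyMeasurable measurableSet_Ioi

theorem aestronglyMeasurable_zeroModeF :
    AEStronglyMeasurable (zeroModeF α) halfLineMeasure :=
  (continuousOn_zeroModeF hα0 hα1).aestronglyMeasurable measurableSet_Ioi

theorem integrableOn_zeroModePhi_Ioi {r : ℝ} (hr : 0 < r) :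
    IntegrableOn (zeroModePhi α) (Ioi r) := by
  have hsub : Ioi r ⊆ Ioi 0 := Ioi_subset_Ioi hr.le
  refine ⟨(aestronglyMeasurable_zeroModePhi hα0 hα1).mono_measure
    (Measure.restrict_mono hsub le_rfl), ?_⟩
  rw [hasFiniteIntegral_iff_ofReal]
  · exact (lintegral_zeroModePhi_Ioi_le hα0 hα1 hr).trans_lt ENNReal.ofReal_lt_top
  · filter_upwards [ae_restrict_mem measurableSet_Ioi] with x hx
    exact (zeroModePhi_pos hα0 hα1 (hsub hx)).le

theorem exists_zeroModePhi_sq_le :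
    ∃ C > 0, ∀ x ∈ Ioc (0 : ℝ) 1, zeroModePhi α x ^ 2 ≤ C * x ^ (-α) := by
  obtain ⟨C, hC, h⟩ := exists_zeroModePhi_le hα0 hα1
  refine ⟨C ^ 2, by positivity, fun x hx => ?_⟩
  have h0 := zeroModePhi_pos hα0 hα1 hx.1
  calc zeroModePhi α x ^ 2 ≤ (C * x ^ (-(α / 2))) ^ 2 := by gcongr; exact h x hx
    _ = C ^ 2 * x ^ (-α) := by
        rw [mul_pow, ← Real.rpow_natCast (x ^ (-(α / 2))), ← Real.rpow_mul hx.1.le]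
        congr 2
        push_cast
        ring

omit hα0 in
theorem integrableOn_rpow_neg {r : ℝ} (hr : 0 ≤ r) :
    IntegrableOn (fun x : ℝ => x ^ (-α)) (Ioc 0 r) :=
  (intervalIntegrable_iff_integrableOn_Ioc_of_le hr).1
    (intervalIntegral.intervalIntegrable_rpow' (by linarith))

/-- Near 0 the square is at most a multiple of x^{−α}, integrable because α < 1. Beyond 1 it is at
most Φ(1)Φ, and Φ is integrable there. -/
theorem integrable_zeroModePhi_sq :
    Integrable (fun x => zeroModePhi α x ^ 2) halfLineMeasure := by
  have hm := (aestronglyMeasurable_zeroModePhi hα0 hα1).pow 2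
  rw [halfLineMeasure, ← IntegrableOn, ← Ioc_union_Ioi_eq_Ioi zero_le_one, integrableOn_union]
  constructor
  · obtain ⟨C, hC, h⟩ := exists_zeroModePhi_sq_le hα0 hα1
    refine ((integrableOn_rpow_neg hα1 zero_le_one).const_mul C).mono'
      (hm.mono_measure (Measure.restrict_mono Ioc_subset_Ioi_zero le_rfl)) ?_
    filter_upwards [ae_restrict_mem measurableSet_Ioc] with x hx
    rw [Real.norm_of_nonneg (by positivity)]
    exact h x hx
  · refine ((integrableOn_zeroModePhi_Ioi hα0 hα1 one_pos).const_mul (zeroModePhi α 1)).mono'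
      (hm.mono_measure (Measure.restrict_mono (Ioi_subset_Ioi zero_le_one) le_rfl)) ?_
    filter_upwards [ae_restrict_mem measurableSet_Ioi] with x hx
    have hx : 1 < x := hx
    rw [Real.norm_of_nonneg (by positivity), sq]
    exact mul_le_mul_of_nonneg_right (zeroModePhi_anti hα0 hα1 one_pos hx.le)
      (zeroModePhi_pos hα0 hα1 (one_pos.trans hx)).le

theorem memLp_zeroModePhi : MemLp (fun x => (zeroModePhi α x : ℂ)) 2 halfLineMeasure :=
  MemLp.ofReal ((memLp_two_iff_integrable_sq (aestronglyMeasurable_zeroModePhi hα0 hα1)).2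
    (integrable_zeroModePhi_sq hα0 hα1))

theorem memLp_zeroModeF {r : ℝ} :
    MemLp (fun x => (zeroModeF α x : ℂ)) 2 (volume.restrict (Ioc 0 r)) := by
  have hm := (aestronglyMeasurable_zeroModeF hα0 hα1).mono_measure
    (Measure.restrict_mono (Ioc_subset_Ioi_zero (r := r)) le_rfl)
  refine MemLp.ofReal (f := zeroModeF α) (MemLp.of_bound hm (zeroModeF α r) ?_)
  filter_upwards [ae_restrict_mem measurableSet_Ioc] with x hx
  rw [Real.norm_of_nonneg (zeroModeF_pos hα0 hα1 hx.1).le]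
  exact zeroModeF_mono hα0 hα1 hx.1 hx.2

theorem integrable_zeroModePhi_mul {f : ℝ → ℂ} (hf : MemLp f 2 halfLineMeasure) :
    Integrable (fun x => (zeroModePhi α x : ℂ) * f x) halfLineMeasure :=
  (memLp_zeroModePhi hα0 hα1).integrable_mul hf

theorem integrableOn_zeroModeF_mul {f : ℝ → ℂ} (hf : MemLp f 2 halfLineMeasure) {r : ℝ} :
    IntegrableOn (fun x => (zeroModeF α x : ℂ) * f x) (Ioc 0 r) :=
  (memLp_zeroModeF hα0 hα1).integrable_mul
    (hf.mono_measure (Measure.restrict_mono Ioc_subset_Ioi_zero le_rfl))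

theorem intervalIntegrable_zeroModeF_mul {f : ℝ → ℂ} (hf : MemLp f 2 halfLineMeasure) {r : ℝ}
    (hr : 0 < r) : IntervalIntegrable (fun x => (zeroModeF α x : ℂ) * f x) volume 0 r :=
  (intervalIntegrable_iff_integrableOn_Ioc_of_le hr.le).2 (integrableOn_zeroModeF_mul hα0 hα1 hf)

theorem intervalIntegrable_zeroModePhi_mul {f : ℝ → ℂ} (hf : MemLp f 2 halfLineMeasure) {r : ℝ}
    (hr : 0 < r) : IntervalIntegrable (fun x => (zeroModePhi α x : ℂ) * f x) volume 0 r :=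
  (intervalIntegrable_iff_integrableOn_Ioc_of_le hr.le).2
    (IntegrableOn.mono_set (integrable_zeroModePhi_mul hα0 hα1 hf) Ioc_subset_Ioi_zero)

/-- The variation of constants formula with initial data at the origin. -/
noncomputable def volterra (α : ℝ) (f : ℝ → ℂ) (r : ℝ) : ℂ :=
  zeroModePhi α r * (∫ ρ in (0 : ℝ)..r, (zeroModeF α ρ : ℂ) * f ρ)
    - zeroModeF α r * ∫ ρ in (0 : ℝ)..r, (zeroModePhi α ρ : ℂ) * f ρ

theorem greenIntegral_eq_add {f : ℝ → ℂ} (hf : MemLp f 2 halfLineMeasure) {r : ℝ} (hr : 0 < r) :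
    greenIntegral α f r = zeroModePhi α r * (∫ ρ in (0 : ℝ)..r, (zeroModeF α ρ : ℂ) * f ρ)
      + zeroModeF α r * ∫ ρ in Ioi r, (zeroModePhi α ρ : ℂ) * f ρ := by
  have hi := integrable_zeroModeGreen_mul hα0 hα1 hf hr
  rw [greenIntegral, ← Ioc_union_Ioi_eq_Ioi hr.le, setIntegral_union
    (Ioc_disjoint_Ioi le_rfl) measurableSet_Ioi
    (IntegrableOn.mono_set hi Ioc_subset_Ioi_zero)
    (IntegrableOn.mono_set hi (Ioi_subset_Ioi hr.le)), intervalIntegral.integral_of_le hr.le,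
    ← integral_const_mul, ← integral_const_mul]
  congr 1
  · refine setIntegral_congr_fun measurableSet_Ioc fun ρ hρ => ?_
    simp only [zeroModeGreen_eq, max_eq_left hρ.2, min_eq_right hρ.2, Complex.ofReal_mul, mul_assoc]
  · refine setIntegral_congr_fun measurableSet_Ioi fun ρ hρ => ?_
    have hρ : r < ρ := hρ
    simp only [zeroModeGreen_eq, max_eq_right hρ.le, min_eq_left hρ.le, Complex.ofReal_mul]
    ring

/-- Replacing the integral over (r, ∞) by the full integral minus that over (0, r) isolates the
leading behaviour ⟨Φ,f⟩F at the origin, leaving an expression that sees f only on (0, r). -/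
theorem greenIntegral_eq_volterra {f : ℝ → ℂ} (hf : MemLp f 2 halfLineMeasure) {r : ℝ}
    (hr : 0 < r) : greenIntegral α f r
      = volterra α f r + (∫ ρ in Ioi 0, (zeroModePhi α ρ : ℂ) * f ρ) * zeroModeF α r := by
  have hi := integrable_zeroModePhi_mul hα0 hα1 hf
  rw [greenIntegral_eq_add hα0 hα1 hf hr, volterra, ← Ioc_union_Ioi_eq_Ioi hr.le, setIntegral_union
    (Ioc_disjoint_Ioi le_rfl) measurableSet_Ioi
    (IntegrableOn.mono_set hi Ioc_subset_Ioi_zero)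
    (IntegrableOn.mono_set hi (Ioi_subset_Ioi hr.le)), intervalIntegral.integral_of_le hr.le,
    intervalIntegral.integral_of_le hr.le]
  ring

/-! ### The variation of constants formula for continuous data -/

theorem hasDerivAt_integral_of_continuousOn {f : ℝ → ℂ} {g : ℝ → ℝ} (hg : ContinuousOn g (Ioi 0))
    (hf : ContinuousOn f (Ioi 0)) {r : ℝ} (hr : 0 < r)
    (hi : IntervalIntegrable (fun x => (g x : ℂ) * f x) volume 0 r) :
    HasDerivAt (fun r => ∫ ρ in (0 : ℝ)..r, (g ρ : ℂ) * f ρ) (g r * f r) r := by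
  have hc : ContinuousOn (fun x => (g x : ℂ) * f x) (Ioi 0) :=
    (Complex.continuous_ofReal.comp_continuousOn hg).mul hf
  exact intervalIntegral.integral_hasDerivAt_right hi
    (hc.stronglyMeasurableAtFilter isOpen_Ioi r hr) (hc.continuousAt (Ioi_mem_nhds hr))

/-- The derivative of the variation of constants formula. -/
noncomputable def volterraDeriv (α : ℝ) (f : ℝ → ℂ) (r : ℝ) : ℂ :=
  zeroModePhiDeriv α r * (∫ ρ in (0 : ℝ)..r, (zeroModeF α ρ : ℂ) * f ρ)
    - zeroModeFDeriv α r * ∫ ρ in (0 : ℝ)..r, (zeroModePhi α ρ : ℂ) * f ρ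

theorem hasDerivAt_volterra {f : ℝ → ℂ} (hf : MemLp f 2 halfLineMeasure)
    (hc : ContinuousOn f (Ioi 0)) {r : ℝ} (hr : 0 < r) :
    HasDerivAt (volterra α f) (volterraDeriv α f r) r := by
  have h1 := hasDerivAt_integral_of_continuousOn hα0 hα1 (continuousOn_zeroModeF hα0 hα1) hc hr
    (intervalIntegrable_zeroModeF_mul hα0 hα1 hf hr)
  have h2 := hasDerivAt_integral_of_continuousOn hα0 hα1 (continuousOn_zeroModePhi hα0 hα1) hc hr
    (intervalIntegrable_zeroModePhi_mul hα0 hα1 hf hr)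
  convert! ((hasDerivAt_zeroModePhi hα0 hα1 hr).ofReal_comp.mul h1).sub
    ((hasDerivAt_zeroModeF hα0 hα1 hr).ofReal_comp.mul h2) using 1
  rw [volterraDeriv]
  ring

theorem hasDerivAt_volterraDeriv {f : ℝ → ℂ} (hf : MemLp f 2 halfLineMeasure)
    (hc : ContinuousOn f (Ioi 0)) {r : ℝ} (hr : 0 < r) :
    HasDerivAt (volterraDeriv α f)
      ((1 + (couplingConst α / r ^ 2 : ℝ)) * volterra α f r - f r) r := by
  have h1 := hasDerivAt_integral_of_continuousOn hα0 hα1 (continuousOn_zeroModeF hα0 hα1) hc hr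
    (intervalIntegrable_zeroModeF_mul hα0 hα1 hf hr)
  have h2 := hasDerivAt_integral_of_continuousOn hα0 hα1 (continuousOn_zeroModePhi hα0 hα1) hc hr
    (intervalIntegrable_zeroModePhi_mul hα0 hα1 hf hr)
  have hw : (zeroModePhi α r * zeroModeFDeriv α r - zeroModePhiDeriv α r * zeroModeF α r : ℂ)
      = 1 := by exact_mod_cast zeroMode_wronskian hα0 hα1 hr
  convert! ((hasDerivAt_zeroModePhiDeriv hα0 hα1 hr).ofReal_comp.mul h1).sub
    ((hasDerivAt_zeroModeFDeriv hα0 hα1 hr).ofReal_comp.mul h2) using 1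
  rw [volterra]
  push_cast
  linear_combination f r * hw

theorem contDiffOn_integral {f : ℝ → ℂ} {g : ℝ → ℝ} (hg : ContDiffOn ℝ ∞ g (Ioi 0))
    (hf : ContDiffOn ℝ ∞ f (Ioi 0))
    (hi : ∀ r > 0, IntervalIntegrable (fun x => (g x : ℂ) * f x) volume 0 r) :
    ContDiffOn ℝ ∞ (fun r => ∫ ρ in (0 : ℝ)..r, (g ρ : ℂ) * f ρ) (Ioi 0) := by
  have hd := fun r (hr : 0 < r) => hasDerivAt_integral_of_continuousOn hα0 hα1 hg.continuousOn
    hf.continuousOn hr (hi r hr)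
  rw [contDiffOn_infty_iff_deriv_of_isOpen isOpen_Ioi]
  refine ⟨fun r hr => (hd r hr).differentiableAt.differentiableWithinAt, ?_⟩
  refine ContDiffOn.congr (ContDiffOn.mul ?_ hf) fun r hr => (hd r hr).deriv
  exact Complex.ofRealCLM.contDiff.comp_contDiffOn hg

theorem contDiffOn_volterra {f : ℝ → ℂ} (hf : MemLp f 2 halfLineMeasure)
    (hc : ContDiffOn ℝ ∞ f (Ioi 0)) : ContDiffOn ℝ ∞ (volterra α f) (Ioi 0) := by
  have hΦ := contDiffOn_zeroModePhi hα0 hα1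
  have hF := contDiffOn_zeroModeF hα0 hα1
  refine ContDiffOn.sub (ContDiffOn.mul ?_ (contDiffOn_integral hα0 hα1 hF hc fun r hr =>
    intervalIntegrable_zeroModeF_mul hα0 hα1 hf hr)) (ContDiffOn.mul ?_
    (contDiffOn_integral hα0 hα1 hΦ hc fun r hr =>
      intervalIntegrable_zeroModePhi_mul hα0 hα1 hf hr))
  · exact Complex.ofRealCLM.contDiff.comp_contDiffOn hΦ
  · exact Complex.ofRealCLM.contDiff.comp_contDiffOn hF

theorem ofReal_zeroModePsi (r : ℝ) :
    (zeroModePsi α r : ℂ) = greenIntegral α (fun ρ => (zeroModePhi α ρ : ℂ)) r := by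
  rw [zeroModePsi, greenIntegral, ← integral_complex_ofReal]
  simp only [Complex.ofReal_mul]

theorem contDiffOn_zeroModePsi : ContDiffOn ℝ ∞ (zeroModePsi α) (Ioi 0) := by
  have hΦ := contDiffOn_zeroModePhi hα0 hα1
  have hF := contDiffOn_zeroModeF hα0 hα1
  have hm := memLp_zeroModePhi hα0 hα1
  have h : ContDiffOn ℝ ∞ (fun r => (zeroModePsi α r : ℂ)) (Ioi 0) := by
    -- Ψ is the variation of constants formula applied to Φ plus a constant multiple of F, and both
    -- are smooth.
    refine ContDiffOn.congr (ContDiffOn.add (contDiffOn_volterra hα0 hα1 hm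
      (Complex.ofRealCLM.contDiff.comp_contDiffOn hΦ)) ((contDiffOn_const (c := ∫ ρ in Ioi 0,
      (zeroModePhi α ρ : ℂ) * (zeroModePhi α ρ : ℂ))).mul
      (Complex.ofRealCLM.contDiff.comp_contDiffOn hF))) fun r hr => ?_
    rw [ofReal_zeroModePsi hα0 hα1, greenIntegral_eq_volterra hα0 hα1 hm hr]
    rfl
  exact Complex.reCLM.contDiff.comp_contDiffOn h

/-! ### Behaviour of the variation of constants formula at the origin -/

omit hα0 hα1 in
theorem norm_integral_mul_le {g : ℝ → ℝ} {f : ℝ → ℂ} {μ : Measure ℝ}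
    (hg : MemLp (fun x => (g x : ℂ)) 2 μ) (hf : MemLp f 2 μ) :
    ‖∫ x, (g x : ℂ) * f x ∂μ‖ ≤ √(∫ x, g x ^ 2 ∂μ) * √(∫ x, ‖f x‖ ^ 2 ∂μ) := by
  refine (norm_integral_le_integral_norm _).trans ?_
  have h := integral_mul_norm_le_Lp_mul_Lq Real.HolderConjugate.two_two (by simpa using hg)
    (by simpa using hf)
  simpa [norm_mul, Real.sqrt_eq_rpow, Complex.norm_real] using h

theorem exists_integral_zeroModeF_sq_le : ∃ C > 0, ∀ r ∈ Ioc (0 : ℝ) 1,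
    √(∫ x in Ioc 0 r, zeroModeF α x ^ 2) ≤ C * r ^ ((3 + α) / 2) := by
  obtain ⟨C, hC, h⟩ := exists_zeroModeF_le hα0 hα1
  refine ⟨C, hC, fun r hr => ?_⟩
  have hpos : 0 < r ^ ((3 + α) / 2) := Real.rpow_pos_of_pos hr.1 _
  refine Real.sqrt_le_iff.2 ⟨by positivity, ?_⟩
  have hb : ∀ x ∈ Ioc 0 r, zeroModeF α x ^ 2 ≤ (C * r ^ (1 + α / 2)) ^ 2 := by
    intro x hx
    have h0 := zeroModeF_pos hα0 hα1 hx.1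
    gcongr
    refine (h x ⟨hx.1, hx.2.trans hr.2⟩).trans ?_
    exact mul_le_mul_of_nonneg_left (Real.rpow_le_rpow hx.1.le hx.2 (by linarith)) hC.le
  have h2 := norm_setIntegral_le_of_norm_le_const (μ := volume) (s := Ioc 0 r)
    (f := fun x => zeroModeF α x ^ 2) (by simp) (fun x hx => by
      rw [Real.norm_of_nonneg (by positivity)]; exact hb x hx)
  refine (le_abs_self _).trans (h2.trans (le_of_eq ?_))
  rw [Measure.real, Real.volume_Ioc, sub_zero, ENNReal.toReal_ofReal hr.1.le, mul_pow, mul_pow,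
    mul_assoc, ← Real.rpow_natCast (r ^ (1 + α / 2)), ← Real.rpow_mul hr.1.le,
    ← Real.rpow_natCast (r ^ ((3 + α) / 2)), ← Real.rpow_mul hr.1.le, ← Real.rpow_add_one hr.1.ne']
  congr 2
  push_cast
  ring

theorem exists_integral_zeroModePhi_sq_le : ∃ C > 0, ∀ r ∈ Ioc (0 : ℝ) 1,
    √(∫ x in Ioc 0 r, zeroModePhi α x ^ 2) ≤ C * r ^ ((1 - α) / 2) := by
  obtain ⟨C, hC, h⟩ := exists_zeroModePhi_sq_le hα0 hα1
  have h1α : 0 < 1 - α := by linarith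
  refine ⟨√(C / (1 - α)), by positivity, fun r hr => ?_⟩
  have hb : ∫ x in Ioc 0 r, zeroModePhi α x ^ 2 ≤ C / (1 - α) * r ^ (1 - α) := by
    calc ∫ x in Ioc 0 r, zeroModePhi α x ^ 2 ≤ ∫ x in Ioc 0 r, C * x ^ (-α) :=
          setIntegral_mono_on
            (IntegrableOn.mono_set (integrable_zeroModePhi_sq hα0 hα1) Ioc_subset_Ioi_zero)
            ((integrableOn_rpow_neg hα1 hr.1.le).const_mul C) measurableSet_Ioc
            fun x hx => h x ⟨hx.1, hx.2.trans hr.2⟩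
      _ = C / (1 - α) * r ^ (1 - α) := by
          rw [integral_const_mul, ← intervalIntegral.integral_of_le hr.1.le,
            integral_rpow (Or.inl (by linarith)), Real.zero_rpow (by linarith),
            show -α + 1 = 1 - α by ring]
          ring
  refine (Real.sqrt_le_sqrt hb).trans (le_of_eq ?_)
  rw [Real.sqrt_mul (by positivity), Real.sqrt_eq_rpow (r ^ (1 - α)), ← Real.rpow_mul hr.1.le]
  congr 2
  ring

/-- By Cauchy-Schwarz on (0, r) the two terms are bounded by r^{−α/2} r^{(3+α)/2} and r^{1+α/2}
r^{(1−α)/2} times the L² norm of f on (0, r). Both powers equal r^{3/2}, and the gain from O to o is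
the vanishing of that norm as r ↓ 0. -/
theorem volterra_isLittleO {f : ℝ → ℂ} (hf : MemLp f 2 halfLineMeasure) :
    volterra α f =o[𝓝[>] 0] fun x : ℝ => x ^ (3 / 2 : ℝ) := by
  obtain ⟨A, hA, hA'⟩ := exists_zeroModePhi_le hα0 hα1
  obtain ⟨B, hB, hB'⟩ := exists_zeroModeF_le hα0 hα1
  obtain ⟨C, hC, hC'⟩ := exists_integral_zeroModeF_sq_le hα0 hα1
  obtain ⟨D, hD, hD'⟩ := exists_integral_zeroModePhi_sq_le hα0 hα1
  set n : ℝ → ℝ := fun r => √(∫ x in (0 : ℝ)..r, ‖f x‖ ^ 2) with hn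
  have hn0 : Tendsto n (𝓝[>] 0) (𝓝 0) := by
    have hi : IntegrableOn (fun x => ‖f x‖ ^ 2) (uIcc 0 1) volume := by
      rw [uIcc_of_le zero_le_one, integrableOn_Icc_iff_integrableOn_Ioc]
      exact IntegrableOn.mono_set ((memLp_two_iff_integrable_sq_norm hf.1).1 hf)
        Ioc_subset_Ioi_zero
    have hc := intervalIntegral.continuousOn_primitive_interval hi 0 left_mem_uIcc
    have h1 : Tendsto (fun r => ∫ x in (0 : ℝ)..r, ‖f x‖ ^ 2) (𝓝[>] 0) (𝓝 0) := by
      have h2 := hc.tendsto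
      rw [intervalIntegral.integral_same, uIcc_of_le zero_le_one] at h2
      refine h2.mono_left ?_
      rw [← nhdsWithin_Ioo_eq_nhdsGT (zero_lt_one (α := ℝ))]
      exact nhdsWithin_mono _ Ioo_subset_Icc_self
    simpa [n] using h1.sqrt
  refine IsBigO.trans_isLittleO (g := fun x => x ^ (3 / 2 : ℝ) * n x) ?_ ?_
  · refine IsBigO.of_bound (A * C + B * D) ?_
    filter_upwards [Ioc_mem_nhdsGT (zero_lt_one (α := ℝ))] with r hr
    have hfr := hf.mono_measure (Measure.restrict_mono (Ioc_subset_Ioi_zero (r := r)) le_rfl)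
    have k1 := norm_integral_mul_le (memLp_zeroModeF hα0 hα1) hfr
    have k2 := norm_integral_mul_le ((memLp_zeroModePhi hα0 hα1).mono_measure
      (Measure.restrict_mono (Ioc_subset_Ioi_zero (r := r)) le_rfl)) hfr
    rw [← intervalIntegral.integral_of_le hr.1.le] at k1 k2
    have en : √(∫ x in Ioc 0 r, ‖f x‖ ^ 2) = n r := by
      rw [hn, ← intervalIntegral.integral_of_le hr.1.le]
    rw [en] at k1 k2
    have hn1 : 0 ≤ n r := Real.sqrt_nonneg _
    have pF := zeroModeF_pos hα0 hα1 hr.1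
    have pΦ := zeroModePhi_pos hα0 hα1 hr.1
    have p3 : 0 < r ^ (3 / 2 : ℝ) := Real.rpow_pos_of_pos hr.1 _
    have pa : 0 ≤ r ^ (-(α / 2)) := (Real.rpow_pos_of_pos hr.1 _).le
    have pb : 0 ≤ r ^ (1 + α / 2) := (Real.rpow_pos_of_pos hr.1 _).le
    have e1 : r ^ (-(α / 2)) * r ^ ((3 + α) / 2) = r ^ (3 / 2 : ℝ) := by
      rw [← Real.rpow_add hr.1]; congr 1; ring
    have e2 : r ^ (1 + α / 2) * r ^ ((1 - α) / 2) = r ^ (3 / 2 : ℝ) := by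
      rw [← Real.rpow_add hr.1]; congr 1; ring
    rw [volterra, Real.norm_of_nonneg (by positivity)]
    refine (norm_sub_le _ _).trans ?_
    rw [norm_mul, norm_mul, Complex.norm_real, Complex.norm_real, Real.norm_of_nonneg pF.le,
      Real.norm_of_nonneg pΦ.le]
    calc _ ≤ (A * r ^ (-(α / 2))) * ((C * r ^ ((3 + α) / 2)) * n r)
          + (B * r ^ (1 + α / 2)) * ((D * r ^ ((1 - α) / 2)) * n r) := by
          refine add_le_add (mul_le_mul (hA' r hr) (k1.trans ?_) (norm_nonneg _) (by positivity))
            (mul_le_mul (hB' r hr) (k2.trans ?_) (norm_nonneg _) (by positivity))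
          · exact mul_le_mul_of_nonneg_right (hC' r hr) hn1
          · exact mul_le_mul_of_nonneg_right (hD' r hr) hn1
      _ = _ := by linear_combination (A * C * n r) * e1 + (B * D * n r) * e2
  · have h := (isBigO_refl (fun x : ℝ => x ^ (3 / 2 : ℝ)) (𝓝[>] 0)).mul_isLittleO
      ((isLittleO_one_iff ℝ).2 hn0)
    simpa using h

end Integrability

/-! ### Extensions of a symmetric operator with defect indices `(1, 1)` -/

section Extensions

set_option linter.unusedSectionVars false

variable {H : Type*} [NormedAddCommGroup H] [InnerProductSpace ℂ H] [CompleteSpace H]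

/-- `R` is a bounded symmetric left inverse of `T + 1`, and the orthogonal complement of the range
of `T + 1` is spanned by `e ≠ 0`. -/
structure IsGreenOperator (T : H →ₗ.[ℂ] H) (R : H →L[ℂ] H) (e : H) : Prop where
  dense : Dense (T.domain : Set H)
  symm : ∀ f g, ⟪R f, g⟫_ℂ = ⟪f, R g⟫_ℂ
  left_inv : ∀ x : T.domain, R (T x + x) = x
  ne_zero : e ≠ 0
  inner_eq_zero : ∀ x : T.domain, ⟪e, T x + x⟫_ℂ = 0
  exists_smul : ∀ w, (∀ x : T.domain, ⟪w, T x + x⟫_ℂ = 0) → ∃ c : ℂ, w = c • e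

/-- The elements `R f + a e` with `⟪e, f⟫ = β a`. -/
def boundaryLine (R : H →L[ℂ] H) (e : H) (β : ℝ) : Submodule ℂ H where
  carrier := {g | ∃ (f : H) (a : ℂ), g = R f + a • e ∧ ⟪e, f⟫_ℂ = β * a}
  zero_mem' := ⟨0, 0, by simp, by simp⟩
  add_mem' := by
    rintro _ _ ⟨f, a, rfl, hf⟩ ⟨f', a', rfl, hf'⟩
    refine ⟨f + f', a + a', ?_, ?_⟩
    · rw [map_add, add_smul]; abel
    · rw [inner_add_right, hf, hf', mul_add]
  smul_mem' := by
    rintro c _ ⟨f, a, rfl, hf⟩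
    refine ⟨c • f, c * a, ?_, ?_⟩
    · rw [map_smul, smul_add, mul_smul]
    · rw [inner_smul_right, hf]; ring

namespace IsGreenOperator

variable {T : H →ₗ.[ℂ] H} {R : H →L[ℂ] H} {e : H} (h : IsGreenOperator T R e)
include h

theorem inner_add_eq (f : H) (a : ℂ) (x : T.domain) :
    ⟪f - (R f + a • e), (x : H)⟫_ℂ = ⟪R f + a • e, T x⟫_ℂ := by
  have h1 := h.symm f (T x + x)
  have h2 := h.inner_eq_zero x
  rw [h.left_inv] at h1
  rw [inner_add_right] at h1 h2
  rw [inner_sub_left, inner_add_left, inner_add_left, inner_smul_left, inner_smul_left]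
  linear_combination (-1 : ℂ) * h1 - (starRingEnd ℂ) a * h2

theorem mem_adjoint_domain (f : H) (a : ℂ) : R f + a • e ∈ T†.domain :=
  LinearPMap.mem_adjoint_domain_of_exists _ ⟨_, h.inner_add_eq f a⟩

theorem adjoint_apply {g : T†.domain} {f : H} {a : ℂ} (hg : (g : H) = R f + a • e) :
    T† g = f - g := by
  refine LinearPMap.adjoint_apply_eq h.dense g fun x => ?_
  rw [hg]
  exact h.inner_add_eq f a x

/-- Symmetry of R and its left inverse property show that g − R(T†g + g) is orthogonal to the range
of T+1, hence a multiple of e. -/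
theorem exists_eq (g : T†.domain) : ∃ a : ℂ, (g : H) = R (T† g + g) + a • e := by
  obtain ⟨a, ha⟩ := h.exists_smul (g - R (T† g + g)) fun x => by
    have h1 := LinearPMap.adjoint_isFormalAdjoint h.dense g x
    rw [inner_sub_left, h.symm, h.left_inv, inner_add_left, h1, inner_add_right, sub_self]
  exact ⟨a, by rw [← ha]; abel⟩

theorem mem_adjoint_domain_iff {g : H} :
    g ∈ T†.domain ↔ ∃ (f : H) (a : ℂ), g = R f + a • e := by
  constructor
  · intro hg
    obtain ⟨a, ha⟩ := h.exists_eq ⟨g, hg⟩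
    exact ⟨_, a, ha⟩
  · rintro ⟨f, a, rfl⟩
    exact h.mem_adjoint_domain f a

/-- T†+1 recovers f from Rf + ae, and then a is determined because e ≠ 0. This uniqueness makes (f,
a) coordinates on the domain of the adjoint. -/
theorem eq_and_eq {f f' : H} {a a' : ℂ} (heq : R f + a • e = R f' + a' • e) :
    f = f' ∧ a = a' := by
  have h1 := h.adjoint_apply (g := ⟨_, h.mem_adjoint_domain f a⟩) rfl
  have h2 := h.adjoint_apply (g := ⟨_, h.mem_adjoint_domain f a⟩) (f := f') (a := a') heq
  have h3 : f = f' := sub_left_injective (h1.symm.trans h2)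
  subst h3
  exact ⟨rfl, smul_left_injective ℂ h.ne_zero (add_left_cancel heq)⟩

theorem le_adjoint : T ≤ T† := by
  refine LinearPMap.IsFormalAdjoint.le_adjoint h.dense fun x y => ?_
  have h1 := h.symm (T x + x) (T y + y)
  rw [h.left_inv, h.left_inv, inner_add_left, inner_add_right] at h1
  exact (add_right_cancel h1).symm

theorem isClosable : T.IsClosable :=
  (LinearPMap.adjoint_isClosed h.dense).isClosable.leIsClosable h.le_adjoint

/-- The double orthogonal complement of the range is its closure, and the orthogonal complement is
the line of e. -/
theorem mem_closure_range_add {f : H} (hf : ⟪e, f⟫_ℂ = 0) :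
    f ∈ _root_.closure ((LinearMap.range (T.toFun + T.domain.subtype) : Submodule ℂ H) : Set H) := by
  rw [← Submodule.topologicalClosure_coe, ← Submodule.orthogonal_orthogonal_eq_closure]
  refine (Submodule.mem_orthogonal _ _).2 fun w hw => ?_
  obtain ⟨c, rfl⟩ := h.exists_smul w fun x => by
    rw [← inner_conj_symm, show ⟪T x + x, w⟫_ℂ = 0 from
      (Submodule.mem_orthogonal _ _).1 hw _ ⟨x, rfl⟩, map_zero]
  rw [inner_smul_left, hf, mul_zero]

theorem exists_norm_sub_lt {f : H} (hf : ⟪e, f⟫_ℂ = 0) {ε : ℝ} (hε : 0 < ε) :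
    ∃ x : T.domain, ‖T x + x - f‖ < ε := by
  obtain ⟨_, ⟨x, rfl⟩, hx⟩ := Metric.mem_closure_iff.1 (h.mem_closure_range_add hf) ε hε
  refine ⟨x, ?_⟩
  rwa [dist_comm, dist_eq_norm] at hx

/-- On the graph of T one has R(y+x) = x and y+x ⊥ e; both conditions are closed, so they pass to
the closure. Conversely the continuous map f ↦ (Rf, f − Rf) sends the range of T+1 into the graph,
and that range is dense in the complement of e. -/
theorem mem_closure_domain_iff {g : H} :
    g ∈ T.closure.domain ↔ ∃ f, ⟪e, f⟫_ℂ = 0 ∧ g = R f := by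
  rw [LinearPMap.mem_domain_iff]
  simp only [← h.isClosable.graph_closure_eq_closure_graph]
  constructor
  · rintro ⟨y, hy⟩
    have hcl : IsClosed {p : H × H | R (p.2 + p.1) = p.1 ∧ ⟪e, p.2 + p.1⟫_ℂ = 0} := by
      refine (isClosed_eq ?_ ?_).inter (isClosed_eq ?_ ?_) <;> fun_prop
    have hsub : (T.graph : Set (H × H)) ⊆ {p | R (p.2 + p.1) = p.1 ∧ ⟪e, p.2 + p.1⟫_ℂ = 0} := by
      rintro ⟨x, y⟩ hxy
      obtain ⟨z, rfl, rfl⟩ := T.mem_graph_iff.1 hxy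
      exact ⟨h.left_inv z, h.inner_eq_zero z⟩
    have := closure_minimal hsub hcl hy
    exact ⟨y + g, this.2, this.1.symm⟩
  · rintro ⟨f, hf, rfl⟩
    refine ⟨f - R f, ?_⟩
    refine map_mem_closure (f := fun f : H => (R f, f - R f)) (by fun_prop)
      (h.mem_closure_range_add hf) ?_
    rintro _ ⟨x, rfl⟩
    refine T.mem_graph_iff.2 ⟨x, ?_⟩
    have := h.left_inv x
    simp only [LinearMap.add_apply, LinearPMap.toFun_eq_coe, Submodule.subtype_apply, this]
    exact ⟨trivial, by abel⟩

theorem inner_self_ne_zero : ⟪e, e⟫_ℂ ≠ 0 := _root_.inner_self_ne_zero.2 h.ne_zero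

theorem range_eq {f₀ : H} (hf₀ : ⟪e, f₀⟫_ℂ ≠ 0) :
    LinearMap.range (R : H →ₗ[ℂ] H) = T.closure.domain ⊔ Submodule.span ℂ {R f₀} := by
  ext g
  simp only [LinearMap.mem_range, ContinuousLinearMap.coe_coe, Submodule.mem_sup,
    Submodule.mem_span_singleton, h.mem_closure_domain_iff]
  constructor
  · rintro ⟨f, rfl⟩
    refine ⟨R (f - (⟪e, f⟫_ℂ / ⟪e, f₀⟫_ℂ) • f₀), ⟨_, ?_, rfl⟩, _, ⟨⟪e, f⟫_ℂ / ⟪e, f₀⟫_ℂ, rfl⟩, ?_⟩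
    · rw [inner_sub_right, inner_smul_right, div_mul_cancel₀ _ hf₀, sub_self]
    · rw [map_sub, map_smul, sub_add_cancel]
  · rintro ⟨_, ⟨f, -, rfl⟩, _, ⟨c, rfl⟩, rfl⟩
    exact ⟨f + c • f₀, by rw [map_add, map_smul]⟩

theorem adjoint_domain_eq : T†.domain =
    T.closure.domain ⊔ Submodule.span ℂ {R e} ⊔ Submodule.span ℂ {e} := by
  rw [← h.range_eq h.inner_self_ne_zero]
  ext g
  simp only [h.mem_adjoint_domain_iff, Submodule.mem_sup, LinearMap.mem_range,
    ContinuousLinearMap.coe_coe, Submodule.mem_span_singleton]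
  constructor
  · rintro ⟨f, a, rfl⟩
    exact ⟨_, ⟨f, rfl⟩, _, ⟨a, rfl⟩, rfl⟩
  · rintro ⟨_, ⟨f, rfl⟩, _, ⟨a, rfl⟩, rfl⟩
    exact ⟨f, a, rfl⟩

theorem iSupIndep_domains : iSupIndep ![T.closure.domain, Submodule.span ℂ {R e},
    Submodule.span ℂ {e}] := by
  rw [iSupIndep_iff_finsetSum_eq_zero_imp_eq_zero]
  intro s v hv hsum i hi
  -- Extending the family by zero off `s` gives a relation among all three summands. Uniqueness of
  -- coordinates makes the total f-part and the e-part vanish, and pairing the f-part with e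
  -- separates its two pieces.
  set w : Fin 3 → H := fun i => if i ∈ s then v i else 0 with hw
  have hwm : ∀ i, w i ∈ (![T.closure.domain, Submodule.span ℂ {R e},
      Submodule.span ℂ {e}] : Fin 3 → Submodule ℂ H) i := by
    intro i
    by_cases his : i ∈ s
    · simpa [hw, his] using hv i his
    · simp [hw, his]
  have hws : ∑ i, w i = 0 := by rw [← hsum]; simp [hw]
  have hwi : w i = v i := by simp [hw, hi]
  rw [← hwi]
  rw [Fin.sum_univ_three] at hws
  obtain ⟨f, hf, h0⟩ := h.mem_closure_domain_iff.1 (hwm 0)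
  obtain ⟨c, h1⟩ := Submodule.mem_span_singleton.1 (hwm 1)
  obtain ⟨a, h2⟩ := Submodule.mem_span_singleton.1 (hwm 2)
  rw [h0, ← h1, ← h2] at hws
  obtain ⟨k1, rfl⟩ := h.eq_and_eq (f := f + c • e) (f' := 0) (a := a) (a' := 0)
    (by rw [map_add, map_smul, hws]; simp)
  have k2 : ⟪e, f + c • e⟫_ℂ = 0 := by rw [k1, inner_zero_right]
  rw [inner_add_right, hf, zero_add, inner_smul_right, mul_eq_zero,
    or_iff_left h.inner_self_ne_zero] at k2
  subst k2
  rw [zero_smul, add_zero] at k1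
  subst k1
  fin_cases i
  · simpa using h0
  · simpa using h1.symm
  · simpa using h2.symm

theorem operatorKer_adjoint : operatorKer (shiftByOne T†) = Submodule.span ℂ {e} := by
  ext g
  simp only [operatorKer, Submodule.mem_map, LinearMap.mem_ker, Submodule.mem_span_singleton]
  constructor
  · rintro ⟨x, hx, rfl⟩
    obtain ⟨a, ha⟩ := h.exists_eq x
    have hx' : T† x + x = 0 := by rw [add_comm]; exact hx
    rw [hx', map_zero, zero_add] at ha
    exact ⟨a, ha.symm⟩
  · rintro ⟨a, rfl⟩
    have hm : a • e ∈ T†.domain := by simpa using h.mem_adjoint_domain 0 a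
    refine ⟨⟨a • e, hm⟩, ?_, rfl⟩
    have := h.adjoint_apply (g := ⟨a • e, hm⟩) (f := 0) (a := a) (by simp)
    change (a • e) + T† ⟨a • e, hm⟩ = 0
    rw [this]
    simp

/-! #### The Friedrichs extension -/

/-- The images T(s n) of a form-Cauchy sequence need not converge, so positivity cannot be passed to
the limit directly. Polarisation bounds 2 Re⟨T(s n), s m⟩ below by −form(s n − s m); m is sent to
infinity first, then T is moved to the other side as T†, and then n is sent to infinity. -/
theorem adjoint_form_nonneg (hT : IsNonnegOperator T) (g : T†.domain)
    (hg : (g : H) ∈ closedFormDomain T hT) : 0 ≤ (⟪(g : H), T† g⟫_ℂ).re := by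
  obtain ⟨s, hs, hs'⟩ := hg
  have hsymm : ∀ x y : T.domain, ⟪T x, (y : H)⟫_ℂ = ⟪(x : H), T y⟫_ℂ := fun x y => by
    have h1 := h.symm (T x + x) (T y + y)
    rw [h.left_inv, h.left_inv, inner_add_left, inner_add_right] at h1
    exact (add_right_cancel h1).symm
  have hpol : ∀ x y : T.domain, -operatorForm T (x - y) ≤ 2 * (⟪T x, (y : H)⟫_ℂ).re := by
    intro x y
    have h1 := hT x
    have h2 := hT y
    have h3 : operatorForm T (x - y) = operatorForm T x + operatorForm T y
        - 2 * (⟪T x, (y : H)⟫_ℂ).re := by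
      have h4 : (⟪(y : H), T x⟫_ℂ).re = (⟪T x, (y : H)⟫_ℂ).re := by
        rw [← inner_conj_symm, Complex.conj_re]
      simp only [operatorForm, LinearPMap.map_sub, Submodule.coe_sub, inner_sub_left,
        inner_sub_right, Complex.sub_re, h4, ← hsymm x y]
      ring
    linarith
  refine le_of_forall_pos_le_add fun ε hε => ?_
  have hev : ∀ᶠ p : ℕ × ℕ in atTop, operatorForm T (s p.1 - s p.2) < ε :=
    hs'.eventually_lt_const hε
  rw [← prod_atTop_atTop_eq] at hev
  have hev' := hev.curry
  have h5 : ∀ᶠ n in atTop, -ε / 2 ≤ (⟪T (s n), (g : H)⟫_ℂ).re := by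
    filter_upwards [hev'] with n hn
    have hlim : Tendsto (fun m => (⟪T (s n), (s m : H)⟫_ℂ).re) atTop
        (𝓝 (⟪T (s n), (g : H)⟫_ℂ).re) :=
      (Complex.continuous_re.tendsto _).comp (tendsto_const_nhds.inner hs)
    refine ge_of_tendsto hlim ?_
    filter_upwards [hn] with m hm
    have := hpol (s n) (s m)
    linarith
  have hlim : Tendsto (fun n => (⟪T (s n), (g : H)⟫_ℂ).re) atTop (𝓝 (⟪(g : H), T† g⟫_ℂ).re) := by
    have e1 : ∀ n, ⟪T (s n), (g : H)⟫_ℂ = ⟪(s n : H), T† g⟫_ℂ := fun n =>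
      (LinearPMap.adjoint_isFormalAdjoint h.dense).symm (s n) g
    simp only [e1]
    exact (Complex.continuous_re.tendsto _).comp (hs.inner tendsto_const_nhds)
  have := ge_of_tendsto hlim h5
  linarith

/-- Convergence in the graph norm controls the form, because the form is the pairing of a vector
with its image. -/
theorem closure_domain_le_closedFormDomain (hT : IsNonnegOperator T) :
    T.closure.domain ≤ closedFormDomain T hT := by
  intro g hg
  rw [LinearPMap.mem_domain_iff] at hg
  simp only [← h.isClosable.graph_closure_eq_closure_graph] at hg
  obtain ⟨y, hy⟩ := hg
  obtain ⟨p, hp, hlim⟩ := mem_closure_iff_seq_limit.1 hy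
  choose s hs1 hs2 using fun n => T.mem_graph_iff.1 (hp n)
  have l1 : Tendsto (fun n => (s n : H)) atTop (𝓝 g) := by
    simpa only [hs1, Function.comp_def] using (continuous_fst.tendsto _).comp hlim
  have l2 : Tendsto (fun n => T (s n)) atTop (𝓝 y) := by
    simpa only [hs2, Function.comp_def] using (continuous_snd.tendsto _).comp hlim
  refine ⟨s, l1, ?_⟩
  have d : ∀ {u : ℕ → H} {a : H}, Tendsto u atTop (𝓝 a) →
      Tendsto (fun p : ℕ × ℕ => u p.1 - u p.2) atTop (𝓝 0) := fun {u a} hu => by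
    rw [← sub_self a, ← prod_atTop_atTop_eq]
    exact (hu.comp tendsto_fst).sub (hu.comp tendsto_snd)
  have := (Complex.continuous_re.tendsto _).comp ((d l1).inner (𝕜 := ℂ) (d l2))
  rw [inner_zero_left, Complex.zero_re] at this
  refine this.congr fun p => ?_
  simp only [operatorForm, Function.comp_def, LinearPMap.map_sub, Submodule.coe_sub]

theorem friedrichs_apply (hT : IsNonnegOperator T) (x : (friedrichsExtension T hT).domain) (f : H)
    (hx : (x : H) = R f) :
    friedrichsExtension T hT x = f - x := by
  have hm : (x : H) ∈ T†.domain := x.2.2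
  have h1 : friedrichsExtension T hT x = T† ⟨x, hm⟩ := LinearPMap.domRestrict_apply rfl
  rw [h1, h.adjoint_apply (g := ⟨x, hm⟩) (f := f) (a := 0) (by simpa using hx)]

/-! #### Self-adjoint extensions -/

/-- The boundary form in the coordinates (f, a). The contributions ⟨f, Rf'⟩ cancel by symmetry of R,
so only a and ⟨e, f⟩ survive and the extension problem becomes two-dimensional. -/
theorem inner_adjoint_sub (g g' : T†.domain) {f f' : H} {a a' : ℂ} (hg : (g : H) = R f + a • e)
    (hg' : (g' : H) = R f' + a' • e) : ⟪T† g, (g' : H)⟫_ℂ - ⟪(g : H), T† g'⟫_ℂ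
      = a' * starRingEnd ℂ ⟪e, f⟫_ℂ - starRingEnd ℂ a * ⟪e, f'⟫_ℂ := by
  rw [h.adjoint_apply hg, h.adjoint_apply hg', inner_sub_left, inner_sub_right, sub_sub_sub_cancel_right,
    hg, hg', inner_add_right, inner_add_left, inner_smul_left, inner_smul_right, h.symm,
    inner_conj_symm]
  ring

/-- The self-adjoint extensions are the restrictions of T† to subspaces that coincide with their own
annihilator under the boundary form. -/
theorem isSelfAdjoint_iff {B : H →ₗ.[ℂ] H} (hTB : T ≤ B) : IsSelfAdjoint B ↔ B ≤ T† ∧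
    ∀ y : T†.domain, (y : H) ∈ B.domain ↔
      ∀ g : T†.domain, (g : H) ∈ B.domain → ⟪T† g, (y : H)⟫_ℂ - ⟪(g : H), T† y⟫_ℂ = 0 := by
  have hB : Dense (B.domain : Set H) := h.dense.mono hTB.1
  rw [LinearPMap.isSelfAdjoint_def]
  constructor
  · intro hsa
    have hfa : B.IsFormalAdjoint B := by
      have := LinearPMap.adjoint_isFormalAdjoint hB
      rwa [hsa] at this
    have hle : B ≤ T† := LinearPMap.IsFormalAdjoint.le_adjoint h.dense fun x y => by
      obtain ⟨z, hz1, hz2⟩ := LinearPMap.exists_of_le hTB x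
      rw [hz2, hz1]
      exact hfa z y
    refine ⟨hle, fun y => ⟨fun hy g hg => ?_, fun hy => ?_⟩⟩
    · rw [sub_eq_zero, ← hle.2 (x := ⟨g, hg⟩) (y := g) rfl, ← hle.2 (x := ⟨y, hy⟩) (y := y) rfl]
      exact hfa ⟨g, hg⟩ ⟨y, hy⟩
    · rw [← hsa]
      refine LinearPMap.mem_adjoint_domain_of_exists _ ⟨T† y, fun x => ?_⟩
      have h1 := hy ⟨x, hle.1 x.2⟩ x.2
      rw [sub_eq_zero, ← hle.2 (x := x) (y := ⟨x, hle.1 x.2⟩) rfl] at h1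
      rw [← inner_conj_symm, ← h1, inner_conj_symm]
  · rintro ⟨hle, hiff⟩
    symm
    refine LinearPMap.eq_of_le_of_domain_eq (LinearPMap.IsFormalAdjoint.le_adjoint hB ?_) ?_
    · intro x y
      have h1 := (hiff ⟨y, hle.1 y.2⟩).1 y.2 ⟨x, hle.1 x.2⟩ x.2
      rwa [sub_eq_zero, ← hle.2 (x := x) (y := ⟨x, hle.1 x.2⟩) rfl,
        ← hle.2 (x := y) (y := ⟨y, hle.1 y.2⟩) rfl] at h1
    · refine le_antisymm (fun y hy => ?_) fun y hy => ?_
      · refine LinearPMap.mem_adjoint_domain_of_exists _ ⟨B ⟨y, hy⟩, fun x => ?_⟩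
        have h1 := (hiff ⟨x, hle.1 x.2⟩).1 x.2 ⟨y, hle.1 hy⟩ hy
        rwa [sub_eq_zero, ← hle.2 (x := x) (y := ⟨x, hle.1 x.2⟩) rfl,
          ← hle.2 (x := ⟨y, hy⟩) (y := ⟨y, hle.1 hy⟩) rfl] at h1
      · have hfa := LinearPMap.adjoint_isFormalAdjoint hB ⟨y, hy⟩
        have hx : ∀ x : T.domain, ⟪B† ⟨y, hy⟩, (x : H)⟫_ℂ = ⟪y, T x⟫_ℂ := fun x => by
          obtain ⟨z, hz1, hz2⟩ := LinearPMap.exists_of_le hTB x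
          rw [hz2, hz1]
          exact hfa z
        have hyT : y ∈ T†.domain := LinearPMap.mem_adjoint_domain_of_exists _ ⟨_, hx⟩
        have hval : T† ⟨y, hyT⟩ = B† ⟨y, hy⟩ := LinearPMap.adjoint_apply_eq h.dense _ hx
        refine (hiff ⟨y, hyT⟩).2 fun g hg => ?_
        rw [sub_eq_zero, hval, ← hle.2 (x := ⟨g, hg⟩) (y := g) rfl, ← inner_conj_symm]
        have := hfa ⟨g, hg⟩
        simp only at this
        rw [← this, inner_conj_symm]

theorem le_domRestrict {S : Submodule ℂ H} (hS : ∀ f, ⟪e, f⟫_ℂ = 0 → R f ∈ S) :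
    T ≤ T†.domRestrict S := by
  have hm : T.domain ≤ (T†.domRestrict S).domain := fun x hx => by
    refine ⟨?_, h.le_adjoint.1 hx⟩
    have := hS _ (h.inner_eq_zero ⟨x, hx⟩)
    rwa [h.left_inv] at this
  refine ⟨hm, fun x y hxy => ?_⟩
  exact (h.le_adjoint.2 hxy).trans
    (LinearPMap.domRestrict_apply (x := y) (y := ⟨y, y.2.2⟩) rfl).symm

theorem isSelfAdjoint_domRestrict_range :
    IsSelfAdjoint (T†.domRestrict (LinearMap.range (R : H →ₗ[ℂ] H))) := by
  refine (h.isSelfAdjoint_iff (h.le_domRestrict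
    (S := LinearMap.range (R : H →ₗ[ℂ] H)) fun f _ => ⟨f, rfl⟩)).2
    ⟨LinearPMap.domRestrict_le, fun y => ⟨?_, fun hy => ?_⟩⟩
  · rintro ⟨⟨f', hf'⟩, -⟩ g ⟨⟨f, hf⟩, -⟩
    rw [h.inner_adjoint_sub g y (f := f) (a := 0) (f' := f') (a' := 0) (by simpa using hf.symm)
      (by simpa using hf'.symm)]
    simp
  · obtain ⟨f', a', hfa⟩ := h.mem_adjoint_domain_iff.1 y.2
    -- Testing against R e suffices: its boundary form with y is a' times ⟨e, e⟩, so a' = 0.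
    have hm : R e ∈ T†.domain := by simpa using h.mem_adjoint_domain e 0
    have h1 := hy ⟨R e, hm⟩ ⟨⟨e, rfl⟩, hm⟩
    rw [h.inner_adjoint_sub ⟨R e, hm⟩ y (f := e) (a := 0) (by simp) hfa, map_zero, zero_mul,
      sub_zero, mul_eq_zero, map_eq_zero, or_iff_left h.inner_self_ne_zero] at h1
    rw [h1, zero_smul, add_zero] at hfa
    exact ⟨⟨f', hfa.symm⟩, y.2⟩

theorem isSelfAdjoint_domRestrict_boundaryLine (β : ℝ) :
    IsSelfAdjoint (T†.domRestrict (boundaryLine R e β)) := by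
  refine (h.isSelfAdjoint_iff (h.le_domRestrict
    (S := boundaryLine R e β) fun f hf => ⟨f, 0, by simp, by simp [hf]⟩)).2
    ⟨LinearPMap.domRestrict_le, fun y => ⟨?_, fun hy => ?_⟩⟩
  · rintro ⟨⟨f', a', hfa', hb'⟩, -⟩ g ⟨⟨f, a, hfa, hb⟩, -⟩
    rw [h.inner_adjoint_sub g y hfa hfa', hb, hb', map_mul, Complex.conj_ofReal]
    ring
  · obtain ⟨f', a', hfa⟩ := h.mem_adjoint_domain_iff.1 y.2
    -- The normalisation makes ⟨e, f⟩ = β, so that Rf + e is an element of the line with a = 1 and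
    -- can serve as test vector.
    set f : H := ((β : ℂ) / ⟪e, e⟫_ℂ) • e with hf
    have hb : ⟪e, f⟫_ℂ = β := by
      rw [hf, inner_smul_right, div_mul_cancel₀ _ h.inner_self_ne_zero]
    have hm := h.mem_adjoint_domain f 1
    have h1 := hy ⟨_, hm⟩ ⟨⟨f, 1, rfl, by rw [hb, mul_one]⟩, hm⟩
    rw [h.inner_adjoint_sub ⟨_, hm⟩ y (f := f) (a := 1) rfl hfa, hb, Complex.conj_ofReal, map_one,
      one_mul, sub_eq_zero] at h1
    exact ⟨⟨f', a', hfa, by rw [← h1, mul_comm]⟩, y.2⟩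

theorem eq_domRestrict {B : H →ₗ.[ℂ] H} (hB : B ≤ T†) {S : Submodule ℂ H}
    (hS : ∀ y : T†.domain, (y : H) ∈ B.domain ↔ (y : H) ∈ S) : B = T†.domRestrict S := by
  refine LinearPMap.dExt ?_ fun x y hxy => ?_
  · ext y
    exact ⟨fun hy => ⟨(hS ⟨y, hB.1 hy⟩).1 hy, hB.1 hy⟩, fun hy => (hS ⟨y, hy.2⟩).2 hy.1⟩
  · exact (hB.2 hxy).trans (LinearPMap.domRestrict_apply (x := y) (y := ⟨y, y.2.2⟩) rfl).symm

/-- If some element has a ≠ 0, its boundary form with itself vanishes, which says that β = ⟨e,f⟩/a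
is real; pairing with it forces the same ratio on every other element of the domain. Maximality then
gives equality. If a = 0 throughout, the domain is the range of R. -/
theorem eq_of_isSelfAdjoint {B : H →ₗ.[ℂ] H} (hTB : T ≤ B) (hsa : IsSelfAdjoint B) :
    B = T†.domRestrict (LinearMap.range (R : H →ₗ[ℂ] H)) ∨
      ∃ β : ℝ, B = T†.domRestrict (boundaryLine R e β) := by
  obtain ⟨hle, hiff⟩ := (h.isSelfAdjoint_iff hTB).1 hsa
  by_cases hex : ∃ (g : T†.domain) (f : H) (a : ℂ), (g : H) ∈ B.domain ∧ (g : H) = R f + a • e ∧ a ≠ 0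
  · right
    obtain ⟨g, f, a, hg, hfa, ha⟩ := hex
    have ha' : starRingEnd ℂ a ≠ 0 := (map_ne_zero _).2 ha
    have hself := (hiff g).1 hg g hg
    rw [h.inner_adjoint_sub g g hfa hfa, sub_eq_zero] at hself
    obtain ⟨β, hβ⟩ : ∃ β : ℝ, ⟪e, f⟫_ℂ = β * a := by
      obtain ⟨β, hβ⟩ := Complex.conj_eq_iff_real.1 (show starRingEnd ℂ (⟪e, f⟫_ℂ / a) = ⟪e, f⟫_ℂ / a by
        rw [map_div₀, div_eq_div_iff ha' ha, mul_comm, hself, mul_comm])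
      exact ⟨β, by rw [← hβ, div_mul_cancel₀ _ ha]⟩
    have hsub : ∀ (y : T†.domain) (f' : H) (a' : ℂ), (y : H) ∈ B.domain → (y : H) = R f' + a' • e →
        ⟪e, f'⟫_ℂ = β * a' := by
      intro y f' a' hy hfa'
      have h1 := (hiff y).1 hy g hg
      rw [h.inner_adjoint_sub g y hfa hfa', hβ, map_mul, Complex.conj_ofReal] at h1
      refine mul_left_cancel₀ ha' ?_
      linear_combination -h1
    refine ⟨β, h.eq_domRestrict hle fun y => ⟨fun hy => ?_, ?_⟩⟩
    · obtain ⟨f', a', hfa'⟩ := h.mem_adjoint_domain_iff.1 y.2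
      exact ⟨f', a', hfa', hsub y f' a' hy hfa'⟩
    · rintro ⟨f', a', hfa', hb'⟩
      refine (hiff y).2 fun g' hg' => ?_
      obtain ⟨f₁, a₁, hfa₁⟩ := h.mem_adjoint_domain_iff.1 g'.2
      rw [h.inner_adjoint_sub g' y hfa₁ hfa', hb', hsub g' f₁ a₁ hg' hfa₁, map_mul,
        Complex.conj_ofReal]
      ring
  · left
    push Not at hex
    refine h.eq_domRestrict hle fun y => ⟨fun hy => ?_, ?_⟩
    · obtain ⟨f', a', hfa'⟩ := h.mem_adjoint_domain_iff.1 y.2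
      have h0 := hex y f' a' hy hfa'
      rw [h0, zero_smul, add_zero] at hfa'
      exact ⟨f', hfa'.symm⟩
    · rintro ⟨f', hf'⟩
      refine (hiff y).2 fun g' hg' => ?_
      obtain ⟨f₁, a₁, hfa₁⟩ := h.mem_adjoint_domain_iff.1 g'.2
      rw [h.inner_adjoint_sub g' y hfa₁ (f' := f') (a' := 0) (by simpa using hf'.symm),
        hex g' f₁ a₁ hg' hfa₁]
      simp

theorem isSelfAdjoint_extension_iff {B : H →ₗ.[ℂ] H} : T ≤ B ∧ IsSelfAdjoint B ↔
    B = T†.domRestrict (LinearMap.range (R : H →ₗ[ℂ] H)) ∨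
      ∃ β : ℝ, B = T†.domRestrict (boundaryLine R e β) := by
  constructor
  · rintro ⟨h1, h2⟩
    exact h.eq_of_isSelfAdjoint h1 h2
  · rintro (rfl | ⟨β, rfl⟩)
    · exact ⟨h.le_domRestrict (S := LinearMap.range (R : H →ₗ[ℂ] H)) fun f _ => ⟨f, rfl⟩,
        h.isSelfAdjoint_domRestrict_range⟩
    · exact ⟨h.le_domRestrict (S := boundaryLine R e β) fun f hf => ⟨f, 0, by simp, by simp [hf]⟩,
        h.isSelfAdjoint_domRestrict_boundaryLine β⟩

/-! #### The domain and the inverse of the Friedrichs extension -/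

variable {f₀ : H} (hf₀ : ⟪e, f₀⟫_ℂ ≠ 0) (hT : IsNonnegOperator T)
  (hQ : R f₀ ∈ closedFormDomain T hT)
include hf₀ hQ

/-- Since R maps into the form domain, an element Rf + ae of the form domain has ae in it as well.
But T†(ae) = −ae has form value −‖ae‖², which must be nonnegative. The range of R exceeds the
closure domain by one dimension, so it is enough to know that a single R f₀ with ⟨e, f₀⟩ ≠ 0 has
finite form. -/
theorem friedrichs_domain : (friedrichsExtension T hT).domain = LinearMap.range (R : H →ₗ[ℂ] H) := by
  have hle : LinearMap.range (R : H →ₗ[ℂ] H) ≤ closedFormDomain T hT := by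
    rw [h.range_eq hf₀]
    refine sup_le (h.closure_domain_le_closedFormDomain hT) ?_
    rwa [Submodule.span_singleton_le_iff_mem]
  rw [friedrichsExtension, LinearPMap.domRestrict_domain]
  refine le_antisymm ?_ (le_inf hle ?_)
  · rintro g ⟨hgQ, hg⟩
    obtain ⟨f, a, rfl⟩ := h.mem_adjoint_domain_iff.1 hg
    have he : a • e ∈ closedFormDomain T hT := by
      have := (closedFormDomain T hT).sub_mem hgQ (hle ⟨f, rfl⟩)
      simpa using this
    have hm : a • e ∈ T†.domain := by simpa using h.mem_adjoint_domain 0 a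
    have h1 := h.adjoint_form_nonneg hT ⟨a • e, hm⟩ he
    rw [h.adjoint_apply (g := ⟨a • e, hm⟩) (f := 0) (a := a) (by simp), zero_sub,
      inner_neg_right, Complex.neg_re] at h1
    have h2 : (⟪a • e, a • e⟫_ℂ).re = ‖a • e‖ ^ 2 := by
      rw [← inner_self_eq_norm_sq (𝕜 := ℂ)]; rfl
    have h3 : a • e = 0 := by
      rw [← norm_eq_zero]
      nlinarith [norm_nonneg (a • e)]
    rw [h3, add_zero]
    exact ⟨f, rfl⟩
  · rintro _ ⟨f, rfl⟩
    simpa using h.mem_adjoint_domain f 0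

theorem friedrichs_eq : friedrichsExtension T hT =
    T†.domRestrict (LinearMap.range (R : H →ₗ[ℂ] H)) := by
  refine h.eq_domRestrict LinearPMap.domRestrict_le fun y => ?_
  change (y : H) ∈ (friedrichsExtension T hT).domain ↔ _
  rw [h.friedrichs_domain hf₀ hT hQ]

theorem operatorKer_friedrichs : operatorKer (shiftByOne (friedrichsExtension T hT)) = ⊥ := by
  rw [eq_bot_iff]
  rintro _ ⟨x, hx, rfl⟩
  have hx0 : x.1 ∈ (friedrichsExtension T hT).domain := x.2
  have hx1 := hx0
  rw [h.friedrichs_domain hf₀ hT hQ] at hx1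
  obtain ⟨f, hf⟩ := hx1
  have h1 := h.friedrichs_apply hT ⟨x.1, hx0⟩ f hf.symm
  have h2 : (x : H) + friedrichsExtension T hT ⟨x.1, hx0⟩ = 0 := hx
  rw [h1, add_sub_cancel] at h2
  rw [h2, map_zero] at hf
  exact hf.symm

theorem inverse_friedrichs : (shiftByOne (friedrichsExtension T hT)).inverse =
    (R : H →ₗ[ℂ] H).toPMap ⊤ := by
  have hker : LinearMap.ker (shiftByOne (friedrichsExtension T hT)).toFun = ⊥ := by
    rw [eq_bot_iff]
    intro x hx
    have : (x : H) ∈ operatorKer (shiftByOne (friedrichsExtension T hT)) := ⟨x, hx, rfl⟩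
    rw [h.operatorKer_friedrichs hf₀ hT hQ, Submodule.mem_bot] at this
    exact Subtype.ext this
  have hval : ∀ f : H, ∃ x : (shiftByOne (friedrichsExtension T hT)).domain,
      (x : H) = R f ∧ shiftByOne (friedrichsExtension T hT) x = f := by
    intro f
    have hm : R f ∈ (friedrichsExtension T hT).domain := by
      rw [h.friedrichs_domain hf₀ hT hQ]; exact ⟨f, rfl⟩
    refine ⟨⟨R f, hm⟩, rfl, ?_⟩
    have h1 := h.friedrichs_apply hT ⟨R f, hm⟩ f rfl
    change R f + friedrichsExtension T hT ⟨R f, hm⟩ = f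
    rw [h1, add_sub_cancel]
  refine LinearPMap.dExt ?_ ?_
  · rw [LinearPMap.inverse_domain, LinearMap.toPMap_domain, eq_top_iff]
    intro f _
    obtain ⟨x, -, hx⟩ := hval f
    exact ⟨x, hx⟩
  · intro y z hyz
    obtain ⟨x, hx1, hx2⟩ := hval y
    rw [LinearPMap.inverse_apply_eq hker hx2, hx1, hyz]
    rfl

end IsGreenOperator

end Extensions

/-! ### The Green operator inverts the differential operator -/

section GreenRepresentation

set_option linter.unusedSectionVars false

variable {α : ℝ} (hα0 : 0 ≤ α) (hα1 : α < 1)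

include hα0 hα1

/-- Lagrange's identity: the terms y'u' cancel. Applied with y = Φ and y = F, it turns the integrals
in the Green representation into boundary terms. -/
theorem hasDerivAt_ofReal_wronskian {y y1 : ℝ → ℝ} {u u1 : ℝ → ℂ} {u2 : ℂ} {q x : ℝ}
    (hy : HasDerivAt y (y1 x) x) (hy1 : HasDerivAt y1 (q * y x) x)
    (hu : HasDerivAt u (u1 x) x) (hu1 : HasDerivAt u1 u2 x) :
    HasDerivAt (fun x => (y1 x : ℂ) * u x - y x * u1 x) (y x * (-u2 + (q : ℂ) * u x)) x := by
  have h := (hy1.ofReal_comp.mul hu).sub (hy.ofReal_comp.mul hu1)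
  refine h.congr_deriv ?_
  push_cast
  ring

variable {u u1 u2 f : ℝ → ℂ} (h1 : ∀ x, 0 < x → HasDerivAt u (u1 x) x)
  (h2 : ∀ x, 0 < x → HasDerivAt u1 (u2 x) x) {N : ℝ} (hN : ∀ x, N < x → u x = 0)
  (hf : MemLp f 2 halfLineMeasure)
  (hfu : ∀ x, 0 < x → f x = -u2 x + ((1 + couplingConst α / x ^ 2 : ℝ) : ℂ) * u x)

include h1 h2 hN hf hfu

theorem integral_Ioi_zeroModePhi_mul {r : ℝ} (hr : 0 < r) :
    ∫ x in Ioi r, (zeroModePhi α x : ℂ) * f x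
      = zeroModePhi α r * u1 r - zeroModePhiDeriv α r * u r := by
  have hd : ∀ x, 0 < x → HasDerivAt (fun x => (zeroModePhiDeriv α x : ℂ) * u x
      - zeroModePhi α x * u1 x) ((zeroModePhi α x : ℂ) * f x) x := fun x hx => by
    rw [hfu x hx]
    exact hasDerivAt_ofReal_wronskian hα0 hα1 (hasDerivAt_zeroModePhi hα0 hα1 hx)
      (hasDerivAt_zeroModePhiDeriv hα0 hα1 hx) (h1 x hx) (h2 x hx)
  have hlim : Tendsto (fun x => (zeroModePhiDeriv α x : ℂ) * u x - zeroModePhi α x * u1 x) atTop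
      (𝓝 0) := by
    refine Tendsto.congr' ?_ tendsto_const_nhds
    filter_upwards [eventually_gt_atTop N, eventually_gt_atTop 0] with x hx hx0
    have e : u =ᶠ[𝓝 x] fun _ => 0 := by
      filter_upwards [lt_mem_nhds hx] with y hy using hN y hy
    have e1 : u1 x = 0 := (h1 x hx0).unique ((hasDerivAt_const x 0).congr_of_eventuallyEq e)
    rw [hN x hx, e1]
    ring
  rw [integral_Ioi_of_hasDerivAt_of_tendsto' (fun x hx => hd x (hr.trans_le hx)) ?_ hlim]
  · ring
  · exact IntegrableOn.mono_set (integrable_zeroModePhi_mul hα0 hα1 hf) (Ioi_subset_Ioi hr.le)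

theorem integral_zeroModePhi_mul_of_tendsto {ℓ : ℂ} (hl : Tendsto
    (fun x => zeroModePhi α x * u1 x - zeroModePhiDeriv α x * u x) (𝓝[>] 0) (𝓝 ℓ)) :
    ∫ x in Ioi 0, (zeroModePhi α x : ℂ) * f x = ℓ := by
  have hi := integrable_zeroModePhi_mul hα0 hα1 hf
  have hc : Tendsto (fun r => ∫ x in Ioi r, (zeroModePhi α x : ℂ) * f x) (𝓝[>] 0)
      (𝓝 (∫ x in Ioi 0, (zeroModePhi α x : ℂ) * f x)) := by
    have e : ∀ᶠ r in 𝓝[>] (0 : ℝ), (∫ x in Ioi 0, (zeroModePhi α x : ℂ) * f x)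
        - (∫ x in (0 : ℝ)..r, (zeroModePhi α x : ℂ) * f x)
          = ∫ x in Ioi r, (zeroModePhi α x : ℂ) * f x := by
      filter_upwards [self_mem_nhdsWithin] with r hr
      rw [← Ioc_union_Ioi_eq_Ioi (mem_Ioi.1 hr).le, setIntegral_union
        (Ioc_disjoint_Ioi le_rfl) measurableSet_Ioi
        (IntegrableOn.mono_set hi Ioc_subset_Ioi_zero)
        (IntegrableOn.mono_set hi (Ioi_subset_Ioi (mem_Ioi.1 hr).le)),
        intervalIntegral.integral_of_le (mem_Ioi.1 hr).le]
      ring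
    refine Tendsto.congr' e ?_
    have hcont : ContinuousOn (fun r => ∫ x in (0 : ℝ)..r, (zeroModePhi α x : ℂ) * f x)
        (uIcc 0 1) :=
      intervalIntegral.continuousOn_primitive_interval
        (by rw [uIcc_of_le zero_le_one, integrableOn_Icc_iff_integrableOn_Ioc]
            exact IntegrableOn.mono_set hi Ioc_subset_Ioi_zero)
    have h0 := (hcont 0 left_mem_uIcc).tendsto
    rw [intervalIntegral.integral_same, uIcc_of_le zero_le_one] at h0
    have h0' := h0.mono_left (nhdsWithin_le_of_mem (Icc_mem_nhdsGT zero_lt_one))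
    simpa using h0'.const_sub (∫ x in Ioi 0, (zeroModePhi α x : ℂ) * f x)
  refine tendsto_nhds_unique hc (hl.congr' ?_)
  filter_upwards [self_mem_nhdsWithin] with r hr
  exact (integral_Ioi_zeroModePhi_mul hα0 hα1 h1 h2 hN hf hfu hr).symm

/-- Lagrange's identity evaluates both integrals in the kernel as boundary terms at r, the ones at
infinity and at 0 being zero. The terms with u' cancel, and u remains with the Wronskian as its
factor. The hypothesis at 0 is weak enough to cover functions behaving like x^{1+α/2}, not only test
functions. -/
theorem greenIntegral_eq_of_tendsto (hl : Tendsto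
    (fun x => zeroModeFDeriv α x * u x - zeroModeF α x * u1 x) (𝓝[>] 0) (𝓝 0))
    {r : ℝ} (hr : 0 < r) : greenIntegral α f r = u r := by
  have hd : ∀ x, 0 < x → HasDerivAt (fun x => (zeroModeFDeriv α x : ℂ) * u x
      - zeroModeF α x * u1 x) ((zeroModeF α x : ℂ) * f x) x := fun x hx => by
    rw [hfu x hx]
    exact hasDerivAt_ofReal_wronskian hα0 hα1 (hasDerivAt_zeroModeF hα0 hα1 hx)
      (hasDerivAt_zeroModeFDeriv hα0 hα1 hx) (h1 x hx) (h2 x hx)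
  rw [greenIntegral_eq_add hα0 hα1 hf hr,
    integral_Ioi_zeroModePhi_mul hα0 hα1 h1 h2 hN hf hfu hr,
    intervalIntegral.integral_eq_sub_of_hasDerivAt_of_tendsto hr (fun x hx => hd x hx.1)
      (intervalIntegrable_zeroModeF_mul hα0 hα1 hf hr) hl
      ((hd r hr).continuousAt.tendsto.mono_left nhdsWithin_le_nhds)]
  have hw : (zeroModePhi α r : ℂ) * zeroModeFDeriv α r - zeroModePhiDeriv α r * zeroModeF α r = 1 := by
    exact_mod_cast zeroMode_wronskian hα0 hα1 hr
  linear_combination u r * hw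

end GreenRepresentation

/-! ### Test functions -/

theorem exists_testFunction_eq_zero (φ : 𝓓(halfLine, ℂ)) :
    ∃ ε N : ℝ, 0 < ε ∧ ε < N ∧ (∀ x, x < ε → φ x = 0) ∧ ∀ x, N < x → φ x = 0 := by
  have hc : IsCompact (tsupport φ) := φ.hasCompactSupport
  obtain ⟨N, hN⟩ := hc.bddAbove
  obtain ⟨ε, hε, hε'⟩ : ∃ ε > 0, ∀ x ∈ tsupport φ, ε ≤ x := by
    rcases (tsupport φ).eq_empty_or_nonempty with h | h
    · exact ⟨1, one_pos, by simp [h]⟩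
    · obtain ⟨x, hx, hmin⟩ := hc.exists_isMinOn h continuousOn_id
      exact ⟨x, φ.tsupport_subset hx, fun y hy => hmin hy⟩
  refine ⟨ε, max N (ε + 1), hε, by simp, fun x hx => ?_, fun x hx => ?_⟩
  · exact image_eq_zero_of_notMem_tsupport fun hm => not_le.2 hx (hε' x hm)
  · exact image_eq_zero_of_notMem_tsupport fun hm => not_le.2 ((le_max_left _ _).trans_lt hx) (hN hm)

/-- A function that is smooth on `(0, ∞)` and vanishes outside a compact subset is a test
function. -/
theorem exists_testFunction {v : ℝ → ℂ} (hv : ContDiffOn ℝ ∞ v (Ioi 0)) {ε N : ℝ} (hε : 0 < ε)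
    (h1 : ∀ x, 0 < x → x < ε → v x = 0) (h2 : ∀ x, N < x → v x = 0) :
    ∃ φ : 𝓓(halfLine, ℂ), ∀ x, 0 < x → φ x = v x := by
  have hz : ∀ x, x ∉ Icc ε N → (Ioi 0).indicator v x = 0 := fun x hx => by
    by_cases h0 : x ∈ Ioi 0
    · rw [indicator_of_mem h0]
      by_cases hx1 : x < ε
      · exact h1 x h0 hx1
      · exact h2 x (not_le.1 fun h => hx ⟨not_lt.1 hx1, h⟩)
    · exact indicator_of_notMem h0 _
  have hs : tsupport ((Ioi 0).indicator v) ⊆ Icc ε N :=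
    closure_minimal (fun x hx => by_contra fun h => hx (hz x h)) isClosed_Icc
  have hsub : tsupport ((Ioi 0).indicator v) ⊆ Ioi 0 := fun x hx => hε.trans_le (hs hx).1
  have hcd : ContDiff ℝ ∞ ((Ioi 0).indicator v) := by
    refine contDiff_iff_contDiffAt.2 fun x => ?_
    by_cases hx : x ∈ tsupport ((Ioi 0).indicator v)
    swap
    · exact contDiffAt_const.congr_of_eventuallyEq (notMem_tsupport_iff_eventuallyEq.1 hx)
    have hx0 : x ∈ Ioi (0 : ℝ) := hsub hx
    refine (hv.contDiffAt (Ioi_mem_nhds hx0)).congr_of_eventuallyEq ?_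
    filter_upwards [Ioi_mem_nhds hx0] with y hy using indicator_of_mem hy _
  refine ⟨⟨_, hcd, HasCompactSupport.of_support_subset_isCompact isCompact_Icc
    ((subset_tsupport _).trans hs), hsub⟩, fun x hx => indicator_of_mem (mem_Ioi.2 hx) v⟩

theorem ae_eq_zero_of_forall_testFunction {f : ℝ → ℂ} (hf : LocallyIntegrableOn f (Ioi 0))
    (h : ∀ φ : 𝓓(halfLine, ℂ), ∫ x in Ioi 0, f x * φ x = 0) : f =ᵐ[halfLineMeasure] 0 := by
  have := isOpen_Ioi.ae_eq_zero_of_integral_contDiff_smul_eq_zero hf fun g hg hgc hgs => by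
    have hs : tsupport (fun x => (g x : ℂ)) ⊆ tsupport g := by
      refine closure_mono fun x hx h0 => hx ?_
      simp [h0]
    have hφ := h ⟨fun x => (g x : ℂ), Complex.ofRealCLM.contDiff.comp hg,
      hgc.comp_left (g := fun x : ℝ => (x : ℂ)) Complex.ofReal_zero, hs.trans hgs⟩
    rw [← hφ, ← setIntegral_eq_integral_of_forall_compl_eq_zero (s := Ioi 0)]
    · refine setIntegral_congr_fun measurableSet_Ioi fun x _ => ?_
      change g x • f x = f x * (g x : ℂ)
      rw [Complex.real_smul, mul_comm]
    · intro x hx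
      rw [image_eq_zero_of_notMem_tsupport fun hm => hx (hgs hm), zero_smul]
  rw [Filter.EventuallyEq, ae_restrict_iff' measurableSet_Ioi]
  exact this

theorem locallyIntegrableOn_of_memLp {f : ℝ → ℂ} (hf : MemLp f 2 halfLineMeasure) :
    LocallyIntegrableOn f (Ioi 0) :=
  locallyIntegrableOn_of_locallyIntegrable_restrict (hf.locallyIntegrable (by norm_num))

theorem inner_eq_setIntegral {f g : ℝ → ℂ} {w v : HalfLineL2} (hf : w =ᵐ[halfLineMeasure] f)
    (hg : v =ᵐ[halfLineMeasure] g) : ⟪w, v⟫_ℂ = ∫ x in Ioi 0, starRingEnd ℂ (f x) * g x := by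
  rw [L2.inner_def]
  refine integral_congr_ae ?_
  filter_upwards [hf, hg] with x h1 h2
  rw [h1, h2, RCLike.inner_apply, mul_comm]

theorem coeFn_testToL2 (φ : 𝓓(halfLine, ℂ)) : testToL2 φ =ᵐ[halfLineMeasure] φ :=
  (testFunction_memLp φ).coeFn_toLp

theorem inner_testToL2 (w : HalfLineL2) (φ : 𝓓(halfLine, ℂ)) :
    ⟪w, testToL2 φ⟫_ℂ = ∫ x in Ioi 0, starRingEnd ℂ (w x) * φ x :=
  inner_eq_setIntegral (ae_eq_refl _) (coeFn_testToL2 φ)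

theorem memLp_conj {f : ℝ → ℂ} (hf : MemLp f 2 halfLineMeasure) :
    MemLp (fun x => starRingEnd ℂ (f x)) 2 halfLineMeasure :=
  hf.star

theorem dense_zeroModeOperator_domain (α : ℝ) :
    Dense ((zeroModeOperator α).domain : Set HalfLineL2) := by
  rw [Submodule.dense_iff_topologicalClosure_eq_top, Submodule.topologicalClosure_eq_top_iff,
    eq_bot_iff]
  intro w hw
  have h : ∀ φ : 𝓓(halfLine, ℂ), ∫ x in Ioi 0, starRingEnd ℂ (w x) * φ x = 0 := fun φ => by
    rw [← inner_testToL2, ← inner_conj_symm,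
      (Submodule.mem_orthogonal _ _).1 hw _ (LinearMap.mem_range_self testToL2 φ), map_zero]
  have := ae_eq_zero_of_forall_testFunction
    (locallyIntegrableOn_of_memLp (memLp_conj (Lp.memLp w))) h
  refine (Submodule.mem_bot ℂ).2 ((Lp.eq_zero_iff_ae_eq_zero).2 ?_)
  filter_upwards [this] with x hx
  simpa using hx

theorem integrable_mul_testFunction {f : ℝ → ℂ} (hf : LocallyIntegrableOn f (Ioi 0))
    (φ : 𝓓(halfLine, ℂ)) : Integrable (fun x => f x * φ x) halfLineMeasure := by
  obtain ⟨ε, N, hε, -, h1, h2⟩ := exists_testFunction_eq_zero φ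
  have hi : IntegrableOn (fun x => f x * φ x) (Icc ε N) :=
    (hf.integrableOn_compact_subset (fun x hx => hε.trans_le hx.1) isCompact_Icc).mul_continuousOn
      φ.continuous.continuousOn isCompact_Icc
  refine IntegrableOn.of_forall_sdiff_eq_zero hi measurableSet_Ioi fun x hx => ?_
  have : φ x = 0 := by
    by_cases hx1 : x < ε
    · exact h1 x hx1
    · exact h2 x (not_le.1 fun h => hx.2 ⟨not_lt.1 hx1, h⟩)
  rw [this, mul_zero]

/-- Integration against a locally integrable function, as a linear form on test functions. -/
noncomputable def testPairing {f : ℝ → ℂ} (hf : LocallyIntegrableOn f (Ioi 0)) :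
    𝓓(halfLine, ℂ) →ₗ[ℂ] ℂ where
  toFun φ := ∫ x in Ioi 0, f x * φ x
  map_add' φ ψ := by
    rw [← integral_add (integrable_mul_testFunction hf φ) (integrable_mul_testFunction hf ψ)]
    refine integral_congr_ae (ae_of_all _ fun x => ?_)
    exact mul_add _ _ _
  map_smul' c φ := by
    rw [RingHom.id_apply, smul_eq_mul, ← integral_const_mul]
    refine integral_congr_ae (ae_of_all _ fun x => ?_)
    exact mul_left_comm _ _ _

section GreenOperatorInverse

variable {α : ℝ}

theorem coeFn_besselActionL2_add (φ : 𝓓(halfLine, ℂ)) :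
    (besselActionL2 α φ + testToL2 φ : HalfLineL2) =ᵐ[halfLineMeasure]
      fun x => besselAction α φ x + φ x := by
  filter_upwards [Lp.coeFn_add (besselActionL2 α φ) (testToL2 φ), coeFn_testToL2 φ,
    (besselAction_memLp α φ).coeFn_toLp] with x h1 h2 h3
  rw [h1, Pi.add_apply, h2]
  exact congrArg (· + φ x) h3

theorem memLp_besselAction_add (φ : 𝓓(halfLine, ℂ)) :
    MemLp (fun x => besselAction α φ x + φ x) 2 halfLineMeasure :=
  (besselAction_memLp α φ).add (testFunction_memLp φ)

theorem tendsto_wronskian_testFunction (φ : 𝓓(halfLine, ℂ)) (y z : ℝ → ℝ) :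
    Tendsto (fun x => (y x : ℂ) * φ x - z x * deriv φ x) (𝓝[>] 0) (𝓝 0) := by
  obtain ⟨ε, -, hε, -, h1, -⟩ := exists_testFunction_eq_zero φ
  refine Tendsto.congr' ?_ tendsto_const_nhds
  filter_upwards [nhdsWithin_le_nhds (gt_mem_nhds hε)] with x hx
  have e : φ =ᶠ[𝓝 x] fun _ => 0 := by
    filter_upwards [gt_mem_nhds hx] with y hy using h1 y hy
  rw [h1 x hx, e.deriv_eq, deriv_const]
  ring

variable (hα0 : 0 ≤ α) (hα1 : α < 1)
include hα0 hα1

theorem greenIntegral_besselAction_add (φ : 𝓓(halfLine, ℂ)) {r : ℝ} (hr : 0 < r) :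
    greenIntegral α (fun x => besselAction α φ x + φ x) r = φ r := by
  obtain ⟨-, N, -, -, -, hN⟩ := exists_testFunction_eq_zero φ
  refine greenIntegral_eq_of_tendsto hα0 hα1
    (fun x _ => (testFunction_differentiable φ x).hasDerivAt)
    (fun x _ => (testFunction_deriv_differentiable φ x).hasDerivAt) hN
    (memLp_besselAction_add φ) (fun x hx => ?_)
    (tendsto_wronskian_testFunction φ (zeroModeFDeriv α) (zeroModeF α)) hr
  simp only [besselAction]
  push_cast
  ring

theorem integral_zeroModePhi_mul_besselAction_add (φ : 𝓓(halfLine, ℂ)) :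
    ∫ x in Ioi 0, (zeroModePhi α x : ℂ) * (besselAction α φ x + φ x) = 0 := by
  obtain ⟨-, N, -, -, -, hN⟩ := exists_testFunction_eq_zero φ
  refine integral_zeroModePhi_mul_of_tendsto hα0 hα1
    (fun x _ => (testFunction_differentiable φ x).hasDerivAt)
    (fun x _ => (testFunction_deriv_differentiable φ x).hasDerivAt) hN
    (memLp_besselAction_add φ) (fun x hx => ?_) ?_
  · simp only [besselAction]
    push_cast
    ring
  · have := (tendsto_wronskian_testFunction φ (zeroModePhiDeriv α) (zeroModePhi α)).neg
    rw [neg_zero] at this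
    refine this.congr fun x => by ring

/-- The zero mode `Φ_{α,0}` as an element of `L²((0, ∞))`. -/
noncomputable def zeroModePhiL2 : HalfLineL2 := (memLp_zeroModePhi hα0 hα1).toLp _

theorem coeFn_zeroModePhiL2 :
    zeroModePhiL2 hα0 hα1 =ᵐ[halfLineMeasure] fun x => (zeroModePhi α x : ℂ) :=
  (memLp_zeroModePhi hα0 hα1).coeFn_toLp

theorem inner_zeroModePhiL2 {f : ℝ → ℂ} {v : HalfLineL2} (hv : v =ᵐ[halfLineMeasure] f) :
    ⟪zeroModePhiL2 hα0 hα1, v⟫_ℂ = ∫ x in Ioi 0, (zeroModePhi α x : ℂ) * f x := by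
  rw [inner_eq_setIntegral (coeFn_zeroModePhiL2 hα0 hα1) hv]
  simp only [Complex.conj_ofReal]

/-- The solution given by variation of constants vanishes near 0 because ψ does. Beyond the support
of ψ its two coefficients are the full integrals against F and Φ, which vanish by hypothesis, so it
is again a test function. -/
theorem exists_besselAction_add_eq (ψ : 𝓓(halfLine, ℂ))
    (hΦ : ∫ x in Ioi 0, (zeroModePhi α x : ℂ) * ψ x = 0)
    (hF : ∫ x in Ioi 0, (zeroModeF α x : ℂ) * ψ x = 0) :
    ∃ φ : 𝓓(halfLine, ℂ), ∀ x, 0 < x → besselAction α φ x + φ x = ψ x := by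
  obtain ⟨ε, N, hε, hεN, h1, h2⟩ := exists_testFunction_eq_zero ψ
  have hψ := testFunction_memLp ψ
  have z1 : ∀ (y : ℝ → ℝ) (x : ℝ), 0 < x → x < ε →
      ∫ ρ in (0 : ℝ)..x, (y ρ : ℂ) * ψ ρ = 0 := fun y x hx hxε => by
    rw [intervalIntegral.integral_of_le hx.le]
    refine setIntegral_eq_zero_of_forall_eq_zero fun ρ hρ => ?_
    rw [h1 ρ (hρ.2.trans_lt hxε), mul_zero]
  have z2 : ∀ (y : ℝ → ℝ), ∫ x in Ioi 0, (y x : ℂ) * ψ x = 0 → ∀ x : ℝ, N < x →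
      ∫ ρ in (0 : ℝ)..x, (y ρ : ℂ) * ψ ρ = 0 := fun y hy x hx => by
    have hx0 : 0 < x := (hε.trans hεN).trans hx
    rw [intervalIntegral.integral_of_le hx0.le, ← hy]
    refine (setIntegral_eq_of_subset_of_forall_sdiff_eq_zero measurableSet_Ioi
      Ioc_subset_Ioi_zero fun ρ hρ => ?_).symm
    rw [h2 ρ (hx.trans (not_le.1 fun h => hρ.2 ⟨hρ.1, h⟩)), mul_zero]
  obtain ⟨φ, hφ⟩ := exists_testFunction
    (contDiffOn_volterra hα0 hα1 hψ ψ.contDiff.contDiffOn) hε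
    (fun x hx hxε => by rw [volterra, z1 _ x hx hxε, z1 _ x hx hxε]; simp)
    (fun x hx => by rw [volterra, z2 _ hF x hx, z2 _ hΦ x hx]; simp)
  refine ⟨φ, fun x hx => ?_⟩
  have e1 : ∀ y, 0 < y → deriv φ y = volterraDeriv α ψ y := fun y hy => by
    have : φ =ᶠ[𝓝 y] volterra α ψ := by
      filter_upwards [Ioi_mem_nhds hy] with z hz using hφ z hz
    rw [this.deriv_eq]
    exact (hasDerivAt_volterra hα0 hα1 hψ ψ.continuous.continuousOn hy).deriv
  have e2 : deriv φ =ᶠ[𝓝 x] volterraDeriv α ψ := by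
    filter_upwards [Ioi_mem_nhds hx] with z hz using e1 z hz
  rw [besselAction, e2.deriv_eq,
    (hasDerivAt_volterraDeriv hα0 hα1 hψ ψ.continuous.continuousOn hx).deriv, hφ x hx]
  ring

/-- On (1, ∞), a set of infinite measure, F is at least F(1) > 0. -/
theorem not_memLp_zeroModeF : ¬ MemLp (fun x => (zeroModeF α x : ℂ)) 2 halfLineMeasure := by
  intro h
  have h1 : MemLp (fun _ : ℝ => zeroModeF α 1) 2 (volume.restrict (Ioi (1 : ℝ))) := by
    refine (h.mono_measure (Measure.restrict_mono (Ioi_subset_Ioi zero_le_one) le_rfl)).mono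
      aestronglyMeasurable_const ?_
    filter_upwards [ae_restrict_mem measurableSet_Ioi] with x hx
    have hx1 : (1 : ℝ) < x := hx
    rw [Complex.norm_real, Real.norm_of_nonneg (zeroModeF_pos hα0 hα1 one_pos).le,
      Real.norm_of_nonneg (zeroModeF_pos hα0 hα1 (one_pos.trans hx1)).le]
    exact zeroModeF_mono hα0 hα1 one_pos hx1.le
  rw [memLp_const_iff two_ne_zero ENNReal.ofNat_ne_top] at h1
  rcases h1 with h1 | h1
  · exact (zeroModeF_pos hα0 hα1 one_pos).ne' h1
  · simp at h1

/-- Determines the weak solutions of the equation in L² without regularity theory, by linear algebra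
on functionals over the test functions. -/
theorem exists_smul_zeroModePhiL2 {w : HalfLineL2}
    (hw : ∀ φ : 𝓓(halfLine, ℂ), ⟪w, besselActionL2 α φ + testToL2 φ⟫_ℂ = 0) :
    ∃ c : ℂ, w = c • zeroModePhiL2 hα0 hα1 := by
  have lw : LocallyIntegrableOn (fun x => starRingEnd ℂ (w x)) (Ioi 0) :=
    locallyIntegrableOn_of_memLp (memLp_conj (Lp.memLp w))
  have lΦ : LocallyIntegrableOn (fun x => (zeroModePhi α x : ℂ)) (Ioi 0) :=
    locallyIntegrableOn_of_memLp (memLp_zeroModePhi hα0 hα1)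
  have lF : LocallyIntegrableOn (fun x => (zeroModeF α x : ℂ)) (Ioi 0) :=
    (Complex.continuous_ofReal.comp_continuousOn
      (continuousOn_zeroModeF hα0 hα1)).locallyIntegrableOn measurableSet_Ioi
  have hspan : testPairing lw ∈ Submodule.span ℂ (range ![testPairing lΦ, testPairing lF]) := by
    -- A linear functional vanishing on the common kernel of finitely many functionals is a
    -- combination of them; here the two are integration against Φ and F.
    refine mem_span_of_iInf_ker_le_ker fun ψ hψ => ?_
    rw [Submodule.mem_iInf] at hψ
    obtain ⟨φ, hφ⟩ := exists_besselAction_add_eq hα0 hα1 ψ (hψ 0) (hψ 1)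
    have := hw φ
    rw [inner_eq_setIntegral (ae_eq_refl _) (coeFn_besselActionL2_add φ)] at this
    refine Eq.trans (setIntegral_congr_fun measurableSet_Ioi fun x hx => ?_) this
    simp only [hφ x hx]
  rw [Matrix.range_cons, Matrix.range_cons, Matrix.range_empty, union_empty, singleton_union,
    Submodule.mem_span_pair] at hspan
  obtain ⟨a, b, hab⟩ := hspan
  have hae : (fun x => starRingEnd ℂ (w x) - (a * zeroModePhi α x + b * zeroModeF α x))
      =ᵐ[halfLineMeasure] 0 := by
    refine ae_eq_zero_of_forall_testFunction (lw.sub ((lΦ.smul a).add (lF.smul b))) fun φ => ?_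
    have h1 := LinearMap.congr_fun hab φ
    have i1 := integrable_mul_testFunction lw φ
    have i2 := integrable_mul_testFunction lΦ φ
    have i3 := integrable_mul_testFunction lF φ
    have i4 : Integrable (fun x => a * (zeroModePhi α x * φ x) + b * (zeroModeF α x * φ x))
        halfLineMeasure := (i2.const_mul a).add (i3.const_mul b)
    calc ∫ x in Ioi 0, (starRingEnd ℂ (w x) - (a * zeroModePhi α x + b * zeroModeF α x)) * φ x
        = ∫ x in Ioi 0, (starRingEnd ℂ (w x) * φ x
          - (a * (zeroModePhi α x * φ x) + b * (zeroModeF α x * φ x))) := by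
          refine integral_congr_ae (ae_of_all _ fun x => ?_)
          ring
      _ = 0 := by
          rw [integral_sub i1 i4,
            integral_add (i2.const_mul a) (i3.const_mul b), integral_const_mul, integral_const_mul,
            sub_eq_zero]
          exact h1.symm
  -- Otherwise F would be a combination of conj w and Φ and therefore square-integrable.
  have hb : b = 0 := by
    by_contra hb
    refine not_memLp_zeroModeF hα0 hα1 ?_
    have hm := ((memLp_conj (Lp.memLp w)).sub ((memLp_zeroModePhi hα0 hα1).const_mul a)).const_mul b⁻¹
    refine hm.ae_eq ?_
    filter_upwards [hae] with x hx
    have hx' : starRingEnd ℂ (w x) = a * zeroModePhi α x + b * zeroModeF α x := sub_eq_zero.1 hx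
    simp only [Pi.sub_apply, hx']
    field_simp
    ring
  refine ⟨starRingEnd ℂ a, Lp.ext ?_⟩
  filter_upwards [hae, Lp.coeFn_smul (starRingEnd ℂ a) (zeroModePhiL2 hα0 hα1),
    coeFn_zeroModePhiL2 hα0 hα1] with x h1 h2 h3
  have h1' : starRingEnd ℂ (w x) = a * zeroModePhi α x + b * zeroModeF α x := sub_eq_zero.1 h1
  rw [hb, zero_mul, add_zero] at h1'
  rw [h2, Pi.smul_apply, h3, smul_eq_mul, ← Complex.conj_conj (w x), h1', map_mul,
    Complex.conj_ofReal]

theorem zeroModePhiL2_ne_zero : zeroModePhiL2 hα0 hα1 ≠ 0 := by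
  intro h
  have h1 := (Lp.eq_zero_iff_ae_eq_zero).1 h
  have h2 : ∀ᵐ x ∂halfLineMeasure, False := by
    filter_upwards [h1, coeFn_zeroModePhiL2 hα0 hα1, ae_restrict_mem measurableSet_Ioi]
      with x h1 h2 hx
    rw [h1, Pi.zero_apply] at h2
    exact (zeroModePhi_pos hα0 hα1 hx).ne' (by exact_mod_cast h2.symm)
  rw [eventually_false_iff_eq_bot, ae_eq_bot, Measure.restrict_eq_zero] at h2
  simp at h2

theorem isGreenOperator_greenOperator :
    IsGreenOperator (zeroModeOperator α) (greenOperator hα0 hα1) (zeroModePhiL2 hα0 hα1) where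
  dense := dense_zeroModeOperator_domain α
  symm := inner_greenOperator_left hα0 hα1
  left_inv := by
    rintro ⟨_, φ, rfl⟩
    rw [zeroModeOperator_apply]
    refine Lp.ext ?_
    filter_upwards [coeFn_greenOperator hα0 hα1 (besselActionL2 α φ + testToL2 φ),
      coeFn_testToL2 φ, ae_restrict_mem measurableSet_Ioi] with r h1 h2 hr
    rw [h1, greenIntegral_congr (coeFn_besselActionL2_add φ),
      greenIntegral_besselAction_add hα0 hα1 φ hr, h2]
  ne_zero := zeroModePhiL2_ne_zero hα0 hα1
  inner_eq_zero := by
    rintro ⟨_, φ, rfl⟩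
    rw [zeroModeOperator_apply, inner_zeroModePhiL2 hα0 hα1 (coeFn_besselActionL2_add φ),
      integral_zeroModePhi_mul_besselAction_add hα0 hα1]
  exists_smul w hw := exists_smul_zeroModePhiL2 hα0 hα1 fun φ => by
    rw [← zeroModeOperator_apply]
    exact hw ⟨testToL2 φ, LinearMap.mem_range_self _ φ⟩

end GreenOperatorInverse

/-! ### The adjoint as the maximal realisation -/

/-- The complex conjugate of a test function. -/
noncomputable def conjTestFunction (φ : 𝓓(halfLine, ℂ)) : 𝓓(halfLine, ℂ) :=
  ⟨fun x => starRingEnd ℂ (φ x), Complex.conjCLE.contDiff.comp φ.contDiff,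
    φ.hasCompactSupport.comp_left (map_zero _),
    (tsupport_comp_subset (map_zero (starRingEnd ℂ)) φ).trans φ.tsupport_subset⟩

theorem conjTestFunction_apply (φ : 𝓓(halfLine, ℂ)) (x : ℝ) :
    conjTestFunction φ x = starRingEnd ℂ (φ x) := rfl

theorem besselAction_conjTestFunction (α : ℝ) (φ : 𝓓(halfLine, ℂ)) (x : ℝ) :
    besselAction α (conjTestFunction φ) x = starRingEnd ℂ (besselAction α φ x) := by
  have h1 : deriv (conjTestFunction φ) = fun x => starRingEnd ℂ (deriv φ x) := by
    funext y
    exact ((testFunction_differentiable φ y).hasDerivAt.star).deriv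
  have h2 : deriv (fun x => starRingEnd ℂ (deriv φ x)) x = starRingEnd ℂ (deriv (deriv φ) x) :=
    ((testFunction_deriv_differentiable φ x).hasDerivAt.star).deriv
  rw [besselAction, besselAction, h1, h2, conjTestFunction_apply, map_add, map_mul, map_neg,
    Complex.conj_ofReal]

theorem coeFn_besselActionL2 (α : ℝ) (φ : 𝓓(halfLine, ℂ)) :
    besselActionL2 α φ =ᵐ[halfLineMeasure] besselAction α φ :=
  (besselAction_memLp α φ).coeFn_toLp

/-- Conjugating the test function replaces the sesquilinear inner product by the bilinear pairing
used for weak derivatives. -/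
theorem inner_testToL2_conj (w : HalfLineL2) (φ : 𝓓(halfLine, ℂ)) :
    ⟪testToL2 (conjTestFunction φ), w⟫_ℂ = ∫ x in Ioi 0, w x * φ x := by
  rw [inner_eq_setIntegral (coeFn_testToL2 _) (ae_eq_refl _)]
  simp only [conjTestFunction_apply, Complex.conj_conj, mul_comm]

theorem inner_besselActionL2_conj {α : ℝ} (w : HalfLineL2) (φ : 𝓓(halfLine, ℂ)) :
    ⟪besselActionL2 α (conjTestFunction φ), w⟫_ℂ = ∫ x in Ioi 0, w x * besselAction α φ x := by
  rw [inner_eq_setIntegral (coeFn_besselActionL2 α _) (ae_eq_refl _)]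
  simp only [besselAction_conjTestFunction, Complex.conj_conj, mul_comm]

theorem exists_adjoint_eq_iff {α : ℝ} {g w : HalfLineL2} :
    (∃ hg : g ∈ (zeroModeOperator α)†.domain, (zeroModeOperator α)† ⟨g, hg⟩ = w) ↔
      ∀ φ : 𝓓(halfLine, ℂ), ∫ x in Ioi 0, w x * φ x = ∫ x in Ioi 0, g x * besselAction α φ x := by
  have hd := dense_zeroModeOperator_domain α
  constructor
  · rintro ⟨hg, rfl⟩ φ
    have h := (LinearPMap.adjoint_isFormalAdjoint hd).symm
      ⟨testToL2 (conjTestFunction φ), LinearMap.mem_range_self _ _⟩ ⟨g, hg⟩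
    rw [zeroModeOperator_apply, inner_besselActionL2_conj, inner_testToL2_conj] at h
    exact h.symm
  · intro h
    have h' : ∀ x : (zeroModeOperator α).domain,
        ⟪w, (x : HalfLineL2)⟫_ℂ = ⟪g, zeroModeOperator α x⟫_ℂ := by
      rintro ⟨_, φ, rfl⟩
      have e : conjTestFunction (conjTestFunction φ) = φ := by
        ext x
        exact Complex.conj_conj _
      have := h (conjTestFunction φ)
      rw [← inner_testToL2_conj, ← inner_besselActionL2_conj, e] at this
      rw [zeroModeOperator_apply, ← inner_conj_symm, this, inner_conj_symm]
    have hg : g ∈ (zeroModeOperator α)†.domain :=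
      LinearPMap.mem_adjoint_domain_of_exists _ ⟨w, h'⟩
    exact ⟨hg, LinearPMap.adjoint_apply_eq hd ⟨g, hg⟩ h'⟩

theorem continuousOn_couplingConst_div_sq (α : ℝ) :
    ContinuousOn (fun x : ℝ => ((couplingConst α / x ^ 2 : ℝ) : ℂ)) (Ioi 0) := by
  refine Complex.continuous_ofReal.comp_continuousOn
    (continuousOn_const.div (by fun_prop) fun x hx => ?_)
  have : (0 : ℝ) < x := hx
  positivity

/-- The potential is continuous on the open half-line, so its product with g is locally integrable
and the same term can be added to both sides of the weak identity. -/
theorem hasWeakSecondDeriv_iff {α : ℝ} {g h : ℝ → ℂ} (hg : LocallyIntegrableOn g (Ioi 0)) :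
    HasWeakSecondDeriv g h ↔ LocallyIntegrableOn h (Ioi 0) ∧ ∀ φ : 𝓓(halfLine, ℂ),
      ∫ x in Ioi 0, (-h x + ((couplingConst α / x ^ 2 : ℝ) : ℂ) * g x) * φ x
        = ∫ x in Ioi 0, g x * besselAction α φ x := by
  have hV : LocallyIntegrableOn (fun x => ((couplingConst α / x ^ 2 : ℝ) : ℂ) * g x) (Ioi 0) :=
    hg.continuousOn_mul (continuousOn_couplingConst_div_sq α) isOpen_Ioi.isLocallyClosed
  refine and_congr_right fun hh => forall_congr' fun φ => ?_
  have i1 := integrable_mul_testFunction hh φ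
  have i2 := integrable_mul_testFunction hV φ
  have i3 : Integrable (fun x => g x * deriv (deriv φ) x) halfLineMeasure := by
    obtain ⟨v, hv⟩ : ∃ v : 𝓓(halfLine, ℂ), ⇑v = deriv (deriv φ) :=
      ⟨⟨_, (contDiff_infty_iff_deriv.1 (testFunction_deriv_contDiff φ)).2,
        φ.hasCompactSupport.deriv.deriv, (tsupport_deriv_subset.trans tsupport_deriv_subset).trans
          φ.tsupport_subset⟩, rfl⟩
    rw [← hv]
    exact integrable_mul_testFunction hg v
  have e1 : ∫ x in Ioi 0, (-h x + ((couplingConst α / x ^ 2 : ℝ) : ℂ) * g x) * φ x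
      = -(∫ x in Ioi 0, h x * φ x)
        + ∫ x in Ioi 0, ((couplingConst α / x ^ 2 : ℝ) : ℂ) * g x * φ x := by
    rw [← integral_neg]
    refine Eq.trans ?_ (integral_add i1.neg i2)
    exact integral_congr_ae (ae_of_all _ fun x => by beta_reduce; ring)
  have e2 : ∫ x in Ioi 0, g x * besselAction α φ x = -(∫ x in Ioi 0, g x * deriv (deriv φ) x)
      + ∫ x in Ioi 0, ((couplingConst α / x ^ 2 : ℝ) : ℂ) * g x * φ x := by
    rw [← integral_neg]
    refine Eq.trans ?_ (integral_add i3.neg i2)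
    exact integral_congr_ae (ae_of_all _ fun x => by
      simp only [besselAction]; ring)
  rw [e1, e2, add_left_inj, neg_inj, eq_comm]

theorem mem_adjoint_domain_iff_hasWeakSecondDeriv {α : ℝ} {g : HalfLineL2} :
    g ∈ (zeroModeOperator α)†.domain ↔ ∃ h : ℝ → ℂ, HasWeakSecondDeriv g h ∧
      MemLp (fun x => -h x + ((couplingConst α / x ^ 2 : ℝ) : ℂ) * g x) 2 halfLineMeasure := by
  have lg := locallyIntegrableOn_of_memLp (Lp.memLp g)
  constructor
  · intro hg
    have hV : LocallyIntegrableOn (fun x => ((couplingConst α / x ^ 2 : ℝ) : ℂ) * g x) (Ioi 0) :=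
      lg.continuousOn_mul (continuousOn_couplingConst_div_sq α) isOpen_Ioi.isLocallyClosed
    have hm := Lp.memLp ((zeroModeOperator α)† ⟨g, hg⟩)
    -- The weak second derivative has to be the potential term minus A*g.
    refine ⟨fun x => ((couplingConst α / x ^ 2 : ℝ) : ℂ) * g x - (zeroModeOperator α)† ⟨g, hg⟩ x,
      (hasWeakSecondDeriv_iff (α := α) lg).2
        ⟨hV.sub (locallyIntegrableOn_of_memLp hm), fun φ => ?_⟩, ?_⟩
    · rw [← exists_adjoint_eq_iff.1 ⟨hg, rfl⟩ φ]
      exact integral_congr_ae (ae_of_all _ fun x => by ring)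
    · exact hm.ae_eq (ae_of_all _ fun x => by ring)
  · rintro ⟨h, hh, hm⟩
    refine (exists_adjoint_eq_iff (w := hm.toLp _)).2 (fun φ => ?_) |>.1
    rw [← ((hasWeakSecondDeriv_iff lg).1 hh).2 φ]
    refine integral_congr_ae ?_
    filter_upwards [hm.coeFn_toLp] with x hx
    rw [hx]

theorem adjoint_ae_eq {α : ℝ} (g : (zeroModeOperator α)†.domain) {h : ℝ → ℂ}
    (hh : HasWeakSecondDeriv (g : HalfLineL2) h) : (zeroModeOperator α)† g =ᵐ[halfLineMeasure]
      fun x => -h x + ((couplingConst α / x ^ 2 : ℝ) : ℂ) * (g : HalfLineL2) x := by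
  have lg := locallyIntegrableOn_of_memLp (Lp.memLp (g : HalfLineL2))
  have hV : LocallyIntegrableOn (fun x => ((couplingConst α / x ^ 2 : ℝ) : ℂ)
      * (g : HalfLineL2) x) (Ioi 0) :=
    lg.continuousOn_mul (continuousOn_couplingConst_div_sq α) isOpen_Ioi.isLocallyClosed
  have hm := locallyIntegrableOn_of_memLp (Lp.memLp ((zeroModeOperator α)† g))
  have hk := hh.1.neg.add hV
  have := ae_eq_zero_of_forall_testFunction (hm.sub hk) fun φ => by
    have e1 := exists_adjoint_eq_iff.1 ⟨g.2, rfl⟩ φ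
    rw [← ((hasWeakSecondDeriv_iff lg).1 hh).2 φ, ← sub_eq_zero] at e1
    refine Eq.trans ?_ ((integral_sub (integrable_mul_testFunction hm φ)
      (integrable_mul_testFunction hk φ)).trans e1)
    exact integral_congr_ae (ae_of_all _ fun x => sub_mul _ _ _)
  filter_upwards [this] with x hx
  exact sub_eq_zero.1 hx

/-! ### Expansions at the origin -/

theorem tendsto_mul_rpow_neg_of_isLittleO {h : ℝ → ℂ} {p q : ℝ}
    (hh : h =o[𝓝[>] 0] fun x : ℝ => x ^ p) (hqp : q ≤ p) :
    Tendsto (fun x : ℝ => h x * ((x ^ (-q) : ℝ) : ℂ)) (𝓝[>] 0) (𝓝 0) := by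
  rw [← isLittleO_one_iff ℝ]
  have h1 : (fun x : ℝ => ((x ^ (-q) : ℝ) : ℂ)) =O[𝓝[>] 0] fun x : ℝ => x ^ (-q) :=
    IsBigO.of_bound 1 (Eventually.of_forall fun x => by rw [Complex.norm_real, one_mul])
  refine (hh.mul_isBigO h1).trans_isBigO (IsBigO.of_bound 1 ?_)
  filter_upwards [Ioc_mem_nhdsGT zero_lt_one] with x hx
  rw [← Real.rpow_add hx.1, norm_one, mul_one, Real.norm_of_nonneg (Real.rpow_nonneg hx.1.le _)]
  exact Real.rpow_le_one hx.1.le hx.2 (by linarith)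

theorem tendsto_ofReal_rpow_nhdsGT_zero {p : ℝ} (hp : 0 < p) :
    Tendsto (fun x : ℝ => ((x ^ p : ℝ) : ℂ)) (𝓝[>] 0) (𝓝 0) := by
  have h := (Real.continuousAt_rpow_const 0 p (Or.inr hp.le)).tendsto
  rw [Real.zero_rpow hp.ne'] at h
  exact_mod_cast (Complex.continuous_ofReal.tendsto 0).comp (h.mono_left nhdsWithin_le_nhds)

theorem isLittleO_ofReal {h : ℝ → ℝ} {k : ℝ → ℝ} (hh : h =o[𝓝[>] 0] k) :
    (fun x => (h x : ℂ)) =o[𝓝[>] 0] k :=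
  (isBigO_of_le _ fun x => (Complex.norm_real (h x)).le).trans_isLittleO hh

section OriginExpansion

variable {α : ℝ}

/-- The exponents satisfy −α/2 < 1+α/2 < 3/2, the last because α < 1, so the coefficients can be
read off one after the other by dividing by the leading power. -/
theorem eq_zero_of_isLittleO (hα0 : 0 ≤ α) (hα1 : α < 1) {a b : ℂ}
    (h : (fun x : ℝ => a * ((x ^ (-(α / 2)) : ℝ) : ℂ) + b * ((x ^ (1 + α / 2) : ℝ) : ℂ))
      =o[𝓝[>] 0] fun x : ℝ => x ^ (3 / 2 : ℝ)) : a = 0 ∧ b = 0 := by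
  have ha : a = 0 := by
    have h1 := tendsto_mul_rpow_neg_of_isLittleO h (q := -(α / 2)) (by linarith)
    have h2 : Tendsto (fun x : ℝ => a + b * ((x ^ (1 + α) : ℝ) : ℂ)) (𝓝[>] 0) (𝓝 (a + b * 0)) :=
      tendsto_const_nhds.add ((tendsto_ofReal_rpow_nhdsGT_zero (by linarith)).const_mul b)
    rw [mul_zero, add_zero] at h2
    refine tendsto_nhds_unique (h2.congr' ?_) h1
    filter_upwards [self_mem_nhdsWithin] with x hx
    rw [add_mul, mul_assoc, mul_assoc, ← Complex.ofReal_mul, ← Complex.ofReal_mul,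
      ← Real.rpow_add hx, ← Real.rpow_add hx, show -(α / 2) + -(-(α / 2)) = 0 by ring,
      show 1 + α / 2 + -(-(α / 2)) = 1 + α by ring, Real.rpow_zero, Complex.ofReal_one, mul_one]
  refine ⟨ha, ?_⟩
  have h1 := tendsto_mul_rpow_neg_of_isLittleO h (q := 1 + α / 2) (by linarith)
  refine tendsto_nhds_unique (tendsto_const_nhds.congr' ?_) h1
  filter_upwards [self_mem_nhdsWithin] with x hx
  rw [ha, zero_mul, zero_add, mul_assoc, ← Complex.ofReal_mul, ← Real.rpow_add hx,
    add_neg_cancel, Real.rpow_zero, Complex.ofReal_one, mul_one]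

theorem HasOriginExpansion.unique (hα0 : 0 ≤ α) (hα1 : α < 1) {g : HalfLineL2} {a b a' b' : ℂ}
    (h : HasOriginExpansion α g a b) (h' : HasOriginExpansion α g a' b') : a = a' ∧ b = b' := by
  obtain ⟨u, hu, hgu, hlim⟩ := h
  obtain ⟨u', hu', hgu', hlim'⟩ := h'
  have heq : EqOn u u' (Ioi 0) :=
    Measure.eqOn_open_of_ae_eq (hgu.symm.trans hgu') isOpen_Ioi hu hu'
  have := eq_zero_of_isLittleO hα0 hα1 (a := a' - a) (b := b' - b) <| by
    refine (hlim.sub hlim').congr' ?_ EventuallyEq.rfl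
    filter_upwards [self_mem_nhdsWithin] with x hx
    rw [heq hx]
    ring
  exact ⟨(sub_eq_zero.1 this.1).symm, (sub_eq_zero.1 this.2).symm⟩

theorem continuousOn_integral_zero {f : ℝ → ℂ}
    (hf : ∀ r, 0 < r → IntervalIntegrable f volume 0 r) :
    ContinuousOn (fun r => ∫ x in (0 : ℝ)..r, f x) (Ioi 0) := by
  intro r hr
  have hr0 : (0 : ℝ) < r := hr
  have hi : IntegrableOn f (uIcc 0 (r + 1)) := by
    rw [uIcc_of_le (by positivity), integrableOn_Icc_iff_integrableOn_Ioc]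
    exact (intervalIntegrable_iff_integrableOn_Ioc_of_le (by positivity)).1 (hf _ (by positivity))
  have h := intervalIntegral.continuousOn_primitive_interval hi
  refine ((h r ?_).continuousAt ?_).continuousWithinAt
  · rw [uIcc_of_le (by positivity)]
    exact ⟨hr0.le, by linarith⟩
  · rw [uIcc_of_le (by positivity)]
    exact Icc_mem_nhds hr0 (by linarith)

variable (hα0 : 0 ≤ α) (hα1 : α < 1)
include hα0 hα1

theorem continuousOn_volterra {f : ℝ → ℂ} (hf : MemLp f 2 halfLineMeasure) :
    ContinuousOn (volterra α f) (Ioi 0) :=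
  ((Complex.continuous_ofReal.comp_continuousOn (continuousOn_zeroModePhi hα0 hα1)).mul
    (continuousOn_integral_zero fun _ hr => intervalIntegrable_zeroModeF_mul hα0 hα1 hf hr)).sub
  ((Complex.continuous_ofReal.comp_continuousOn (continuousOn_zeroModeF hα0 hα1)).mul
    (continuousOn_integral_zero fun _ hr => intervalIntegrable_zeroModePhi_mul hα0 hα1 hf hr))

/-- Rf contributes ⟨Φ,f⟩F up to the negligible Volterra term, and Φ itself contributes to both
powers. Thus the coordinates (a, ⟨Φ,f⟩) and the two boundary coefficients determine each other
linearly. -/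
theorem hasOriginExpansion_greenOperator_add (f : HalfLineL2) (a : ℂ) :
    HasOriginExpansion α (greenOperator hα0 hα1 f + a • zeroModePhiL2 hα0 hα1) (a * coeffPhi α)
      (a * -(macdonaldConst α * coeffF α) + ⟪zeroModePhiL2 hα0 hα1, f⟫_ℂ * coeffF α) := by
  have hf := Lp.memLp f
  set c : ℂ := ⟪zeroModePhiL2 hα0 hα1, f⟫_ℂ with hc
  have hc' : c = ∫ x in Ioi 0, (zeroModePhi α x : ℂ) * f x :=
    inner_zeroModePhiL2 hα0 hα1 (ae_eq_refl _)
  refine ⟨fun r => volterra α f r + c * zeroModeF α r + a * zeroModePhi α r, ?_, ?_, ?_⟩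
  · exact ((continuousOn_volterra hα0 hα1 hf).add (continuousOn_const.mul
      (Complex.continuous_ofReal.comp_continuousOn (continuousOn_zeroModeF hα0 hα1)))).add
      (continuousOn_const.mul
        (Complex.continuous_ofReal.comp_continuousOn (continuousOn_zeroModePhi hα0 hα1)))
  · filter_upwards [Lp.coeFn_add (greenOperator hα0 hα1 f) (a • zeroModePhiL2 hα0 hα1),
      Lp.coeFn_smul a (zeroModePhiL2 hα0 hα1), coeFn_zeroModePhiL2 hα0 hα1,
      coeFn_greenOperator hα0 hα1 f, ae_restrict_mem measurableSet_Ioi] with r h1 h2 h3 h4 hr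
    rw [h1, Pi.add_apply, h2, Pi.smul_apply, h3, h4, greenIntegral_eq_volterra hα0 hα1 hf hr, hc',
      smul_eq_mul]
  · have h1 := volterra_isLittleO hα0 hα1 hf
    have h2 := (isLittleO_ofReal (zeroModeF_sub_isLittleO hα0 hα1)).const_mul_left c
    have h3 := (isLittleO_ofReal (zeroModePhi_sub_isLittleO hα0 hα1)).const_mul_left a
    refine ((h1.add h2).add h3).congr (fun x => ?_) fun _ => rfl
    push_cast
    ring

/-- The coefficient `β` such that `⟪Φ, f⟫ = β a` is the condition `g₁ = γ g₀` for the element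
`R f + a Φ`. -/
noncomputable def boundaryParameter (α γ : ℝ) : ℝ :=
  (γ * coeffPhi α + macdonaldConst α * coeffF α) / coeffF α

/-- The parameter is affine in γ with slope `coeffPhi α / coeffF α`, which is nonzero. -/
theorem boundaryParameter_surjective : Function.Surjective (boundaryParameter α) := by
  intro β
  have h1 := (coeffPhi_pos hα0 hα1).ne'
  have h2 := (coeffF_pos hα0 hα1).ne'
  refine ⟨(β - macdonaldConst α) * coeffF α / coeffPhi α, ?_⟩
  rw [boundaryParameter]
  field_simp
  ring

theorem mem_boundaryLine_iff {g : HalfLineL2} (hg : g ∈ (zeroModeOperator α)†.domain) (γ : ℝ) :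
    g ∈ boundaryLine (greenOperator hα0 hα1) (zeroModePhiL2 hα0 hα1) (boundaryParameter α γ) ↔
      ∃ g₀ : ℂ, HasOriginExpansion α g g₀ (γ * g₀) := by
  have h := isGreenOperator_greenOperator hα0 hα1
  have hF : (coeffF α : ℂ) ≠ 0 := by exact_mod_cast (coeffF_pos hα0 hα1).ne'
  have key : ∀ a c : ℂ, c = boundaryParameter α γ * a ↔
      a * -(macdonaldConst α * coeffF α) + c * coeffF α = γ * (a * coeffPhi α) := by
    intro a c
    rw [boundaryParameter]
    push_cast
    rw [div_mul_eq_mul_div, eq_div_iff hF]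
    constructor <;> intro h <;> linear_combination h
  constructor
  · rintro ⟨f, a, rfl, hfa⟩
    have := hasOriginExpansion_greenOperator_add hα0 hα1 f a
    rw [(key _ _).1 hfa] at this
    exact ⟨_, this⟩
  · rintro ⟨g₀, hg₀⟩
    obtain ⟨f, a, rfl⟩ := h.mem_adjoint_domain_iff.1 hg
    obtain ⟨h0, h1⟩ := (hasOriginExpansion_greenOperator_add hα0 hα1 f a).unique hα0 hα1 hg₀
    rw [← h0] at h1
    exact ⟨f, a, rfl, (key _ _).2 h1⟩

end OriginExpansion

/-! ### The form domain contains the range of the Green operator -/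

section FormDomain

variable {H : Type*} [NormedAddCommGroup H] [InnerProductSpace ℂ H] [CompleteSpace H]

namespace IsGreenOperator

variable {T : H →ₗ.[ℂ] H} {R : H →L[ℂ] H} {e : H} (h : IsGreenOperator T R e)
include h

omit h [CompleteSpace H] in
theorem operatorForm_le (x : T.domain) : operatorForm T x ≤ (⟪(x : H), T x + x⟫_ℂ).re := by
  rw [operatorForm, inner_add_right, Complex.add_re, le_add_iff_nonneg_right]
  exact inner_self_nonneg (𝕜 := ℂ)

/-- If a sequence normalised by `⟪e, k n⟫ = 1` is asymptotically negligible for the form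
`⟪R f, f⟫`, then the form domain contains the range of `R`. -/
theorem apply_mem_closedFormDomain (hT : IsNonnegOperator T) {k : ℕ → H} {ε : ℕ → ℝ}
    (hε : Tendsto ε atTop (𝓝 0)) (hk : ∀ n, ⟪e, k n⟫_ℂ = 1)
    (hRk : Tendsto (fun n => R (k n)) atTop (𝓝 0)) (hkk : ∀ n m, ‖⟪R (k n), k m⟫_ℂ‖ ≤ ε n)
    (f : H) : R f ∈ closedFormDomain T hT := by
  set c : ℂ := ⟪e, f⟫_ℂ with hc
  -- Subtracting c·k n puts f into the complement of e, where the range of T+1 is dense. This yields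
  -- x n in the domain of T with (T+1)(x n) close to f − c·k n, so x n tends to R f.
  have hortho : ∀ n, ⟪e, f - c • k n⟫_ℂ = 0 := fun n => by
    rw [inner_sub_right, inner_smul_right, hk, mul_one, sub_self]
  choose x hx using fun n : ℕ => h.exists_norm_sub_lt (hortho n)
    (Nat.one_div_pos_of_nat (n := n) (α := ℝ))
  set η : ℕ → H := fun n => T (x n) + x n - (f - c • k n) with hη
  have hη0 : Tendsto η atTop (𝓝 0) :=
    squeeze_zero_norm (fun n => (hx n).le) tendsto_one_div_add_atTop_nhds_zero_nat
  have hT' : ∀ n, T (x n) + x n = f - c • k n + η n := fun n => by simp only [hη]; abel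
  have hxn : ∀ n, (x n : H) = R f - c • R (k n) + R (η n) := fun n => by
    rw [← h.left_inv (x n), hT', map_add, map_sub, map_smul]
  refine ⟨x, ?_, ?_⟩
  · simp only [hxn]
    have h1 := (R.continuous.tendsto 0).comp hη0
    rw [map_zero] at h1
    simpa using ((hRk.const_smul c).const_sub (R f)).add h1
  · have d : ∀ {u : ℕ → H}, Tendsto u atTop (𝓝 0) →
        Tendsto (fun p : ℕ × ℕ => u p.1 - u p.2) atTop (𝓝 0) := fun {u} hu => by
      rw [← sub_zero (0 : H), ← prod_atTop_atTop_eq]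
      exact (hu.comp tendsto_fst).sub (hu.comp tendsto_snd)
    have hε1 : Tendsto (fun p : ℕ × ℕ => ε p.1) atTop (𝓝 0) := by
      rw [← prod_atTop_atTop_eq]; exact hε.comp tendsto_fst
    have hε2 : Tendsto (fun p : ℕ × ℕ => ε p.2) atTop (𝓝 0) := by
      rw [← prod_atTop_atTop_eq]; exact hε.comp tendsto_snd
    have hkk0 : Tendsto (fun p : ℕ × ℕ => ⟪R (k p.1 - k p.2), k p.1 - k p.2⟫_ℂ) atTop (𝓝 0) := by
      have hlim : Tendsto (fun p : ℕ × ℕ => 2 * ε p.1 + 2 * ε p.2) atTop (𝓝 0) := by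
        simpa using (hε1.const_mul 2).add (hε2.const_mul 2)
      refine squeeze_zero_norm (fun p => ?_) hlim
      rw [map_sub, inner_sub_left, inner_sub_right, inner_sub_right]
      have b1 := hkk p.1 p.1
      have b2 := hkk p.1 p.2
      have b3 := hkk p.2 p.1
      have b4 := hkk p.2 p.2
      have n1 := norm_sub_le (⟪R (k p.1), k p.1⟫_ℂ) ⟪R (k p.1), k p.2⟫_ℂ
      have n2 := norm_sub_le (⟪R (k p.2), k p.1⟫_ℂ) ⟪R (k p.2), k p.2⟫_ℂ
      refine (norm_sub_le _ _).trans ?_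
      linarith
    have hRη : Tendsto (fun p : ℕ × ℕ => R (η p.1 - η p.2)) atTop (𝓝 0) := by
      have := (R.continuous.tendsto 0).comp (d hη0)
      rwa [map_zero] at this
    have hRkk : Tendsto (fun p : ℕ × ℕ => R (k p.1 - k p.2)) atTop (𝓝 0) := by
      simpa only [map_sub] using d hRk
    have hmain : Tendsto (fun p : ℕ × ℕ => ⟪(x p.1 - x p.2 : H), T (x p.1 - x p.2) +
        (x p.1 - x p.2 : T.domain)⟫_ℂ) atTop (𝓝 0) := by
      -- The sequence k n need not be bounded, so symmetry is used to make k appear only as R k,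
      -- apart from the term ⟨R k, k⟩ controlled by hypothesis.
      have hexp : ∀ a b : H, ⟪R a - c • R b, a - c • b⟫_ℂ = starRingEnd ℂ c * c * ⟪R b, b⟫_ℂ
          - starRingEnd ℂ c * ⟪R b, a⟫_ℂ - c * ⟪a, R b⟫_ℂ + ⟪R a, a⟫_ℂ := fun a b => by
        rw [inner_sub_left, inner_sub_right, inner_sub_right, inner_smul_left, inner_smul_left,
          inner_smul_right, inner_smul_right, h.symm a b]
        ring
      -- In differences the fixed terms f and R f cancel, leaving only k and the errors η.
      have e1 : ∀ p : ℕ × ℕ, ⟪(x p.1 - x p.2 : H), T (x p.1 - x p.2) +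
          (x p.1 - x p.2 : T.domain)⟫_ℂ = starRingEnd ℂ c * c * ⟪R (k p.1 - k p.2), k p.1 - k p.2⟫_ℂ
            - starRingEnd ℂ c * ⟪R (k p.1 - k p.2), η p.1 - η p.2⟫_ℂ
            - c * ⟪η p.1 - η p.2, R (k p.1 - k p.2)⟫_ℂ
            + ⟪R (η p.1 - η p.2), η p.1 - η p.2⟫_ℂ := fun p => by
        have g1 : (x p.1 - x p.2 : H) = R (η p.1 - η p.2) - c • R (k p.1 - k p.2) := by
          rw [hxn, hxn, R.map_sub (η p.1), R.map_sub (k p.1), smul_sub]; abel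
        have g2 : T (x p.1 - x p.2) + (x p.1 - x p.2 : T.domain)
            = (η p.1 - η p.2) - c • (k p.1 - k p.2) := by
          have a1 := hT' p.1
          have a2 := hT' p.2
          rw [LinearPMap.map_sub, Submodule.coe_sub, smul_sub]
          calc T (x p.1) - T (x p.2) + (x p.1 - x p.2 : H)
              = (T (x p.1) + x p.1) - (T (x p.2) + x p.2) := by abel
            _ = _ := by rw [a1, a2]; abel
        rw [g1, g2]
        exact hexp _ _
      simp only [e1]
      have t1 := hkk0.const_mul (starRingEnd ℂ c * c)
      have t2 := (hRkk.inner (𝕜 := ℂ) (d hη0)).const_mul (starRingEnd ℂ c)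
      have t3 := ((d hη0).inner (𝕜 := ℂ) hRkk).const_mul c
      have t4 := hRη.inner (𝕜 := ℂ) (d hη0)
      have := ((t1.sub t2).sub t3).add t4
      simp only [inner_zero_right, mul_zero, sub_zero, add_zero] at this
      exact this
    have hre := (Complex.continuous_re.tendsto _).comp hmain
    rw [Complex.zero_re] at hre
    exact squeeze_zero (fun p => hT _) (fun p => operatorForm_le _) hre

end IsGreenOperator

end FormDomain

/-! ### Functions concentrated at the origin with negligible form. -/

section ConcentratedSequence

variable {α : ℝ} (hα0 : 0 ≤ α) (hα1 : α < 1)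
include hα0 hα1

variable {κ : ℝ → ℝ} {δ : ℝ} (hκ0 : ∀ x, 0 ≤ κ x) (hκδ : ∀ x, δ < x → κ x = 0)
  (hκ : MemLp (fun x => (κ x : ℂ)) 2 halfLineMeasure)
  (hκ1 : ∫ x in Ioi 0, zeroModePhi α x * κ x = 1)

include hκ in
theorem integrable_zeroModePhi_mul_ofReal :
    Integrable (fun x => zeroModePhi α x * κ x) halfLineMeasure := by
  have := (integrable_zeroModePhi_mul hα0 hα1 hκ).re
  refine this.congr (ae_of_all _ fun x => ?_)
  simp

-- For ρ ≤ δ monotonicity gives G(r,ρ) ≤ Φ(r)F(δ), and Φ(ρ)/Φ(δ) ≥ 1 may be inserted. The integral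
-- of Φκ then appears, and the normalisation makes it 1. Since F/Φ → 0 at the origin, the bound is
-- small for small δ.
include hκ0 hκδ hκ hκ1 in
theorem norm_greenIntegral_le_of_concentrated {r : ℝ} (hr : 0 < r) :
    ‖greenIntegral α (fun x => (κ x : ℂ)) r‖
      ≤ zeroModeF α δ / zeroModePhi α δ * zeroModePhi α r := by
  have hb : ∫ ρ in Ioi 0, zeroModeF α δ / zeroModePhi α δ * zeroModePhi α r
      * (zeroModePhi α ρ * κ ρ) = zeroModeF α δ / zeroModePhi α δ * zeroModePhi α r := by
    rw [integral_const_mul, hκ1, mul_one]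
  rw [← hb, greenIntegral]
  refine norm_integral_le_of_norm_le
    ((integrable_zeroModePhi_mul_ofReal hα0 hα1 hκ).const_mul _) ?_
  filter_upwards [ae_restrict_mem measurableSet_Ioi] with ρ hρ
  have hρ0 : (0 : ℝ) < ρ := hρ
  rcases lt_or_ge δ ρ with hδρ | hδρ
  · simp [hκδ ρ hδρ]
  have hδ : 0 < δ := hρ0.trans_le hδρ
  have p1 := zeroModePhi_pos hα0 hα1 hr
  have p2 := zeroModePhi_pos hα0 hα1 hδ
  have p3 := zeroModeF_pos hα0 hα1 hδ
  rw [norm_mul, Complex.norm_real, Complex.norm_real, Real.norm_of_nonneg (hκ0 ρ),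
    Real.norm_of_nonneg (zeroModeGreen_nonneg hα0 hα1 hr hρ0), ← mul_assoc]
  refine mul_le_mul_of_nonneg_right ?_ (hκ0 ρ)
  have g1 : zeroModeGreen α r ρ ≤ zeroModePhi α r * zeroModeF α δ := by
    rw [zeroModeGreen_eq]
    exact mul_le_mul (zeroModePhi_anti hα0 hα1 hr (le_max_left _ _))
      (zeroModeF_mono hα0 hα1 (lt_min hr hρ0) ((min_le_right _ _).trans hδρ))
      (zeroModeF_pos hα0 hα1 (lt_min hr hρ0)).le p1.le
  have g2 : 1 ≤ zeroModePhi α ρ / zeroModePhi α δ :=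
    (one_le_div p2).2 (zeroModePhi_anti hα0 hα1 hρ0 hδρ)
  calc zeroModeGreen α r ρ ≤ zeroModePhi α r * zeroModeF α δ * 1 := by rwa [mul_one]
    _ ≤ zeroModePhi α r * zeroModeF α δ * (zeroModePhi α ρ / zeroModePhi α δ) :=
        mul_le_mul_of_nonneg_left g2 (by positivity)
    _ = _ := by ring

include hκ0 hκδ hκ hκ1 in
theorem norm_greenOperator_le_of_concentrated :
    ‖greenOperator hα0 hα1 (hκ.toLp _)‖
      ≤ zeroModeF α δ / zeroModePhi α δ * ‖zeroModePhiL2 hα0 hα1‖ := by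
  refine Lp.norm_le_mul_norm_of_ae_le_mul ?_
  filter_upwards [coeFn_greenOperator hα0 hα1 (hκ.toLp _), coeFn_zeroModePhiL2 hα0 hα1,
    ae_restrict_mem measurableSet_Ioi] with r h1 h2 hr
  rw [h1, h2, greenIntegral_congr hκ.coeFn_toLp, Complex.norm_real,
    Real.norm_of_nonneg (zeroModePhi_pos hα0 hα1 hr).le]
  exact norm_greenIntegral_le_of_concentrated hα0 hα1 hκ0 hκδ hκ hκ1 hr

include hκ0 hκδ hκ hκ1 in
theorem norm_inner_greenOperator_le_of_concentrated {κ' : ℝ → ℝ}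
    (hκ0' : ∀ x, 0 ≤ κ' x) (hκ' : MemLp (fun x => (κ' x : ℂ)) 2 halfLineMeasure)
    (hκ1' : ∫ x in Ioi 0, zeroModePhi α x * κ' x = 1) :
    ‖⟪greenOperator hα0 hα1 (hκ.toLp _), hκ'.toLp _⟫_ℂ‖ ≤ zeroModeF α δ / zeroModePhi α δ := by
  have hb : ∫ x in Ioi 0, zeroModeF α δ / zeroModePhi α δ * (zeroModePhi α x * κ' x)
      = zeroModeF α δ / zeroModePhi α δ := by rw [integral_const_mul, hκ1', mul_one]
  rw [inner_eq_setIntegral (coeFn_greenOperator hα0 hα1 _) hκ'.coeFn_toLp, ← hb]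
  refine norm_integral_le_of_norm_le
    ((integrable_zeroModePhi_mul_ofReal hα0 hα1 hκ').const_mul _) ?_
  filter_upwards [ae_restrict_mem measurableSet_Ioi] with x hx
  rw [norm_mul, RCLike.norm_conj, greenIntegral_congr hκ.coeFn_toLp, Complex.norm_real,
    Real.norm_of_nonneg (hκ0' x), ← mul_assoc]
  exact mul_le_mul_of_nonneg_right
    (norm_greenIntegral_le_of_concentrated hα0 hα1 hκ0 hκδ hκ hκ1 hx) (hκ0' x)

theorem tendsto_zeroModeF_div_zeroModePhi :
    Tendsto (fun x => zeroModeF α x / zeroModePhi α x) (𝓝[>] 0) (𝓝 0) := by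
  obtain ⟨C, hC, h⟩ := exists_zeroModeF_le hα0 hα1
  have hp : 0 < 1 + α / 2 := by positivity
  have h1 : Tendsto (fun x : ℝ => C * x ^ (1 + α / 2) / zeroModePhi α 1) (𝓝[>] 0) (𝓝 0) := by
    have := (Real.continuousAt_rpow_const 0 _ (Or.inr hp.le)).tendsto.mono_left
      (nhdsWithin_le_nhds (s := Ioi (0 : ℝ)))
    rw [Real.zero_rpow hp.ne'] at this
    simpa using (this.const_mul C).div_const (zeroModePhi α 1)
  refine tendsto_of_tendsto_of_tendsto_of_le_of_le' tendsto_const_nhds h1 ?_ ?_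
  · filter_upwards [self_mem_nhdsWithin] with x hx
    exact (div_pos (zeroModeF_pos hα0 hα1 hx) (zeroModePhi_pos hα0 hα1 hx)).le
  · filter_upwards [Ioc_mem_nhdsGT zero_lt_one] with x hx
    exact div_le_div₀ (mul_nonneg hC.le (Real.rpow_nonneg hx.1.le _)) (h x hx)
      (zeroModePhi_pos hα0 hα1 one_pos) (zeroModePhi_anti hα0 hα1 hx.1 hx.2)

/-- Positivity of Φ allows the indicator of (0, δ] to be normalised. -/
theorem exists_concentrated {δ : ℝ} (hδ : 0 < δ) : ∃ κ : ℝ → ℝ, (∀ x, 0 ≤ κ x) ∧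
    (∀ x, δ < x → κ x = 0) ∧ MemLp (fun x => (κ x : ℂ)) 2 halfLineMeasure ∧
      ∫ x in Ioi 0, zeroModePhi α x * κ x = 1 := by
  have hI : 0 < ∫ x in Ioc 0 δ, zeroModePhi α x := by
    have hi : IntegrableOn (zeroModePhi α) (Ioc 0 δ) := by
      have h1 : MemLp (zeroModePhi α) 2 (volume.restrict (Ioc 0 δ)) :=
        ((memLp_zeroModePhi hα0 hα1).re).mono_measure
          (Measure.restrict_mono Ioc_subset_Ioi_zero le_rfl)
      exact h1.integrable (by norm_num)
    rw [setIntegral_pos_iff_support_of_nonneg_ae _ hi]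
    · refine lt_of_lt_of_le ?_ (measure_mono (s := Ioc 0 δ) fun x hx =>
        ⟨(zeroModePhi_pos hα0 hα1 hx.1).ne', hx⟩)
      simpa using hδ
    · filter_upwards [ae_restrict_mem measurableSet_Ioc] with x hx
      exact (zeroModePhi_pos hα0 hα1 hx.1).le
  refine ⟨(Ioc 0 δ).indicator fun _ => (∫ x in Ioc 0 δ, zeroModePhi α x)⁻¹,
    fun x => indicator_nonneg (fun _ _ => (inv_pos.2 hI).le) x,
    fun x hx => indicator_of_notMem (fun h => not_le.2 hx h.2) _, ?_, ?_⟩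
  · refine MemLp.ofReal (f := (Ioc 0 δ).indicator fun _ => (∫ x in Ioc 0 δ, zeroModePhi α x)⁻¹) ?_
    refine memLp_indicator_const 2 measurableSet_Ioc _ (Or.inr ?_)
    exact ((Measure.restrict_apply_le _ _).trans_lt (by simp)).ne
  · have e : ∀ x, zeroModePhi α x * (Ioc 0 δ).indicator
        (fun _ => (∫ x in Ioc 0 δ, zeroModePhi α x)⁻¹) x
        = (Ioc 0 δ).indicator (fun x => zeroModePhi α x * (∫ x in Ioc 0 δ, zeroModePhi α x)⁻¹) x :=
      fun x => (indicator_mul_right _ _ _).symm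
    simp only [e]
    rw [setIntegral_indicator measurableSet_Ioc, inter_eq_right.2 Ioc_subset_Ioi_zero,
      integral_mul_const, mul_inv_cancel₀ hI.ne']

theorem greenOperator_mem_closedFormDomain (f : HalfLineL2) :
    greenOperator hα0 hα1 f ∈ closedFormDomain (zeroModeOperator α) (zeroModeOperator_nonneg hα0) := by
  choose κ h0 hδ hm h1 using fun n : ℕ =>
    exists_concentrated hα0 hα1 (Nat.one_div_pos_of_nat (n := n) (α := ℝ))
  have hpos : ∀ n : ℕ, (0 : ℝ) < 1 / (n + 1) := fun n => Nat.one_div_pos_of_nat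
  have hε : Tendsto (fun n : ℕ => zeroModeF α (1 / (n + 1)) / zeroModePhi α (1 / (n + 1))) atTop
      (𝓝 0) :=
    (tendsto_zeroModeF_div_zeroModePhi hα0 hα1).comp (tendsto_nhdsWithin_iff.2
      ⟨tendsto_one_div_add_atTop_nhds_zero_nat, Eventually.of_forall hpos⟩)
  refine (isGreenOperator_greenOperator hα0 hα1).apply_mem_closedFormDomain _
    (k := fun n => (hm n).toLp _) hε (fun n => ?_) ?_ (fun n m => ?_) f
  · rw [inner_zeroModePhiL2 hα0 hα1 (hm n).coeFn_toLp]
    rw [← Complex.ofReal_one, ← h1 n, ← integral_complex_ofReal]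
    refine integral_congr_ae (ae_of_all _ fun x => by simp)
  · refine squeeze_zero_norm (fun n => norm_greenOperator_le_of_concentrated hα0 hα1 (h0 n) (hδ n)
      (hm n) (h1 n)) ?_
    simpa using hε.mul_const ‖zeroModePhiL2 hα0 hα1‖
  · exact norm_inner_greenOperator_le_of_concentrated hα0 hα1 (h0 n) (hδ n) (hm n) (h1 n)
      (h0 m) (hm m) (h1 m)

end ConcentratedSequence

/-! ### The functions `x ^ (1 + α / 2) P` in the range of the Green operator -/

theorem continuousOn_ofReal_rpow_mul {p : ℝ} (hp : 0 ≤ p) {Q : ℝ → ℂ}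
    (hQ : ContinuousOn Q (Ici 0)) : ContinuousOn (fun x : ℝ => ((x ^ p : ℝ) : ℂ) * Q x) (Ici 0) :=
  (Complex.continuous_ofReal.comp (Real.continuous_rpow_const hp)).continuousOn.mul hQ

theorem memLp_of_continuousOn_Ici {g : ℝ → ℂ} (hg : ContinuousOn g (Ici 0)) {N : ℝ}
    (hN : ∀ x, N < x → g x = 0) : MemLp g 2 halfLineMeasure := by
  obtain ⟨M, hM⟩ := isCompact_Icc.exists_bound_of_continuousOn
    (hg.mono (Icc_subset_Ici_self : Icc 0 N ⊆ Ici 0))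
  have hi : MemLp ((Icc 0 N).indicator fun _ => |M|) 2 halfLineMeasure :=
    memLp_indicator_const 2 measurableSet_Icc _
      (Or.inr ((Measure.restrict_apply_le _ _).trans_lt (by simp)).ne)
  refine hi.mono ((hg.mono Ioi_subset_Ici_self).aestronglyMeasurable measurableSet_Ioi) ?_
  filter_upwards [ae_restrict_mem measurableSet_Ioi] with x hx
  by_cases hxN : x ≤ N
  · rw [indicator_of_mem (show x ∈ Icc 0 N from ⟨(mem_Ioi.1 hx).le, hxN⟩), Real.norm_eq_abs, abs_abs]
    exact (hM x ⟨(mem_Ioi.1 hx).le, hxN⟩).trans (le_abs_self M)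
  · rw [hN x (not_le.1 hxN), norm_zero]
    exact norm_nonneg _

section RpowMul

variable {P : ℝ → ℂ} (hP : ContDiffOn ℝ ∞ P (Ici 0))
include hP

theorem contDiffOn_derivWithin_Ici : ContDiffOn ℝ ∞ (derivWithin P (Ici 0)) (Ici 0) :=
  ((contDiffOn_infty_iff_derivWithin (uniqueDiffOn_Ici 0)).1 hP).2

theorem hasDerivAt_of_contDiffOn_Ici {x : ℝ} (hx : 0 < x) :
    HasDerivAt P (derivWithin P (Ici 0) x) x :=
  ((hP.differentiableOn (by simp)) x hx.le).hasDerivWithinAt.hasDerivAt (Ici_mem_nhds hx)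

theorem derivWithin_Ici_eq_zero {N : ℝ} (hN : ∀ x, N < x → P x = 0) {x : ℝ} (hx0 : 0 < x)
    (hx : N < x) : derivWithin P (Ici 0) x = 0 := by
  have e : P =ᶠ[𝓝 x] fun _ => 0 := by
    filter_upwards [lt_mem_nhds hx] with y hy using hN y hy
  exact (hasDerivAt_of_contDiffOn_Ici hP hx0).unique
    ((hasDerivAt_const x 0).congr_of_eventuallyEq e)

theorem hasDerivAt_ofReal_rpow_mul (p : ℝ) {x : ℝ} (hx : 0 < x) :
    HasDerivAt (fun x : ℝ => ((x ^ p : ℝ) : ℂ) * P x)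
      (((p * x ^ (p - 1) : ℝ) : ℂ) * P x + ((x ^ p : ℝ) : ℂ) * derivWithin P (Ici 0) x) x := by
  have h1 := (Real.hasDerivAt_rpow_const (x := x) (p := p) (Or.inl hx.ne')).ofReal_comp
  exact h1.mul (hasDerivAt_of_contDiffOn_Ici hP hx)

variable {α : ℝ} (hα0 : 0 ≤ α) (hα1 : α < 1)
include hα0 hα1

-- P is differentiable at 0 from the right, so P − 1 = O(x), and x^{2+α/2} = o(x^{3/2}).
omit hα1 in
theorem hasOriginExpansion_rpow_mul (hP0 : P 0 = 1)
    (hm : MemLp (fun x : ℝ => ((x ^ (1 + α / 2) : ℝ) : ℂ) * P x) 2 halfLineMeasure) :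
    HasOriginExpansion α (hm.toLp _) 0 1 := by
  refine ⟨_, (continuousOn_ofReal_rpow_mul (by positivity) hP.continuousOn).mono
    Ioi_subset_Ici_self, hm.coeFn_toLp, ?_⟩
  have h1 : (fun x => P x - 1) =O[𝓝[>] 0] fun x : ℝ => x := by
    have := ((hP.differentiableOn (by simp)) 0 self_mem_Ici).isBigO_sub
    simp only [hP0, sub_zero] at this
    exact this.mono (nhdsWithin_mono _ Ioi_subset_Ici_self)
  have h2 : (fun x : ℝ => ((x ^ (1 + α / 2) : ℝ) : ℂ)) =O[𝓝[>] 0] fun x : ℝ => x ^ (1 + α / 2) :=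
    IsBigO.of_bound 1 (Eventually.of_forall fun x => by rw [Complex.norm_real, one_mul])
  have h3 : (fun x : ℝ => x ^ (1 + α / 2) * x) =o[𝓝[>] 0] fun x : ℝ => x ^ (3 / 2 : ℝ) := by
    have h4 : (fun x : ℝ => x ^ (1 / 2 + α / 2)) =o[𝓝[>] 0] fun _ : ℝ => (1 : ℝ) := by
      rw [isLittleO_one_iff]
      have hp : 0 < 1 / 2 + α / 2 := by positivity
      have := (Real.continuousAt_rpow_const 0 _ (Or.inr hp.le)).tendsto.mono_left
        (nhdsWithin_le_nhds (s := Ioi (0 : ℝ)))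
      rwa [Real.zero_rpow hp.ne'] at this
    have h5 := h4.mul_isBigO (isBigO_refl (fun x : ℝ => x ^ (3 / 2 : ℝ)) (𝓝[>] 0))
    refine h5.congr' ?_ (by simp)
    filter_upwards [self_mem_nhdsWithin] with x hx
    rw [← Real.rpow_add hx, ← Real.rpow_add_one (ne_of_gt hx)]
    congr 1
    ring
  refine ((h2.mul h1).trans_isLittleO h3).congr (fun x => ?_) fun _ => rfl
  ring

/-- The candidate f is −u'' + (C_α/x² + 1)u for u = x^s P. With s(s−1) = C_α the singular terms
x^{s−2}P cancel, what remains is continuous up to 0 because s ≥ 1, and the Green representation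
applies. -/
theorem exists_greenOperator_eq_rpow_mul {N : ℝ} (hN : ∀ x, N < x → P x = 0)
    (hm : MemLp (fun x : ℝ => ((x ^ (1 + α / 2) : ℝ) : ℂ) * P x) 2 halfLineMeasure) :
    ∃ f : HalfLineL2, greenOperator hα0 hα1 f = hm.toLp _ := by
  have hN0 : ∀ x, max N 0 < x → P x = 0 := fun x hx => hN x ((le_max_left _ _).trans_lt hx)
  set P1 := derivWithin P (Ici 0) with hP1
  set P2 := derivWithin P1 (Ici 0) with hP2
  have cP1 : ContDiffOn ℝ ∞ P1 (Ici 0) := contDiffOn_derivWithin_Ici hP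
  have cP2 : ContDiffOn ℝ ∞ P2 (Ici 0) := contDiffOn_derivWithin_Ici cP1
  have z1 : ∀ x, max N 0 < x → P1 x = 0 := fun x hx =>
    derivWithin_Ici_eq_zero hP hN0 ((le_max_right _ _).trans_lt hx) hx
  have z2 : ∀ x, max N 0 < x → P2 x = 0 := fun x hx =>
    derivWithin_Ici_eq_zero cP1 z1 ((le_max_right _ _).trans_lt hx) hx
  set s : ℝ := 1 + α / 2 with hs
  have hs0 : 0 < s := by positivity
  have hs1 : 0 ≤ s - 1 := by rw [hs]; linarith
  set f : ℝ → ℂ := fun x => ((x ^ s : ℝ) : ℂ) * P x - ((x ^ (s - 1) : ℝ) : ℂ) * (2 * s * P1 x)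
    - ((x ^ s : ℝ) : ℂ) * P2 x with hf
  have hfm : MemLp f 2 halfLineMeasure := by
    refine memLp_of_continuousOn_Ici (N := max N 0)
      (((continuousOn_ofReal_rpow_mul hs0.le hP.continuousOn).sub
        (continuousOn_ofReal_rpow_mul hs1 (continuousOn_const.mul cP1.continuousOn))).sub
        (continuousOn_ofReal_rpow_mul hs0.le cP2.continuousOn)) fun x hx => ?_
    simp [hf, hN0 x hx, z1 x hx, z2 x hx]
  set u : ℝ → ℂ := fun x => ((x ^ s : ℝ) : ℂ) * P x with hu
  set u1 : ℝ → ℂ := fun x => ((x ^ (s - 1) : ℝ) : ℂ) * (s * P x) + ((x ^ s : ℝ) : ℂ) * P1 x with hu1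
  have d1 : ∀ x, 0 < x → HasDerivAt u (u1 x) x := fun x hx => by
    refine (hasDerivAt_ofReal_rpow_mul hP s hx).congr_deriv ?_
    simp only [hu1]
    push_cast
    ring
  have csP : ContDiffOn ℝ ∞ (fun x => (s : ℂ) * P x) (Ici 0) := contDiffOn_const.mul hP
  have d2 : ∀ x, 0 < x → HasDerivAt u1 (((s * (s - 1) * x ^ (s - 2) : ℝ) : ℂ) * P x
      + ((x ^ (s - 1) : ℝ) : ℂ) * (2 * s * P1 x) + ((x ^ s : ℝ) : ℂ) * P2 x) x := fun x hx => by
    have e : derivWithin (fun x => (s : ℂ) * P x) (Ici 0) x = s * P1 x :=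
      (hasDerivAt_of_contDiffOn_Ici csP hx).unique
        ((hasDerivAt_of_contDiffOn_Ici hP hx).const_mul (s : ℂ))
    refine ((hasDerivAt_ofReal_rpow_mul csP (s - 1) hx).add
      (hasDerivAt_ofReal_rpow_mul cP1 s hx)).congr_deriv ?_
    rw [e, show s - 1 - 1 = s - 2 by ring]
    push_cast
    ring
  have hfu : ∀ x, 0 < x → f x = -(((s * (s - 1) * x ^ (s - 2) : ℝ) : ℂ) * P x
      + ((x ^ (s - 1) : ℝ) : ℂ) * (2 * s * P1 x) + ((x ^ s : ℝ) : ℂ) * P2 x)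
      + ((1 + couplingConst α / x ^ 2 : ℝ) : ℂ) * u x := fun x hx => by
    have e : s * (s - 1) * x ^ (s - 2) = couplingConst α / x ^ 2 * x ^ s := by
      rw [Real.rpow_sub hx, Real.rpow_two, couplingConst, hs]
      ring
    rw [e]
    simp only [hf, hu]
    push_cast
    ring
  have tu : Tendsto u (𝓝[>] 0) (𝓝 0) := by
    have := (continuousOn_ofReal_rpow_mul hs0.le hP.continuousOn) 0 self_mem_Ici
    have h0 := this.tendsto.mono_left (nhdsWithin_mono _ Ioi_subset_Ici_self)
    rwa [Real.zero_rpow hs0.ne', Complex.ofReal_zero, zero_mul] at h0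
  have tu1 : Tendsto u1 (𝓝[>] 0) (𝓝 (u1 0)) := by
    have := ((continuousOn_ofReal_rpow_mul hs1 csP.continuousOn).add
      (continuousOn_ofReal_rpow_mul hs0.le cP1.continuousOn)) 0 self_mem_Ici
    exact this.tendsto.mono_left (nhdsWithin_mono _ Ioi_subset_Ici_self)
  have tF : Tendsto (fun x => (zeroModeF α x : ℂ)) (𝓝[>] 0) (𝓝 0) := by
    obtain ⟨C, hC, hCF⟩ := exists_zeroModeF_le hα0 hα1
    have := ((tendsto_ofReal_rpow_nhdsGT_zero hs0).const_mul (C : ℂ)).norm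
    rw [mul_zero, norm_zero] at this
    refine squeeze_zero_norm' ?_ this
    filter_upwards [Ioc_mem_nhdsGT zero_lt_one] with x hx
    rw [norm_mul, Complex.norm_real, Complex.norm_real, Complex.norm_real,
      Real.norm_of_nonneg (zeroModeF_pos hα0 hα1 hx.1).le, Real.norm_of_nonneg hC.le,
      Real.norm_of_nonneg (Real.rpow_nonneg hx.1.le _)]
    exact hCF x hx
  have bF : IsBoundedUnder (· ≤ ·) (𝓝[>] 0) (norm ∘ fun x => (zeroModeFDeriv α x : ℂ)) := by
    obtain ⟨C, hC, hCF⟩ := exists_zeroModeFDeriv_le hα0 hα1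
    refine ⟨C, eventually_map.2 ?_⟩
    filter_upwards [Ioc_mem_nhdsGT zero_lt_one] with x hx
    rw [Function.comp_apply, Complex.norm_real,
      Real.norm_of_nonneg (zeroModeFDeriv_pos hα0 hα1 hx.1).le]
    exact (hCF x hx).trans (mul_le_of_le_one_right hC.le
      (Real.rpow_le_one hx.1.le hx.2 (by positivity)))
  -- The boundary term at 0 vanishes because F' is bounded and u → 0, while F → 0 and u' has a
  -- limit.
  have hW : Tendsto (fun x => zeroModeFDeriv α x * u x - zeroModeF α x * u1 x) (𝓝[>] 0) (𝓝 0) := by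
    simpa using (isBoundedUnder_le_mul_tendsto_zero bF tu).sub (tF.mul tu1)
  refine ⟨hfm.toLp f, Lp.ext ?_⟩
  filter_upwards [coeFn_greenOperator hα0 hα1 (hfm.toLp f), hm.coeFn_toLp,
    ae_restrict_mem measurableSet_Ioi] with r h1 h2 hr
  rw [h1, h2, greenIntegral_congr hfm.coeFn_toLp,
    greenIntegral_eq_of_tendsto hα0 hα1 d1 d2 (N := max N 0) (fun x hx => by simp [hu, hN0 x hx])
      hfm hfu hW hr]

end RpowMul

/-! ### The domain of the Friedrichs extension -/

section FriedrichsDomain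

variable {α : ℝ} (hα0 : 0 ≤ α) (hα1 : α < 1)
include hα0 hα1

theorem zeroModeFriedrichs_domain_eq {P : ℝ → ℂ} (hP : ContDiffOn ℝ ∞ P (Ici 0)) {N : ℝ}
    (hN : ∀ x, N < x → P x = 0) (hP0 : P 0 = 1)
    (hm : MemLp (fun x : ℝ => ((x ^ (1 + α / 2) : ℝ) : ℂ) * P x) 2 halfLineMeasure) :
    (zeroModeFriedrichs hα0).domain =
      (zeroModeOperator α).closure.domain ⊔ Submodule.span ℂ {hm.toLp _} := by
  have h := isGreenOperator_greenOperator hα0 hα1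
  obtain ⟨f, hf⟩ := exists_greenOperator_eq_rpow_mul hP hα0 hα1 hN hm
  -- If f were orthogonal to Φ, the coefficient of x^{1+α/2} in the expansion of Rf would be 0,
  -- whereas it is P(0) = 1.
  have hne : ⟪zeroModePhiL2 hα0 hα1, f⟫_ℂ ≠ 0 := by
    intro h0
    have h1 := hasOriginExpansion_greenOperator_add hα0 hα1 f 0
    rw [zero_smul, add_zero, hf, h0, zero_mul, zero_mul, zero_mul, add_zero] at h1
    exact zero_ne_one (h1.unique hα0 hα1 (hasOriginExpansion_rpow_mul hP hα0 hP0 hm)).2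
  rw [zeroModeFriedrichs, h.friedrichs_domain hne _
    (greenOperator_mem_closedFormDomain hα0 hα1 f), h.range_eq hne, hf]

end FriedrichsDomain

theorem greenOperator_zeroModePhiL2 {α : ℝ} (hα0 : 0 ≤ α) (hα1 : α < 1)
    (hΨ : MemLp (fun x => (zeroModePsi α x : ℂ)) 2 halfLineMeasure) :
    hΨ.toLp _ = greenOperator hα0 hα1 (zeroModePhiL2 hα0 hα1) := by
  refine Lp.ext ?_
  filter_upwards [hΨ.coeFn_toLp, coeFn_greenOperator hα0 hα1 (zeroModePhiL2 hα0 hα1)] with x h1 h2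
  rw [h1, h2, greenIntegral_congr (coeFn_zeroModePhiL2 hα0 hα1), ofReal_zeroModePsi hα0 hα1]

theorem mainTheorem5 (α : ℝ) (hα0 : 0 ≤ α) (hα1 : α < 1) :
    -- the adjoint is the maximal realisation of the differential operator
    (∀ g : HalfLineL2, g ∈ (zeroModeOperator α)†.domain ↔
      ∃ h : ℝ → ℂ, HasWeakSecondDeriv g h ∧
        MemLp (fun x => -h x + ((α * (2 + α) / (4 * x ^ 2) : ℝ) : ℂ) * g x) 2 halfLineMeasure) ∧
    (∀ (g : (zeroModeOperator α)†.domain) (h : ℝ → ℂ), HasWeakSecondDeriv (g : HalfLineL2) h →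
      (zeroModeOperator α)† g =ᵐ[halfLineMeasure]
        fun x => -h x + ((α * (2 + α) / (4 * x ^ 2) : ℝ) : ℂ) * (g : HalfLineL2) x) ∧
    -- smoothness of `Φ` and `Ψ`, decomposition of the adjoint domain, kernel of `A* + 1`
    ContDiffOn ℝ ∞ (zeroModePhi α) (Ioi 0) ∧
    ContDiffOn ℝ ∞ (zeroModePsi α) (Ioi 0) ∧
    (∃ (hΦ : MemLp (fun x => (zeroModePhi α x : ℂ)) 2 halfLineMeasure)
       (hΨ : MemLp (fun x => (zeroModePsi α x : ℂ)) 2 halfLineMeasure),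
      (zeroModeOperator α)†.domain =
        (zeroModeOperator α).closure.domain ⊔ Submodule.span ℂ {hΨ.toLp} ⊔
          Submodule.span ℂ {hΦ.toLp} ∧
      iSupIndep ![(zeroModeOperator α).closure.domain, Submodule.span ℂ {hΨ.toLp},
        Submodule.span ℂ {hΦ.toLp}] ∧
      operatorKer (shiftByOne (zeroModeOperator α)†) = Submodule.span ℂ {hΦ.toLp}) ∧
    -- the self-adjoint extensions
    (∃ Aext : OnePoint ℝ → (HalfLineL2 →ₗ.[ℂ] HalfLineL2),
      {B | zeroModeOperator α ≤ B ∧ IsSelfAdjoint B} = range Aext ∧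
      Aext OnePoint.infty = zeroModeFriedrichs hα0 ∧
      ∀ (γ : ℝ) (g : HalfLineL2), g ∈ (Aext γ).domain ↔
        g ∈ (zeroModeOperator α)†.domain ∧ ∃ g₀ : ℂ, HasOriginExpansion α g g₀ (γ * g₀)) ∧
    -- the domain of the Friedrichs extension
    (∀ P : ℝ → ℂ, ContDiffOn ℝ ∞ P (Ici 0) → (∃ r : ℝ, ∀ x, r < x → P x = 0) → P 0 = 1 →
      ∃ hP : MemLp (fun x : ℝ => ((x ^ (1 + α / 2) : ℝ) : ℂ) * P x) 2 halfLineMeasure,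
        (zeroModeFriedrichs hα0).domain =
          (zeroModeOperator α).closure.domain ⊔ Submodule.span ℂ {hP.toLp}) ∧
    -- the resolvent of the Friedrichs extension at `-1`
    (∃ R : HalfLineL2 →L[ℂ] HalfLineL2, HasIntegralKernel R (zeroModeGreen α) ∧
      operatorKer (shiftByOne (zeroModeFriedrichs hα0)) = ⊥ ∧
      (shiftByOne (zeroModeFriedrichs hα0)).inverse = (R : HalfLineL2 →ₗ[ℂ] HalfLineL2).toPMap ⊤) := by

  have h := isGreenOperator_greenOperator hα0 hα1
  have hQ := greenOperator_mem_closedFormDomain hα0 hα1 (zeroModePhiL2 hα0 hα1)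
  have hV : ∀ x : ℝ, α * (2 + α) / (4 * x ^ 2) = couplingConst α / x ^ 2 := fun x => by
    rw [couplingConst, div_div]
  simp only [hV]
  refine ⟨fun g => mem_adjoint_domain_iff_hasWeakSecondDeriv, fun g h hh => adjoint_ae_eq g hh,
    contDiffOn_zeroModePhi hα0 hα1, contDiffOn_zeroModePsi hα0 hα1, ?_, ?_, ?_, ?_⟩
  · have hΨ : MemLp (fun x => (zeroModePsi α x : ℂ)) 2 halfLineMeasure :=
      (memLp_greenIntegral hα0 hα1 (memLp_zeroModePhi hα0 hα1)).ae_eq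
        (ae_of_all _ fun x => (ofReal_zeroModePsi hα0 hα1 x).symm)
    refine ⟨memLp_zeroModePhi hα0 hα1, hΨ, ?_⟩
    rw [greenOperator_zeroModePhiL2 hα0 hα1 hΨ]
    exact ⟨h.adjoint_domain_eq, h.iSupIndep_domains, h.operatorKer_adjoint⟩
  -- The point at infinity is assigned the condition a = 0, and a real γ the condition ⟨Φ,f⟩ = βa
  -- with the value of β that encodes γ at the origin.
  · set S : OnePoint ℝ → Submodule ℂ HalfLineL2 := fun γ => γ.elim
      (LinearMap.range (greenOperator hα0 hα1 : HalfLineL2 →ₗ[ℂ] HalfLineL2)) fun γ =>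
        boundaryLine (greenOperator hα0 hα1) (zeroModePhiL2 hα0 hα1) (boundaryParameter α γ)
    refine ⟨fun γ => (zeroModeOperator α)†.domRestrict (S γ), ?_, ?_, fun γ g => ?_⟩
    · ext B
      rw [mem_ofPred_eq, h.isSelfAdjoint_extension_iff, mem_range, OnePoint.exists]
      refine or_congr eq_comm ?_
      rw [(boundaryParameter_surjective hα0 hα1).exists (p := fun β => B =
        (zeroModeOperator α)†.domRestrict
          (boundaryLine (greenOperator hα0 hα1) (zeroModePhiL2 hα0 hα1) β))]
      exact exists_congr fun γ => eq_comm
    · exact (h.friedrichs_eq h.inner_self_ne_zero _ hQ).symm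
    · rw [LinearPMap.domRestrict_domain, Submodule.mem_inf, and_comm]
      exact and_congr_right fun hg => mem_boundaryLine_iff hα0 hα1 hg γ
  · rintro P hP ⟨N, hN⟩ hP0
    have hm : MemLp (fun x : ℝ => ((x ^ (1 + α / 2) : ℝ) : ℂ) * P x) 2 halfLineMeasure :=
      memLp_of_continuousOn_Ici (continuousOn_ofReal_rpow_mul (by positivity) hP.continuousOn)
        (N := N) fun x hx => by rw [hN x hx, mul_zero]
    exact ⟨hm, zeroModeFriedrichs_domain_eq hα0 hα1 hP hN hP0 hm⟩
  · exact ⟨greenOperator hα0 hα1, hasIntegralKernel_greenOperator hα0 hα1,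
      h.operatorKer_friedrichs h.inner_self_ne_zero _ hQ,
      h.inverse_friedrichs h.inner_self_ne_zero _ hQ⟩
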